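/- Let $n\ge 0$ be an integer and let $$B_n=\left\langle \sigma_1,\dots,\sigma_{n-1}\ \middle|\ \sigma_i\sigma_{i+1}\sigma_i=\sigma_{i+1}\sigma_i\sigma_{i+1},\ \ \sigma_i\sigma_j=\sigma_j\sigma_i \text{ if } |i-j|>1\right\rangle$$ be the braid group on $n$ strings. For a group $G$, the Hurwitz action is the left action of $B_n$ on $G^n$ determined by $$\sigma_i\cdot(g_1,\dots,g_n)=(g_1,\dots,g_{i-1},\,g_ig_{i+1}g_i^{-1},\,g_i,\,g_{i+2},\dots,g_n).$$ For $A\subseteq G$ and $g\in G$, let $\operatorname{Red}_A(g)$ be the set of reduced $A$-decompositions of $g$, that is, of the sequences $(a_1,\dots,a_m)$ of elements of $A$ with $a_1\cdots a_m=g$ whose length $m$ is the smallest possible. Let $y_1<\dots<y_n$ be real numbers, $x_j=\sqrt{-1}\,y_j$ for $1\le j\le n$, $x_0=-1$, and $$F_n=\pi_1(\mathbb{C}\setminus\{x_1,\dots,x_n\},x_0),$$ where $ab$ denotes the class of a loop representing $a$ followed by a loop representing $b$. A connecting path is a continuous map $\gamma:[0,1]\to\mathbb{C}$ with $\gamma(0)=x_0$,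 $\gamma(1)\in\{x_1,\dots,x_n\}$ and $\gamma(t)\notin\{x_1,\dots,x_n\}$ for $t\ne 1$. It defines $r_\gamma\in F_n$, the class of the loop that follows $\gamma$ until it is close to $\gamma(1)$, makes one positive turn on a small circle centred at $\gamma(1)$, and returns to $x_0$ along $\gamma$. The set of braid reflections is $R=\{r_\gamma \mid \gamma \text{ a connecting path}\}$. Let $f_j=r_{[x_0,x_j]}$, where $[x_0,x_j]$ is the straight segment, and let $g=f_1\cdots f_n$. Let $W_n=\langle s_1,\dots,s_n\mid s_i^2=1\rangle$ be the universal Coxeter group. There is a unique homomorphism $\pi:F_n\to W_n$ with $\pi(f_j)=s_j$ for all $j$, and it is surjective. Let $T=\pi(R)$ be the set of reflections of $W_n$, and let $c=\pi(g)=s_1\cdots s_n$. Then the reduced $R$-decompositions of $g$ and the reduced $T$-decompositions of $c$ all have length $n$, and: 1. $\operatorname{Red}_R(g)$ is non-empty and stable under the Hurwitz action of $B_n$ on $F_n^n$, and $B_n$ acts simply transitively on it. 2. $\operatorname{Red}_T(c)$ is non-empty and stable under the Hurwitz action of $B_n$ on $W_n^n$, and $B_n$ acts simply transitively on it. 3.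 The map $\pi^n:(r_1,\dots,r_n)\mapsto(\pi(r_1),\dots,\pi(r_n))$ is an isomorphism of $B_n$-sets from $\operatorname{Red}_R(g)$ to $\operatorname{Red}_T(c)$: it is a bijection between these sets and commutes with the action of $B_n$. -/

import Mathlib

noncomputable section

/-! ### The braid group and the Hurwitz action -/

/-- The relators of the braid group on `n` strings: `σ i` for `i = 0, …, n - 2`, with
`σ i σ j σ i = σ j σ i σ j` if `j = i + 1` and `σ i σ j = σ j σ i` if `|i - j| > 1`. -/
def braidRels (n : ℕ) : Set (FreeGroup (Fin (n - 1))) :=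
  {r | ∃ i j : Fin (n - 1),
    ((i : ℕ) + 1 = j ∧
      r = FreeGroup.of i * FreeGroup.of j * FreeGroup.of i *
        (FreeGroup.of j * FreeGroup.of i * FreeGroup.of j)⁻¹) ∨
    (((i : ℕ) + 1 < j ∨ (j : ℕ) + 1 < i) ∧
      r = FreeGroup.of i * FreeGroup.of j * (FreeGroup.of j * FreeGroup.of i)⁻¹)}

/-- The usual braid group `B_n`. -/
abbrev BraidGroup (n : ℕ) : Type := PresentedGroup (braidRels n)

/-- The elementary Hurwitz move
`(g_1, …, g_n) ↦ (g_1, …, g_{i-1}, g_i g_{i+1} g_i⁻¹, g_i, g_{i+2}, …, g_n)`,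
a permutation of `G ^ n`. -/
def hurwitzMove (n : ℕ) (G : Type*) [Group G] (i : Fin (n - 1)) :
    Equiv.Perm (Fin n → G) where
  toFun g k :=
    if (k : ℕ) = i then
      g ⟨i, by omega⟩ * g ⟨i + 1, by omega⟩ * (g ⟨i, by omega⟩)⁻¹
    else if (k : ℕ) = i + 1 then g ⟨i, by omega⟩
    else g k
  invFun g k :=
    if (k : ℕ) = i then g ⟨i + 1, by omega⟩
    else if (k : ℕ) = i + 1 then
      (g ⟨i + 1, by omega⟩)⁻¹ * g ⟨i, by omega⟩ * g ⟨i + 1, by omega⟩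
    else g k
  left_inv g := by
    funext k
    by_cases h1 : (k : ℕ) = i
    · have : g k = g ⟨i, by omega⟩ := congrArg g (Fin.ext h1)
      simp [h1, this]
    · by_cases h2 : (k : ℕ) = i + 1
      · have : g k = g ⟨i + 1, by omega⟩ := congrArg g (Fin.ext h2)
        simp [h2, this, mul_assoc]
      · simp [h1, h2]
  right_inv g := by
    funext k
    by_cases h1 : (k : ℕ) = i
    · have : g k = g ⟨i, by omega⟩ := congrArg g (Fin.ext h1)
      simp [h1, this, mul_assoc]
    · by_cases h2 : (k : ℕ) = i + 1
      · have : g k = g ⟨i + 1, by omega⟩ := congrArg g (Fin.ext h2)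
        simp [h2, this]
      · simp [h1, h2]

theorem hurwitzMove_apply (n : ℕ) (G : Type*) [Group G] (i : Fin (n - 1)) (g : Fin n → G)
    (k : Fin n) :
    hurwitzMove n G i g k =
      if (k : ℕ) = i then
        g ⟨i, by omega⟩ * g ⟨i + 1, by omega⟩ * (g ⟨i, by omega⟩)⁻¹
      else if (k : ℕ) = i + 1 then g ⟨i, by omega⟩
      else g k := rfl

theorem hurwitzMove_rels (n : ℕ) (G : Type*) [Group G] :
    ∀ r ∈ braidRels n, FreeGroup.lift (hurwitzMove n G) r = 1 := by
  rintro r ⟨i, j, ⟨h, rfl⟩ | ⟨h, rfl⟩⟩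
  · simp only [map_mul, map_inv, FreeGroup.lift_apply_of, mul_inv_eq_one]
    ext g k
    have hj := j.2
    have e1 : ¬ (i : ℕ) = i + 1 + 1 := by omega
    have e2 : ¬ (i : ℕ) + 1 + 1 = i := by omega
    simp only [Equiv.Perm.mul_apply, hurwitzMove_apply, ← h]
    by_cases h1 : (k : ℕ) = i
    · simp [h1, e1, e2, mul_assoc]
    · by_cases h2 : (k : ℕ) = i + 1
      · simp [h2, e1, e2]
      · by_cases h3 : (k : ℕ) = i + 1 + 1
        · simp [h3, e1, e2]
        · simp [h1, h2, h3]
  · simp only [map_mul, map_inv, FreeGroup.lift_apply_of, mul_inv_eq_one]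
    ext g k
    simp only [Equiv.Perm.mul_apply, hurwitzMove_apply]
    have e1 : ¬ (i : ℕ) = j := by omega
    have e2 : ¬ (i : ℕ) = j + 1 := by omega
    have e3 : ¬ (j : ℕ) = i + 1 := by omega
    have e4 : ¬ (j : ℕ) = i := by omega
    have e5 : ¬ (i : ℕ) + 1 = j := by omega
    have e6 : ¬ (j : ℕ) + 1 = i := by omega
    by_cases h1 : (k : ℕ) = i
    · simp [h1, e1, e2, e5]
    · by_cases h2 : (k : ℕ) = i + 1
      · simp [h2, e1, e2, e5]
      · simp [h1, h2, e3, e4, e6]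

/-- The Hurwitz action of `B_n` on `G ^ n`. -/
def hurwitz (n : ℕ) (G : Type*) [Group G] : BraidGroup n →* Equiv.Perm (Fin n → G) :=
  PresentedGroup.toGroup (f := hurwitzMove n G) (hurwitzMove_rels n G)

/-- An action of `B` on `X`, given as a homomorphism, restricts to a simply transitive action
on the subset `S`. -/
def IsSimplyTransitiveOn {B X : Type*} [Group B] (φ : B →* Equiv.Perm X) (S : Set X) : Prop :=
  S.Nonempty ∧ (∀ b, ∀ x ∈ S, φ b x ∈ S) ∧ ∀ x ∈ S, ∀ x' ∈ S, ∃! b, φ b x = x'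

/-- `t` is a decomposition of `g` as a product of elements of `A`. -/
def IsDecomposition {G : Type*} [Group G] (A : Set G) (g : G) {m : ℕ} (t : Fin m → G) : Prop :=
  (∀ i, t i ∈ A) ∧ (List.ofFn t).prod = g

/-- The reduced decompositions of `g` as a product of elements of `A` (those of minimal length),
where that minimal length is `n`. -/
def Red {G : Type*} [Group G] (A : Set G) (g : G) (n : ℕ) : Set (Fin n → G) :=
  {t | IsDecomposition A g t ∧
    ∀ (m : ℕ) (u : Fin m → G), IsDecomposition A g u → n ≤ m}

/-! ### The fundamental group of the punctured plane and its braid reflections -/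

/-- The points `x_1, …, x_n`, on the imaginary axis. -/
def puncture {n : ℕ} (y : Fin n → ℝ) (j : Fin n) : ℂ := (y j : ℂ) * Complex.I

/-- The punctured plane `ℂ - {x_1, …, x_n}`. -/
abbrev PuncturedPlane {n : ℕ} (y : Fin n → ℝ) : Type := {z : ℂ // ∀ j, z ≠ puncture y j}

/-- The base point `x_0 = -1`. -/
def basePoint {n : ℕ} (y : Fin n → ℝ) : PuncturedPlane y :=
  ⟨-1, fun j h => by simpa [puncture] using congrArg Complex.re h⟩

/-- The group `F_n = π₁(ℂ - {x_1, …, x_n}, x_0)`. The product `a * b` means: follow `a`, then `b`.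
(Multiplication in Mathlib's `FundamentalGroup` is in the opposite order.) -/
abbrev LoopGroup {n : ℕ} (y : Fin n → ℝ) : Type :=
  (FundamentalGroup (PuncturedPlane y) (basePoint y))ᵐᵒᵖ

/-- A connecting path: it goes from `x_0` to one of the points `x_j`, and avoids
`x_1, …, x_n` before its end. -/
structure ConnectingPath {n : ℕ} (y : Fin n → ℝ) where
  idx : Fin n
  path : Path (-1 : ℂ) (puncture y idx)
  avoids : ∀ t : unitInterval, t ≠ 1 → ∀ k, path t ≠ puncture y k

namespace ConnectingPath

variable {n : ℕ} {y : Fin n → ℝ}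

/-- From time `t` on, `γ` stays in the open disc centred at its end point `γ(1)` whose radius is
the distance from `γ(1)` to the nearest other puncture (the whole plane if there is no other
puncture). -/
def IsCloseAt (γ : ConnectingPath y) (t : unitInterval) : Prop :=
  ∀ s, t ≤ s → ∀ k, puncture y k ≠ puncture y γ.idx →
    ‖γ.path s - puncture y γ.idx‖ < ‖puncture y k - puncture y γ.idx‖

theorem exists_isCloseAt (γ : ConnectingPath y) : ∃ t : unitInterval, t ≠ 1 ∧ γ.IsCloseAt t := by
  have h : ∀ᶠ s in nhds (1 : unitInterval), ∀ k, puncture y k ≠ puncture y γ.idx →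
      ‖γ.path s - puncture y γ.idx‖ < ‖puncture y k - puncture y γ.idx‖ := by
    rw [Filter.eventually_all]
    intro k
    by_cases hk : puncture y k = puncture y γ.idx
    · simp [hk]
    · have hc : Continuous fun s => ‖γ.path s - puncture y γ.idx‖ := by fun_prop
      have h0 : ‖γ.path 1 - puncture y γ.idx‖ < ‖puncture y k - puncture y γ.idx‖ := by
        simpa [sub_eq_zero] using hk
      filter_upwards [hc.continuousAt.eventually_lt continuousAt_const h0] with s hs _ using hs
  obtain ⟨l, hl, hs⟩ := exists_Ioc_subset_of_mem_nhds h ⟨0, zero_lt_one⟩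
  obtain ⟨t, hlt, ht1⟩ := exists_between hl
  exact ⟨t, ht1.ne, fun s hts => hs ⟨hlt.trans_le hts, unitInterval.le_one'⟩⟩

/-- The point `γ(t)`, for `t ≠ 1`, as a point of the punctured plane. -/
def point (γ : ConnectingPath y) (t : unitInterval) (ht : t ≠ 1) : PuncturedPlane y :=
  ⟨γ.path t, γ.avoids t ht⟩

/-- The part of `γ` from time `0` to time `t ≠ 1`. -/
def initialPath (γ : ConnectingPath y) (t : unitInterval) (ht : t ≠ 1) :
    Path (basePoint y) (γ.point t ht) where
  toFun s := ⟨γ.path (s * t), γ.avoids _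
    (ne_of_lt (lt_of_le_of_lt unitInterval.mul_le_right (lt_of_le_of_ne unitInterval.le_one' ht)))⟩
  continuous_toFun := by fun_prop
  source' := Subtype.ext (by simp [basePoint])
  target' := Subtype.ext (by simp [point])

/-- The positive turn around the circle centred at `γ(1)` that starts at `γ(t)`. -/
def circleLoop (γ : ConnectingPath y) (t : unitInterval) (ht : t ≠ 1) (hc : γ.IsCloseAt t) :
    Path (γ.point t ht) (γ.point t ht) where
  toFun s := ⟨puncture y γ.idx +
      (γ.path t - puncture y γ.idx) * Complex.exp ((2 * Real.pi * (s : ℝ) : ℝ) * Complex.I), by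
    intro k hk
    have h1 : (γ.path t - puncture y γ.idx) *
        Complex.exp ((2 * Real.pi * (s : ℝ) : ℝ) * Complex.I) =
        puncture y k - puncture y γ.idx := eq_sub_of_add_eq' hk
    have h2 := congrArg norm h1
    rw [norm_mul, Complex.norm_exp_ofReal_mul_I, mul_one] at h2
    by_cases hkj : puncture y k = puncture y γ.idx
    · rw [hkj, sub_self, norm_zero, norm_eq_zero, sub_eq_zero] at h2
      exact γ.avoids t ht _ h2
    · exact (hc t le_rfl k hkj).ne h2⟩
  continuous_toFun := by fun_prop
  source' := Subtype.ext (by simp [point])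
  target' := Subtype.ext (by simp [point])

/-- The class of the loop that follows `γ` up to time `t`, makes a positive turn around the circle
through `γ(t)` centred at `γ(1)`, and returns along `γ`. -/
def lasso (γ : ConnectingPath y) (t : unitInterval) (ht : t ≠ 1) (hc : γ.IsCloseAt t) :
    LoopGroup y :=
  MulOpposite.op (FundamentalGroup.fromPath (Path.Homotopic.Quotient.mk
    (((γ.initialPath t ht).trans (γ.circleLoop t ht hc)).trans (γ.initialPath t ht).symm)))

/-- The element `r_γ` of `F_n`. The class of the lasso is the same for every admissible time `t`;
some such time is used here. -/
def reflection (γ : ConnectingPath y) : LoopGroup y :=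
  γ.lasso γ.exists_isCloseAt.choose γ.exists_isCloseAt.choose_spec.1
    γ.exists_isCloseAt.choose_spec.2

/-- The straight segment from `x_0` to `x_j`. -/
def segment (y : Fin n → ℝ) (j : Fin n) : ConnectingPath y where
  idx := j
  path :=
    { toFun := fun s => (1 - (s : ℝ) : ℝ) * (-1 : ℂ) + ((s : ℝ) : ℂ) * puncture y j
      continuous_toFun := by fun_prop
      source' := by simp
      target' := by simp }
  avoids t ht k h := by
    have h1 : ((1 - (t : ℝ) : ℝ) * (-1 : ℂ) + ((t : ℝ) : ℂ) * puncture y j).re =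
        (puncture y k).re := congrArg Complex.re h
    have h2 : (t : ℝ) = 1 := by
      simp [puncture] at h1
      linarith
    exact ht (Subtype.ext h2)

end ConnectingPath

/-- The set `R` of braid reflections of `F_n`. -/
def braidReflections {n : ℕ} (y : Fin n → ℝ) : Set (LoopGroup y) :=
  {r | ∃ γ : ConnectingPath y, r = γ.reflection}

/-- The standard braid reflections `f_1, …, f_n`. -/
def stdReflection {n : ℕ} (y : Fin n → ℝ) (j : Fin n) : LoopGroup y :=
  (ConnectingPath.segment y j).reflection

/-- The element `g = f_1 ⋯ f_n`. -/
def stdElement {n : ℕ} (y : Fin n → ℝ) : LoopGroup y :=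
  (List.ofFn (stdReflection y)).prod

/-! ### The universal Coxeter group -/

/-- The universal Coxeter group `W_n = ⟨s_1, …, s_n | s_i² = 1⟩`. -/
abbrev UniversalCoxeterGroup (n : ℕ) : Type :=
  PresentedGroup (Set.range fun i : Fin n => (FreeGroup.of i : FreeGroup (Fin n)) ^ 2)

/-- The generators `s_1, …, s_n` of `W_n`. -/
def coxeterGen (n : ℕ) (i : Fin n) : UniversalCoxeterGroup n := PresentedGroup.of i

end

/-! Topology enters through two facts: the fundamental group is free on the `f_j`, and `R` is the
set of all conjugates of the `f_j`. For the first, slit the plane along horizontal half-lines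
issuing from the punctures, all to the right or all to the left. The two slit planes are
contractible, open, and meet in n + 1 horizontal strips. A covering glued by a function constant on
each strip yields a homomorphism to the free group (`exists_hom_freeGroup`), and subdividing loops
shows that the `f_j` generate (`closure_range_stdReflection`). The rest is combinatorics of reduced
words.

Length: the characters counting a generator modulo 2 force every decomposition of the product to
contain a conjugate of each generator. Hence the minimal length is n, and in a decomposition of
length n each generator occurs once up to conjugacy (`IsDualTo`).

Transitivity is proved for the free and the Coxeter group at once, by descent on the total word
length of a tuple. If no elementary move shortens the tuple, the central letters of the factors
survive in the reduced word of the product, which therefore has length at least n, with equality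
only if all factors are letters (`exists_nf_prod_of_noDescent`). The products g and c do have length
n.

Freeness is proved in W_n, by showing that a length-decreasing path of moves down to (s_1, ..., s_n)
determines a braid independent of the path (`eq_one_of_height`). This requires joining any two
shortening moves through lower tuples. Distant moves commute; for adjacent ones the braid relation
provides the path, except in a "valley", where the middle reflection precedes both neighbours in the
prefix order of root words.

Valleys do not occur (`not_below_both`), and the reason is planarity. The planar Cayley tree gives
W_n a left-invariant cyclic order. Hurwitz moves keep the inverse partial products of a
decomposition in order, so by transitivity adjacent entries of any decomposition are in order as
well. The elements with a given prefix form an interval, and a valley would thus produce another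
valley with a shorter first entry, without end.

Since `π` is equivariant, freeness lifts from W_n to F_n. Both sets of decompositions are then
single free orbits, and `π` matches their base points, so it is a bijection between them. -/

/-! ### Groups with normal forms by reduced words -/

/-- A group `G` generated by letters from an alphabet with an involution `bar` (the formal
inverse), in which every element is the value of exactly one reduced word. -/
structure WordGroup (A : Type*) (G : Type*) [Group G] where
  bar : A → A
  bar_bar : ∀ a, bar (bar a) = a
  gen : A → G
  gen_bar : ∀ a, gen (bar a) = (gen a)⁻¹
  nf : G → List A
  nf_isChain : ∀ g, (nf g).IsChain (fun a b => b ≠ bar a)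
  prod_nf : ∀ g, ((nf g).map gen).prod = g
  nf_prod : ∀ l : List A, l.IsChain (fun a b => b ≠ bar a) → nf (l.map gen).prod = l

namespace WordGroup

variable {A G : Type*} [Group G] (D : WordGroup A G)

/-- A word is reduced if no letter is followed by its formal inverse. -/
def Reduced (l : List A) : Prop := l.IsChain (fun a b => b ≠ D.bar a)

/-- The value of a word. -/
def val (l : List A) : G := (l.map D.gen).prod

/-- The formal inverse of a word. -/
def inv (l : List A) : List A := (l.map D.bar).reverse

/-- The word length of an element. -/
def norm (g : G) : ℕ := (D.nf g).length

@[simp] theorem val_nil : D.val [] = 1 := by simp [val]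

@[simp] theorem val_cons (a : A) (l : List A) : D.val (a :: l) = D.gen a * D.val l := by
  simp [val]

@[simp] theorem val_append (l m : List A) : D.val (l ++ m) = D.val l * D.val m := by
  simp [val]

theorem bar_injective : Function.Injective D.bar := fun a b h => by
  rw [← D.bar_bar a, h, D.bar_bar]

@[simp] theorem bar_inj {a b : A} : D.bar a = D.bar b ↔ a = b := D.bar_injective.eq_iff

theorem eq_bar_comm {a b : A} : a = D.bar b ↔ b = D.bar a := by
  constructor <;> (rintro rfl; rw [D.bar_bar])

@[simp] theorem val_inv (l : List A) : D.val (D.inv l) = (D.val l)⁻¹ := by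
  induction l with
  | nil => simp [inv]
  | cons a l ih =>
    have : D.inv (a :: l) = D.inv l ++ [D.bar a] := by simp [inv]
    rw [this, val_append, ih]
    simp [D.gen_bar]

@[simp] theorem length_inv (l : List A) : (D.inv l).length = l.length := by simp [inv]

theorem reduced_nil : D.Reduced [] := List.isChain_nil

theorem reduced_nf (g : G) : D.Reduced (D.nf g) := D.nf_isChain g

@[simp] theorem val_nf (g : G) : D.val (D.nf g) = g := D.prod_nf g

theorem nf_val {l : List A} (h : D.Reduced l) : D.nf (D.val l) = l := D.nf_prod l h

theorem norm_val {l : List A} (h : D.Reduced l) : D.norm (D.val l) = l.length := by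
  rw [norm, D.nf_val h]

theorem reduced_append {l m : List A} :
    D.Reduced (l ++ m) ↔ D.Reduced l ∧ D.Reduced m ∧
      ∀ a ∈ l.getLast?, ∀ b ∈ m.head?, b ≠ D.bar a :=
  List.isChain_append

theorem reduced_concat {l : List A} {b : A} :
    D.Reduced (l ++ [b]) ↔ D.Reduced l ∧ ∀ a ∈ l.getLast?, b ≠ D.bar a := by
  rw [reduced_append]
  simp [Reduced]

theorem reduced_cons {l : List A} {b : A} :
    D.Reduced (b :: l) ↔ D.Reduced l ∧ ∀ a ∈ l.head?, a ≠ D.bar b := by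
  rw [← List.singleton_append, reduced_append]
  simp [Reduced]

theorem getLast?_inv (l : List A) : (D.inv l).getLast? = l.head?.map D.bar := by
  simp [inv, List.getLast?_reverse]

theorem head?_inv (l : List A) : (D.inv l).head? = l.getLast?.map D.bar := by
  simp [inv, List.head?_reverse]

theorem reduced_inv {l : List A} (h : D.Reduced l) : D.Reduced (D.inv l) := by
  rw [Reduced, inv, List.isChain_reverse, List.isChain_map]
  refine List.IsChain.imp (fun a b hab => ?_) h
  intro h'
  rw [D.bar_bar] at h'
  exact hab h'.symm

theorem nf_inv (g : G) : D.nf g⁻¹ = D.inv (D.nf g) := by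
  rw [← D.nf_val (D.reduced_inv (D.reduced_nf g)), val_inv, val_nf]

theorem norm_gen_mul (a : A) (g : G) :
    D.norm (D.gen a * g) = D.norm g + 1 ∨ D.norm g = D.norm (D.gen a * g) + 1 := by
  obtain ⟨l, hl, rfl⟩ : ∃ l, D.Reduced l ∧ g = D.val l := ⟨D.nf g, D.reduced_nf g, by simp⟩
  by_cases h : D.Reduced (a :: l)
  · left
    rw [← val_cons, D.norm_val h, D.norm_val hl, List.length_cons]
  · right
    rw [reduced_cons] at h
    push Not at h
    obtain ⟨b, hb, rfl⟩ := h hl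
    obtain ⟨m, rfl⟩ : ∃ m, l = D.bar a :: m := by
      cases l with
      | nil => simp at hb
      | cons c m => exact ⟨m, by simp at hb; rw [hb]⟩
    have hm : D.Reduced m := (D.reduced_cons.1 hl).1
    rw [D.norm_val hl, val_cons, D.gen_bar, mul_inv_cancel_left, D.norm_val hm, List.length_cons]

theorem norm_val_le (l : List A) : D.norm (D.val l) ≤ l.length := by
  induction l with
  | nil => rw [D.norm_val D.reduced_nil]
  | cons a l ih =>
    rw [val_cons, List.length_cons]
    rcases D.norm_gen_mul a (D.val l) with h | h <;> omega

theorem norm_conj_le (l : List A) (a : A) :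
    D.norm (D.val l * D.gen a * (D.val l)⁻¹) ≤ 2 * l.length + 1 := by
  have := D.norm_val_le (l ++ a :: D.inv l)
  simp only [val_append, val_cons, val_inv, List.length_append, List.length_cons, length_inv,
    ← mul_assoc] at this
  omega

/-- The word `u` and the letter `a` form the reduced expression of a conjugate `u a u⁻¹`. -/
def IsRootWord (u : List A) (a : A) : Prop := D.Reduced (u ++ [a]) ∧ D.Reduced (u ++ [D.bar a])

theorem IsRootWord.reduced {u : List A} {a : A} (h : D.IsRootWord u a) : D.Reduced u :=
  (D.reduced_concat.1 h.1).1

/-- A last letter equal to `a` or its inverse commutes with `a`, so it can be stripped from the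
conjugating word. When no such letter is left, the conjugate is written without cancellation. -/
theorem exists_isRootWord (g : G) (a : A) :
    ∃ u, D.IsRootWord u a ∧ g * D.gen a * g⁻¹ = D.val u * D.gen a * (D.val u)⁻¹ := by
  suffices h : ∀ l, D.Reduced l →
      ∃ u, D.IsRootWord u a ∧ D.val l * D.gen a * (D.val l)⁻¹ =
        D.val u * D.gen a * (D.val u)⁻¹ by
    simpa using h (D.nf g) (D.reduced_nf g)
  intro l
  induction l using List.reverseRecOn with
  | nil => exact fun _ => ⟨[], by simp [IsRootWord, Reduced], rfl⟩
  | append_singleton l b ih =>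
    intro hl
    by_cases hb : b = a ∨ b = D.bar a
    · obtain ⟨u, hu, hu'⟩ := ih (D.reduced_concat.1 hl).1
      refine ⟨u, hu, ?_⟩
      rw [← hu']
      rcases hb with rfl | rfl <;> simp [D.gen_bar, mul_assoc]
    · push Not at hb
      refine ⟨l ++ [b], ⟨?_, ?_⟩, rfl⟩
      · rw [reduced_concat]
        refine ⟨hl, ?_⟩
        simpa using fun h => hb.2 (D.eq_bar_comm.1 h)
      · rw [reduced_concat]
        refine ⟨hl, ?_⟩
        simpa using hb.1.symm

/-- The two conditions on a root word guard the two junctions: `u ++ [a]` the one on the left of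
`a`, and, after inversion, `u ++ [bar a]` the one on its right. -/
theorem IsRootWord.reduced_conj {u : List A} {a : A} (h : D.IsRootWord u a) :
    D.Reduced (u ++ a :: D.inv u) := by
  have h1 := h.1
  have h2 := h.2
  rw [← List.singleton_append, ← List.append_assoc, reduced_append]
  refine ⟨h1, D.reduced_inv h.reduced, ?_⟩
  simp only [List.getLast?_append, List.getLast?_singleton, Option.some_or, Option.mem_def,
    Option.some.injEq, head?_inv, Option.map_eq_some_iff, forall_eq']
  rintro _ ⟨c, hc, rfl⟩
  rw [reduced_concat] at h2
  exact (h2.2 c hc).symm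

theorem val_conj (u : List A) (a : A) :
    D.val (u ++ a :: D.inv u) = D.val u * D.gen a * (D.val u)⁻¹ := by
  simp [mul_assoc]

theorem IsRootWord.nf_conj {u : List A} {a : A} (h : D.IsRootWord u a) :
    D.nf (D.val u * D.gen a * (D.val u)⁻¹) = u ++ a :: D.inv u := by
  rw [← val_conj, D.nf_val h.reduced_conj]

theorem IsRootWord.norm_conj {u : List A} {a : A} (h : D.IsRootWord u a) :
    D.norm (D.val u * D.gen a * (D.val u)⁻¹) = 2 * u.length + 1 := by
  rw [norm, h.nf_conj]
  simp
  omega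

end WordGroup

/-! ### Products of conjugates that no elementary move shortens -/

theorem List.exists_common_prefix {A : Type*} (u v : List A) :
    ∃ p x y, u = p ++ x ∧ v = p ++ y ∧ ∀ a ∈ x.head?, ∀ b ∈ y.head?, a ≠ b := by
  induction u generalizing v with
  | nil => exact ⟨[], [], v, by simp⟩
  | cons a u ih =>
    cases v with
    | nil => exact ⟨[], a :: u, [], by simp⟩
    | cons b v =>
      by_cases h : a = b
      · subst h
        obtain ⟨p, x, y, rfl, rfl, h⟩ := ih v
        exact ⟨a :: p, x, y, rfl, rfl, h⟩
      · exact ⟨[], a :: u, b :: v, by simpa using h⟩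

namespace WordGroup

variable {A G : Type*} [Group G] (D : WordGroup A G)

/-- Neither of the two elementary Hurwitz moves shortens the pair of conjugates with root words
`d` and `d'`, and the two conjugates are not inverse to each other. -/
def NoDescent (d d' : List A × A) : Prop :=
  ¬ d.1 ++ [D.bar d.2] <+: d'.1 ∧ ¬ d'.1 ++ [d'.2] <+: d.1 ∧ ¬ (d.1 = d'.1 ∧ d'.2 = D.bar d.2)

/-- Write the first two root words as p x and p y with no further common prefix. If the tail has
normal form p y b Z, the product is p x a x⁻¹ y b Z. The three clauses of `NoDescent` exclude
exactly the cancellations left possible at the two ends of x⁻¹, so this word is reduced. Each factor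
thus contributes at least its central letter, and the last clause records that nothing else is left
when the length is minimal. -/
theorem exists_nf_prod_of_noDescent (d : List A × A) (L : List (List A × A))
    (hL : (d :: L).IsChain D.NoDescent) (hd : ∀ e ∈ d :: L, D.IsRootWord e.1 e.2) :
    ∃ Z, D.nf ((d :: L).map fun e => D.val e.1 * D.gen e.2 * (D.val e.1)⁻¹).prod =
        d.1 ++ d.2 :: Z ∧ L.length ≤ Z.length ∧
      (Z.length + d.1.length = L.length → ∀ e ∈ d :: L, e.1 = []) := by
  induction L generalizing d with
  | nil =>
    have h := hd d (by simp)
    refine ⟨D.inv d.1, ?_, by simp, ?_⟩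
    · simp only [List.map_cons, List.map_nil, List.prod_cons, List.prod_nil, mul_one]
      exact h.nf_conj
    · intro hz
      simpa using hz
  | cons d' L ih =>
    obtain ⟨u, a⟩ := d
    obtain ⟨v, b⟩ := d'
    obtain ⟨hnd, hL'⟩ := List.isChain_cons_cons.1 hL
    obtain ⟨Z, hZ, hlen, heq⟩ := ih (v, b) hL' fun e he => hd e (List.mem_cons_of_mem _ he)
    obtain ⟨p, x, y, rfl, rfl, hxy⟩ := List.exists_common_prefix u v
    have hu : D.IsRootWord (p ++ x) a := hd (p ++ x, a) (by simp)
    have hv : D.IsRootWord (p ++ y) b := hd (p ++ y, b) (by simp)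
    simp only at hZ hlen heq
    obtain ⟨n1, n2, n3⟩ := hnd
    simp only [List.append_assoc, List.prefix_append_right_inj, List.append_cancel_left_eq]
      at n1 n2 n3
    have hP : D.Reduced (p ++ y ++ b :: Z) := hZ ▸ D.reduced_nf _
    have hvalP : ((( p ++ y, b) :: L).map fun e =>
        D.val e.1 * D.gen e.2 * (D.val e.1)⁻¹).prod = D.val (p ++ y ++ b :: Z) := by
      rw [← hZ, val_nf]
    have hyb : D.Reduced (y ++ b :: Z) := by
      rw [List.append_assoc, reduced_append] at hP
      exact hP.2.1
    have hred : D.Reduced (p ++ x ++ a :: (D.inv x ++ (y ++ b :: Z))) := by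
      have hux : D.Reduced (p ++ x ++ [a]) := hu.1
      have hsplit : p ++ x ++ a :: (D.inv x ++ (y ++ b :: Z)) =
        (p ++ x ++ [a]) ++ (D.inv x ++ (y ++ b :: Z)) := by simp
      rw [hsplit, reduced_append]
      have hx : D.Reduced (D.inv x) := by
        refine D.reduced_inv ?_
        have := hu.reduced
        rw [reduced_append] at this
        exact this.2.1
      refine ⟨hux, ?_, ?_⟩
      · rw [reduced_append]
        refine ⟨hx, hyb, ?_⟩
        rw [getLast?_inv]
        intro c hc e he
        obtain ⟨f, hf, rfl⟩ := Option.map_eq_some_iff.1 hc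
        rw [D.bar_bar]
        rintro rfl
        cases y with
        | nil =>
          simp only [List.nil_append, List.head?_cons, Option.mem_def, Option.some.injEq] at he
          subst he
          apply n2
          cases x with
          | nil => simp at hf
          | cons g x =>
            simp only [List.head?_cons, Option.some.injEq] at hf
            simp [hf]
        | cons g y =>
          simp only [List.cons_append, List.head?_cons, Option.mem_def, Option.some.injEq] at he
          exact hxy _ hf _ (by simp [he]) rfl
      · simp only [List.getLast?_append, List.getLast?_singleton, Option.some_or, Option.mem_def,
          Option.some.injEq, forall_eq']
        intro c hc
        cases x using List.reverseRecOn with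
        | nil =>
          rintro rfl
          cases y with
          | nil =>
            simp [inv] at hc
            exact n3 (by simp [hc])
          | cons g y =>
            simp [inv] at hc
            exact n1 (by simp [hc])
        | append_singleton x g =>
          rw [List.head?_append, head?_inv] at hc
          simp only [List.getLast?_append, List.getLast?_singleton, Option.some_or,
            Option.map_some, Option.some.injEq] at hc
          subst hc
          have h2 := hu.2
          rw [reduced_concat] at h2
          exact (h2.2 g (by simp)).symm
    refine ⟨D.inv x ++ (y ++ b :: Z), ?_, ?_, ?_⟩
    · rw [List.map_cons, List.prod_cons, hvalP, ← D.nf_val hred]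
      congr 1
      simp [mul_assoc]
    · simp; omega
    · simp only [List.length_append, List.length_cons, length_inv]
      intro h
      have h1 : (p ++ x) = [] := by
        rw [← List.length_eq_zero_iff, List.length_append]
        omega
      have h2 := heq (by
        rw [List.length_append]
        omega)
      simp only [List.mem_cons, forall_eq_or_imp] at h2 ⊢
      exact ⟨h1, h2.1, h2.2⟩

end WordGroup

/-! ### Partial products and elementary properties of the Hurwitz action -/

/-- The product of the first `k` entries of a tuple. -/
def partialProd {G : Type*} [Group G] {n : ℕ} (t : Fin n → G) (k : ℕ) : G :=
  ((List.ofFn t).take k).prod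

section partialProd

variable {G : Type*} [Group G] {n : ℕ}

@[simp] theorem partialProd_zero (t : Fin n → G) : partialProd t 0 = 1 := by simp [partialProd]

theorem partialProd_succ (t : Fin n → G) {k : ℕ} (hk : k < n) :
    partialProd t (k + 1) = partialProd t k * t ⟨k, hk⟩ := by
  rw [partialProd, partialProd, List.prod_take_succ _ _ (by simpa using hk)]
  simp

theorem partialProd_eq_prod (t : Fin n → G) : partialProd t n = (List.ofFn t).prod := by
  rw [partialProd, List.take_of_length_le (by simp)]

/-- The move `σ_i` or its inverse. -/
def hurwitzStep (n : ℕ) (G : Type*) [Group G] (i : Fin (n - 1)) (ε : Bool) :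
    Equiv.Perm (Fin n → G) :=
  if ε then hurwitzMove n G i else (hurwitzMove n G i).symm

/-- The generator `σ_i` of the braid group, or its inverse. -/
def braidGen (n : ℕ) (i : Fin (n - 1)) (ε : Bool) : BraidGroup n :=
  if ε then PresentedGroup.of i else (PresentedGroup.of i)⁻¹

theorem hurwitz_braidGen (i : Fin (n - 1)) (ε : Bool) :
    hurwitz n G (braidGen n i ε) = hurwitzStep n G i ε := by
  have h : hurwitz n G (PresentedGroup.of i) = hurwitzMove n G i := by
    rw [hurwitz, PresentedGroup.toGroup.of]
  cases ε
  · simp only [braidGen, hurwitzStep, map_inv, h, Bool.false_eq_true, if_false]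
    rfl
  · simp [braidGen, hurwitzStep, h]

theorem braidGen_induction {p : BraidGroup n → Prop} (one : p 1)
    (mul : ∀ i ε b, p b → p (braidGen n i ε * b)) (b : BraidGroup n) : p b := by
  have h : b ∈ Subgroup.closure (Set.range (PresentedGroup.of (rels := braidRels n))) := by
    rw [PresentedGroup.closure_range_of]; trivial
  induction h using Subgroup.closure_induction_left with
  | one => exact one
  | mul_left x hx y hy ih =>
    obtain ⟨i, rfl⟩ := hx
    simpa [braidGen] using mul i true y ih
  | inv_mul_cancel x hx y hy ih =>
    obtain ⟨i, rfl⟩ := hx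
    simpa [braidGen] using mul i false y ih

theorem hurwitz_mem {S : Set (Fin n → G)} (hS : ∀ i ε, ∀ t ∈ S, hurwitzStep n G i ε t ∈ S)
    (b : BraidGroup n) (t : Fin n → G) (ht : t ∈ S) : hurwitz n G b t ∈ S := by
  induction b using braidGen_induction with
  | one => simpa
  | mul i ε b ih =>
    rw [map_mul, hurwitz_braidGen]
    exact hS i ε _ ih

/-- The value of `hurwitzStep` at position `i`. -/
def stepFst {G : Type*} [Group G] (ε : Bool) (a b : G) : G := if ε then a * b * a⁻¹ else b

/-- The value of `hurwitzStep` at position `i + 1`. -/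
def stepSnd {G : Type*} [Group G] (ε : Bool) (a b : G) : G := if ε then a else b⁻¹ * a * b

@[simp] theorem stepFst_true (a b : G) : stepFst true a b = a * b * a⁻¹ := rfl
@[simp] theorem stepFst_false (a b : G) : stepFst false a b = b := rfl
@[simp] theorem stepSnd_true (a b : G) : stepSnd true a b = a := rfl
@[simp] theorem stepSnd_false (a b : G) : stepSnd false a b = b⁻¹ * a * b := rfl

theorem stepFst_mul_stepSnd (ε : Bool) (a b : G) : stepFst ε a b * stepSnd ε a b = a * b := by
  cases ε <;> simp [mul_assoc]

theorem hurwitzStep_apply (i : Fin (n - 1)) (ε : Bool) (t : Fin n → G) (k : Fin n) :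
    hurwitzStep n G i ε t k =
      if (k : ℕ) = i then stepFst ε (t ⟨i, by omega⟩) (t ⟨i + 1, by omega⟩)
      else if (k : ℕ) = i + 1 then stepSnd ε (t ⟨i, by omega⟩) (t ⟨i + 1, by omega⟩)
      else t k := by
  cases ε <;> rfl

theorem hurwitzStep_fst (i : Fin (n - 1)) (ε : Bool) (t : Fin n → G) (h : (i : ℕ) < n) :
    hurwitzStep n G i ε t ⟨i, h⟩ = stepFst ε (t ⟨i, h⟩) (t ⟨i + 1, by omega⟩) := by
  simp [hurwitzStep_apply]

theorem hurwitzStep_snd (i : Fin (n - 1)) (ε : Bool) (t : Fin n → G) (h : (i : ℕ) + 1 < n) :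
    hurwitzStep n G i ε t ⟨i + 1, h⟩ = stepSnd ε (t ⟨i, by omega⟩) (t ⟨i + 1, h⟩) := by
  simp [hurwitzStep_apply]

theorem hurwitzStep_of_ne (i : Fin (n - 1)) (ε : Bool) (t : Fin n → G) (k : Fin n)
    (h : (k : ℕ) ≠ i) (h' : (k : ℕ) ≠ i + 1) : hurwitzStep n G i ε t k = t k := by
  simp [hurwitzStep_apply, h, h']

theorem braidGen_not (i : Fin (n - 1)) (ε : Bool) : braidGen n i (!ε) = (braidGen n i ε)⁻¹ := by
  cases ε <;> simp [braidGen]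

theorem partialProd_hurwitzStep_of_le (i : Fin (n - 1)) (ε : Bool) (t : Fin n → G) (k : ℕ)
    (hk : k ≤ i) : partialProd (hurwitzStep n G i ε t) k = partialProd t k := by
  induction k with
  | zero => simp
  | succ k ih =>
    rw [partialProd_succ _ (by omega), partialProd_succ _ (by omega), ih (by omega),
      hurwitzStep_of_ne _ _ _ _ (by simp; omega) (by simp; omega)]

theorem partialProd_hurwitzStep_of_lt (i : Fin (n - 1)) (ε : Bool) (t : Fin n → G) (k : ℕ)
    (hk : i + 1 < k) (hkn : k ≤ n) :
    partialProd (hurwitzStep n G i ε t) k = partialProd t k := by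
  induction k, (show (i : ℕ) + 2 ≤ k from hk) using Nat.le_induction with
  | base =>
    rw [partialProd_succ _ (by omega), partialProd_succ _ (by omega),
      partialProd_succ t (by omega), partialProd_succ t (by omega),
      partialProd_hurwitzStep_of_le _ _ _ _ le_rfl, hurwitzStep_fst, hurwitzStep_snd, mul_assoc,
      stepFst_mul_stepSnd, ← mul_assoc]
  | succ k hk' ih =>
    rw [partialProd_succ _ (by omega), partialProd_succ _ (by omega), ih (by omega) (by omega),
      hurwitzStep_of_ne _ _ _ _ (by simp; omega) (by simp; omega)]

theorem prod_hurwitzStep (i : Fin (n - 1)) (ε : Bool) (t : Fin n → G) :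
    (List.ofFn (hurwitzStep n G i ε t)).prod = (List.ofFn t).prod := by
  rw [← partialProd_eq_prod, ← partialProd_eq_prod,
    partialProd_hurwitzStep_of_lt _ _ _ _ (by omega) le_rfl]

theorem map_hurwitz {H : Type*} [Group H] (φ : G →* H) (b : BraidGroup n) (t : Fin n → G) :
    (fun k => φ (hurwitz n G b t k)) = hurwitz n H b fun k => φ (t k) := by
  induction b using braidGen_induction with
  | one => simp
  | mul i ε b ih =>
    rw [map_mul, map_mul, Equiv.Perm.mul_apply, Equiv.Perm.mul_apply, ← ih, hurwitz_braidGen,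
      hurwitz_braidGen]
    funext k
    simp only [hurwitzStep_apply]
    cases ε <;> split_ifs <;> simp

/-- The conjugates of the entries of a tuple. -/
def conjSet {G : Type*} [Group G] {n : ℕ} (s : Fin n → G) : Set G :=
  {r | ∃ j w, r = w * s j * w⁻¹}

theorem conj_mem_conjSet {s : Fin n → G} {r : G} (hr : r ∈ conjSet s) (w : G) :
    w * r * w⁻¹ ∈ conjSet s := by
  obtain ⟨j, v, rfl⟩ := hr
  exact ⟨j, w * v, by group⟩

theorem self_mem_conjSet (s : Fin n → G) (j : Fin n) : s j ∈ conjSet s := ⟨j, 1, by simp⟩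

theorem hurwitzStep_mem_conjSet {s t : Fin n → G} (ht : ∀ k, t k ∈ conjSet s) (i : Fin (n - 1))
    (ε : Bool) (k : Fin n) : hurwitzStep n G i ε t k ∈ conjSet s := by
  rw [hurwitzStep_apply]
  split_ifs
  · cases ε
    · exact ht _
    · exact conj_mem_conjSet (ht _) _
  · cases ε
    · simpa using conj_mem_conjSet (ht ⟨i, by omega⟩) (t ⟨i + 1, by omega⟩)⁻¹
    · exact ht _
  · exact ht k

/-- The tuples of conjugates of the entries of `s` whose product is the product of `s`. -/
def decompositions {G : Type*} [Group G] {n : ℕ} (s : Fin n → G) : Set (Fin n → G) :=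
  {t | IsDecomposition (conjSet s) (List.ofFn s).prod t}

theorem hurwitzStep_mem_decompositions (s : Fin n → G) (i : Fin (n - 1)) (ε : Bool)
    (t : Fin n → G) (ht : t ∈ decompositions s) : hurwitzStep n G i ε t ∈ decompositions s :=
  ⟨hurwitzStep_mem_conjSet ht.1 i ε, by rw [prod_hurwitzStep, ht.2]⟩

/-- Stated additively so that comparisons of lengths stay in ℕ without subtraction. -/
theorem sum_add_sum_of_eqOn_compl {ι : Type*} [Fintype ι] [DecidableEq ι] (S : Finset ι)
    (f g : ι → ℕ) (h : ∀ k ∉ S, f k = g k) :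
    ∑ k, f k + ∑ k ∈ S, g k = ∑ k, g k + ∑ k ∈ S, f k := by
  have h' : ∑ k ∈ Sᶜ, f k = ∑ k ∈ Sᶜ, g k :=
    Finset.sum_congr rfl fun k hk => h k (Finset.mem_compl.1 hk)
  rw [← Finset.sum_add_sum_compl S f, ← Finset.sum_add_sum_compl S g]
  omega

theorem sum_hurwitzStep (N : G → ℕ) (i : Fin (n - 1)) (ε : Bool) (t : Fin n → G) :
    ∑ k, N (hurwitzStep n G i ε t k) + (N (t ⟨i, by omega⟩) + N (t ⟨i + 1, by omega⟩)) =
      ∑ k, N (t k) + (N (stepFst ε (t ⟨i, by omega⟩) (t ⟨i + 1, by omega⟩)) +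
        N (stepSnd ε (t ⟨i, by omega⟩) (t ⟨i + 1, by omega⟩))) := by
  have h := sum_add_sum_of_eqOn_compl {(⟨i, by omega⟩ : Fin n), ⟨i + 1, by omega⟩}
    (fun k => N (hurwitzStep n G i ε t k)) (fun k => N (t k)) (by
      intro k hk
      simp only [Finset.mem_insert, Finset.mem_singleton, not_or, Fin.ext_iff] at hk
      rw [hurwitzStep_of_ne _ _ _ _ hk.1 hk.2])
  rw [Finset.sum_pair (by simp), Finset.sum_pair (by simp)] at h
  simpa only [hurwitzStep_fst, hurwitzStep_snd] using h

end partialProd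

/-! ### Colours -/

/-- Homomorphisms `χ j` to `ℤ/2` that form a basis dual to the tuple `s`. -/
def IsDualTo {G : Type*} [Group G] {n : ℕ} (χ : Fin n → G →* Multiplicative (ZMod 2))
    (s : Fin n → G) : Prop :=
  ∀ i j, χ j (s i) = if i = j then Multiplicative.ofAdd 1 else 1

section IsDualTo

variable {G : Type*} [Group G] {n : ℕ} {χ : Fin n → G →* Multiplicative (ZMod 2)}
  {s : Fin n → G}

theorem IsDualTo.conj (h : IsDualTo χ s) (w : G) (i j : Fin n) :
    χ j (w * s i * w⁻¹) = if i = j then Multiplicative.ofAdd 1 else 1 := by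
  rw [map_mul, map_mul, mul_right_comm, map_inv, mul_inv_cancel, one_mul, h]

theorem IsDualTo.prod (h : IsDualTo χ s) (j : Fin n) :
    χ j (List.ofFn s).prod = Multiplicative.ofAdd 1 := by
  rw [map_list_prod, List.map_ofFn, List.prod_ofFn]
  simp [h _ _]

/-- A character is constant on conjugacy classes. If no factor had colour `j`, the character `χ j`
would be trivial on the product, where it equals the nonzero class. -/
theorem IsDualTo.exists_color (h : IsDualTo χ s) {m : ℕ} {u : Fin m → G}
    (hu : IsDecomposition (conjSet s) (List.ofFn s).prod u) (c : Fin m → Fin n)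
    (hc : ∀ i, ∃ w, u i = w * s (c i) * w⁻¹) : Function.Surjective c := by
  intro j
  by_contra hj
  push Not at hj
  have h1 := h.prod j
  rw [← hu.2, map_list_prod, List.map_ofFn, List.prod_ofFn] at h1
  rw [Finset.prod_eq_one] at h1
  · exact absurd h1 (by decide)
  · intro i _
    obtain ⟨w, hw⟩ := hc i
    rw [Function.comp_apply, hw, h.conj, if_neg (hj i)]

theorem IsDualTo.le (h : IsDualTo χ s) {m : ℕ} {u : Fin m → G}
    (hu : IsDecomposition (conjSet s) (List.ofFn s).prod u) : n ≤ m := by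
  choose c hc using hu.1
  simpa using Fintype.card_le_of_surjective c (h.exists_color hu c hc)

theorem IsDualTo.red_eq (h : IsDualTo χ s) :
    Red (conjSet s) (List.ofFn s).prod n = decompositions s := by
  ext t
  exact ⟨fun ht => ht.1, fun ht => ⟨ht, fun m u hu => h.le hu⟩⟩

theorem IsDualTo.color_injective (h : IsDualTo χ s) {t : Fin n → G} (ht : t ∈ decompositions s)
    (c : Fin n → Fin n) (hc : ∀ i, ∃ w, t i = w * s (c i) * w⁻¹) : Function.Injective c :=
  Finite.injective_iff_surjective.2 (h.exists_color ht c hc)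

theorem IsDualTo.injective (h : IsDualTo χ s) {t : Fin n → G} (ht : t ∈ decompositions s) :
    Function.Injective t := by
  intro i j hij
  choose c hc using ht.1
  refine h.color_injective ht c hc ?_
  obtain ⟨w, hw⟩ := hc i
  obtain ⟨v, hv⟩ := hc j
  by_contra hne
  have h1 := h.conj w (c i) (c i)
  rw [← hw, hij, hv, h.conj, if_neg (Ne.symm hne), if_pos rfl] at h1
  exact absurd h1 (by decide)

end IsDualTo

/-! ### Hurwitz transitivity -/

namespace WordGroup

variable {A G : Type*} [Group G] (D : WordGroup A G)

/-- This is why an elementary move can shorten a tuple: conjugation by u a u⁻¹ deletes the letter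
following u from a root word that begins with u a⁻¹. -/
theorem conj_val_append (u z : List A) (a b : A) :
    D.val u * D.gen a * (D.val u)⁻¹ *
        (D.val (u ++ D.bar a :: z) * D.gen b * (D.val (u ++ D.bar a :: z))⁻¹) *
        (D.val u * D.gen a * (D.val u)⁻¹)⁻¹ =
      D.val (u ++ z) * D.gen b * (D.val (u ++ z))⁻¹ := by
  simp [D.gen_bar, mul_assoc]

theorem conj_inv_val_append (u z : List A) (a b : A) :
    (D.val u * D.gen a * (D.val u)⁻¹)⁻¹ *
        (D.val (u ++ a :: z) * D.gen b * (D.val (u ++ a :: z))⁻¹) *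
        (D.val u * D.gen a * (D.val u)⁻¹) =
      D.val (u ++ z) * D.gen b * (D.val (u ++ z))⁻¹ := by
  simp [mul_assoc]

/-- If no move shortens the tuple, adjacent root words satisfy `NoDescent`. The first two clauses
hold because a prefix would give a shortening move; the third follows from distinct colours and
`hbar`. The product has length exactly `n`, so the equality case of `exists_nf_prod_of_noDescent`
applies. -/
theorem exists_descent {n : ℕ} (s : Fin n → A) (hs : D.Reduced (List.ofFn s))
    (hbar : ∀ i j, s j = D.bar (s i) → i = j) {χ : Fin n → G →* Multiplicative (ZMod 2)}
    (hχ : IsDualTo χ fun j => D.gen (s j)) {t : Fin n → G}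
    (ht : t ∈ decompositions fun j => D.gen (s j)) (hne : t ≠ fun j => D.gen (s j)) :
    ∃ i ε, ∑ k, D.norm (hurwitzStep n G i ε t k) < ∑ k, D.norm (t k) := by
  by_contra hcon
  push Not at hcon
  apply hne
  choose c w hw using ht.1
  have hc : Function.Injective c := hχ.color_injective ht c fun i => ⟨w i, hw i⟩
  choose u hu hu' using fun i => D.exists_isRootWord (w i) (s (c i))
  have hw' : ∀ i, t i = D.val (u i) * D.gen (s (c i)) * (D.val (u i))⁻¹ := fun i =>
    (hw i).trans (hu' i)
  have hnd : ∀ i : Fin (n - 1), D.NoDescent (u ⟨i, by omega⟩, s (c ⟨i, by omega⟩))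
      (u ⟨i + 1, by omega⟩, s (c ⟨i + 1, by omega⟩)) := by
    intro i
    refine ⟨?_, ?_, ?_⟩
    · rintro ⟨z, hz⟩
      have h1 := hcon i true
      have h2 := sum_hurwitzStep D.norm i true t
      have h3 := (hu ⟨i + 1, by omega⟩).norm_conj
      have h4 := D.conj_val_append (u ⟨i, by omega⟩) z (s (c ⟨i, by omega⟩))
        (s (c ⟨i + 1, by omega⟩))
      simp only [List.append_assoc, List.singleton_append] at hz
      rw [hz, ← hw', ← hw'] at h4
      rw [← hw', ← hz] at h3
      have h5 := D.norm_conj_le (u ⟨i, by omega⟩ ++ z) (s (c ⟨i + 1, by omega⟩))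
      rw [← h4] at h5
      simp only [List.length_append, List.length_cons] at h3 h5
      simp only [stepFst_true, stepSnd_true] at h2
      omega
    · rintro ⟨z, hz⟩
      have h1 := hcon i false
      have h2 := sum_hurwitzStep D.norm i false t
      have h3 := (hu ⟨i, by omega⟩).norm_conj
      have h4 := D.conj_inv_val_append (u ⟨i + 1, by omega⟩) z (s (c ⟨i + 1, by omega⟩))
        (s (c ⟨i, by omega⟩))
      simp only [List.append_assoc, List.singleton_append] at hz
      rw [hz, ← hw', ← hw'] at h4
      rw [← hw', ← hz] at h3
      have h5 := D.norm_conj_le (u ⟨i + 1, by omega⟩ ++ z) (s (c ⟨i, by omega⟩))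
      rw [← h4] at h5
      simp only [List.length_append, List.length_cons] at h3 h5
      simp only [stepFst_false, stepSnd_false] at h2
      omega
    · rintro ⟨-, h⟩
      have := hc (hbar _ _ h)
      simp at this
  have hchain : (List.ofFn fun i => (u i, s (c i))).IsChain D.NoDescent := by
    rw [List.isChain_iff_getElem]
    intro i hi
    simp only [List.length_ofFn] at hi
    simpa using hnd ⟨i, by omega⟩
  have hprod : (List.ofFn t).prod = D.val (List.ofFn s) := by
    rw [ht.2, val, List.map_ofFn]
    rfl
  cases n with
  | zero => exact funext fun i => i.elim0
  | succ n =>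
    have hL : (List.ofFn t) = (List.ofFn fun i => (u i, s (c i))).map
        fun e => D.val e.1 * D.gen e.2 * (D.val e.1)⁻¹ := by
      rw [List.map_ofFn]
      congr 1
      exact funext hw'
    rw [List.ofFn_succ] at hchain
    obtain ⟨Z, hZ, hlen, heq⟩ := D.exists_nf_prod_of_noDescent _ _ hchain (by
      rw [← List.ofFn_succ (f := fun i => (u i, s (c i))), List.forall_mem_ofFn_iff]
      exact hu)
    rw [← List.ofFn_succ (f := fun i => (u i, s (c i)))] at hZ heq hchain
    rw [← hL, hprod, D.nf_val hs] at hZ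
    have hlen' := congrArg List.length hZ
    simp only [List.length_ofFn, List.length_append, List.length_cons] at hlen' hlen heq
    -- The normal form of the product is the word of `s`, of length `n + 1`, which is the least
    -- length allowed.
    have hnil : ∀ i, u i = [] := by
      have := heq (by omega)
      rw [List.forall_mem_ofFn_iff] at this
      exact this
    have ht' : ∀ i, t i = D.gen (s (c i)) := fun i => by simp [hw', hnil]
    have hred : D.Reduced (List.ofFn (s ∘ c)) := by
      rw [Reduced, List.isChain_iff_getElem]
      intro i hi
      simp only [List.length_ofFn] at hi
      have := (hnd ⟨i, by omega⟩).2.2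
      simp only [hnil, true_and] at this
      simpa only [List.getElem_ofFn, Function.comp_apply] using this
    have h1 : D.val (List.ofFn (s ∘ c)) = D.val (List.ofFn s) := by
      rw [← hprod, val, List.map_ofFn]
      congr 2
      exact (funext ht').symm
    -- Both sides are reduced words for the same product, so uniqueness of normal forms removes the
    -- permutation `c`.
    have h2 : s ∘ c = s := by
      have := congrArg D.nf h1
      rw [D.nf_val hred, D.nf_val hs] at this
      exact List.ofFn_injective this
    funext i
    rw [ht', ← Function.comp_apply (f := s), h2]

theorem exists_hurwitz_eq {n : ℕ} (s : Fin n → A) (hs : D.Reduced (List.ofFn s))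
    (hbar : ∀ i j, s j = D.bar (s i) → i = j) {χ : Fin n → G →* Multiplicative (ZMod 2)}
    (hχ : IsDualTo χ fun j => D.gen (s j)) (t : Fin n → G)
    (ht : t ∈ decompositions fun j => D.gen (s j)) :
    ∃ b, hurwitz n G b t = fun j => D.gen (s j) := by
  induction hN : ∑ k, D.norm (t k) using Nat.strong_induction_on generalizing t with
  | _ N ih =>
    by_cases hne : t = fun j => D.gen (s j)
    · exact ⟨1, by simpa⟩
    · obtain ⟨i, ε, hlt⟩ := D.exists_descent s hs hbar hχ ht hne
      obtain ⟨b, hb⟩ := ih _ (hN ▸ hlt) _ (hurwitzStep_mem_decompositions _ i ε t ht) rfl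
      refine ⟨b * braidGen n i ε, ?_⟩
      rw [map_mul, hurwitz_braidGen, Equiv.Perm.mul_apply, hb]

end WordGroup

/-! ### The free group and the universal Coxeter group -/

theorem FreeGroup.prod_map_mk {α : Type*} (l : List (α × Bool)) :
    (l.map fun a => FreeGroup.mk [a]).prod = FreeGroup.mk l := by
  induction l with
  | nil => rfl
  | cons a l ih => rw [List.map_cons, List.prod_cons, ih, FreeGroup.mul_mk]; rfl

/-- Normal forms in the free group. -/
def freeWordGroup (n : ℕ) : WordGroup (Fin n × Bool) (FreeGroup (Fin n)) where
  bar a := (a.1, !a.2)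
  bar_bar a := by simp
  gen a := FreeGroup.mk [a]
  gen_bar a := by simp [FreeGroup.inv_mk, FreeGroup.invRev]
  nf := FreeGroup.toWord
  nf_isChain g := by
    refine List.IsChain.imp (fun a b h => ?_) (FreeGroup.isReduced_toWord (x := g))
    rintro rfl
    simpa using h rfl
  prod_nf g := by rw [FreeGroup.prod_map_mk, FreeGroup.mk_toWord]
  nf_prod l hl := by
    rw [FreeGroup.prod_map_mk, FreeGroup.toWord_mk]
    refine FreeGroup.IsReduced.reduce_eq (List.IsChain.imp (fun a b h h1 => ?_) hl)
    by_contra h2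
    refine h (Prod.ext h1.symm ?_)
    cases ha : a.2 <;> cases hb : b.2 <;> simp_all

/-- Left multiplication by the letter `a` on reduced words of the universal Coxeter group. -/
def coxeterPush {n : ℕ} (a : Fin n) : List (Fin n) → List (Fin n)
  | [] => [a]
  | b :: l => if b = a then l else a :: b :: l

theorem coxeterPush_of_isChain {n : ℕ} {a : Fin n} {l : List (Fin n)}
    (h : (a :: l).IsChain fun a b => b ≠ a) : coxeterPush a l = a :: l := by
  cases l with
  | nil => rfl
  | cons b l =>
    rw [List.isChain_cons_cons] at h
    simp [coxeterPush, h.1]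

theorem isChain_coxeterPush {n : ℕ} (a : Fin n) {l : List (Fin n)}
    (h : l.IsChain fun a b => b ≠ a) : (coxeterPush a l).IsChain fun a b => b ≠ a := by
  cases l with
  | nil => simp [coxeterPush]
  | cons b l =>
    rw [coxeterPush]
    split_ifs with hb
    · exact h.tail
    · exact List.isChain_cons_cons.2 ⟨hb, h⟩

theorem coxeterPush_coxeterPush {n : ℕ} (a : Fin n) {l : List (Fin n)}
    (h : l.IsChain fun a b => b ≠ a) : coxeterPush a (coxeterPush a l) = l := by
  cases l with
  | nil => simp [coxeterPush]
  | cons b l =>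
    by_cases hb : b = a
    · subst hb
      rw [coxeterPush, if_pos rfl, coxeterPush_of_isChain h]
    · simp [coxeterPush, hb]

/-- The action of the universal Coxeter group on reduced words. -/
def coxeterWordAction (n : ℕ) :
    UniversalCoxeterGroup n →* Equiv.Perm {l : List (Fin n) // l.IsChain fun a b => b ≠ a} :=
  PresentedGroup.toGroup
    (f := fun a => Function.Involutive.toPerm
      (fun l => ⟨coxeterPush a l.1, isChain_coxeterPush a l.2⟩)
      (fun l => Subtype.ext (coxeterPush_coxeterPush a l.2))) (by
    rintro _ ⟨a, rfl⟩
    refine Equiv.ext fun l => Subtype.ext ?_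
    simp only [map_pow, FreeGroup.lift_apply_of, pow_two]
    exact coxeterPush_coxeterPush a l.2)

theorem coxeterWordAction_gen {n : ℕ} (a : Fin n)
    (l : {l : List (Fin n) // l.IsChain fun a b => b ≠ a}) :
    (coxeterWordAction n (coxeterGen n a) l).1 = coxeterPush a l.1 := by
  rw [coxeterWordAction, coxeterGen, PresentedGroup.toGroup.of]
  rfl

theorem coxeterGen_mul_self {n : ℕ} (a : Fin n) : coxeterGen n a * coxeterGen n a = 1 := by
  have : PresentedGroup.mk (Set.range fun i : Fin n => (FreeGroup.of i : FreeGroup (Fin n)) ^ 2)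
      (FreeGroup.of a ^ 2) = 1 := PresentedGroup.one_of_mem ⟨a, rfl⟩
  rw [map_pow, pow_two] at this
  exact this

theorem coxeterGen_inv {n : ℕ} (a : Fin n) : (coxeterGen n a)⁻¹ = coxeterGen n a :=
  inv_eq_of_mul_eq_one_left (coxeterGen_mul_self a)

theorem closure_range_coxeterGen (n : ℕ) : Subgroup.closure (Set.range (coxeterGen n)) = ⊤ :=
  PresentedGroup.closure_range_of _

theorem prod_coxeterPush {n : ℕ} (a : Fin n) (l : List (Fin n)) :
    ((coxeterPush a l).map (coxeterGen n)).prod = coxeterGen n a * (l.map (coxeterGen n)).prod := by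
  cases l with
  | nil => simp [coxeterPush]
  | cons b l =>
    rw [coxeterPush]
    split_ifs with hb
    · subst hb
      rw [List.map_cons, List.prod_cons, ← mul_assoc, coxeterGen_mul_self, one_mul]
    · simp

theorem prod_coxeterWordAction {n : ℕ} (g : UniversalCoxeterGroup n)
    (l : {l : List (Fin n) // l.IsChain fun a b => b ≠ a}) :
    ((coxeterWordAction n g l).1.map (coxeterGen n)).prod =
      g * (l.1.map (coxeterGen n)).prod := by
  have h : g ∈ Subgroup.closure (Set.range (coxeterGen n)) := by
    rw [closure_range_coxeterGen]; trivial
  induction h using Subgroup.closure_induction_left with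
  | one => simp
  | mul_left x hx y hy ih =>
    obtain ⟨a, rfl⟩ := hx
    rw [map_mul, Equiv.Perm.mul_apply, coxeterWordAction_gen, prod_coxeterPush, ih, mul_assoc]
  | inv_mul_cancel x hx y hy ih =>
    obtain ⟨a, rfl⟩ := hx
    rw [coxeterGen_inv, map_mul, Equiv.Perm.mul_apply, coxeterWordAction_gen, prod_coxeterPush, ih,
      mul_assoc]

/-- Normal forms in the universal Coxeter group. -/
def coxeterWordGroup (n : ℕ) : WordGroup (Fin n) (UniversalCoxeterGroup n) where
  bar a := a
  bar_bar _ := rfl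
  gen := coxeterGen n
  gen_bar a := (coxeterGen_inv a).symm
  -- Van der Waerden's trick: the group acts on reduced words, and the normal form is the image of
  -- the empty word.
  nf g := (coxeterWordAction n g ⟨[], List.isChain_nil⟩).1
  nf_isChain g := (coxeterWordAction n g ⟨[], List.isChain_nil⟩).2
  prod_nf g := by simp [prod_coxeterWordAction]
  nf_prod l hl := by
    induction l with
    | nil => simp
    | cons a l ih =>
      rw [List.map_cons, List.prod_cons, map_mul, Equiv.Perm.mul_apply, coxeterWordAction_gen,
        ih hl.tail, coxeterPush_of_isChain hl]

/-- The homomorphisms of the free group that count a generator modulo 2. -/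
def freeParity (n : ℕ) (j : Fin n) : FreeGroup (Fin n) →* Multiplicative (ZMod 2) :=
  FreeGroup.lift fun i => if i = j then Multiplicative.ofAdd 1 else 1

theorem isDualTo_freeParity (n : ℕ) : IsDualTo (freeParity n) (FreeGroup.of : Fin n → _) :=
  fun i j => by simp [freeParity]

/-- The homomorphisms of the universal Coxeter group that count a generator modulo 2. -/
def coxeterParity (n : ℕ) (j : Fin n) : UniversalCoxeterGroup n →* Multiplicative (ZMod 2) :=
  PresentedGroup.toGroup (f := fun i => if i = j then Multiplicative.ofAdd 1 else 1) (by
    rintro _ ⟨a, rfl⟩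
    simp only [map_pow, FreeGroup.lift_apply_of]
    split_ifs <;> decide)

theorem isDualTo_coxeterParity (n : ℕ) : IsDualTo (coxeterParity n) (coxeterGen n) :=
  fun i j => by rw [coxeterParity, coxeterGen, PresentedGroup.toGroup.of]

theorem free_exists_hurwitz_eq {n : ℕ} (t : Fin n → FreeGroup (Fin n))
    (ht : t ∈ decompositions (FreeGroup.of : Fin n → _)) :
    ∃ b, hurwitz n _ b t = FreeGroup.of := by
  refine (freeWordGroup n).exists_hurwitz_eq (fun i => (i, true)) ?_ ?_
    (isDualTo_freeParity n) t ht
  · rw [WordGroup.Reduced, List.isChain_iff_getElem]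
    intro i hi
    simp [freeWordGroup]
  · intro i j h
    simp [freeWordGroup] at h

theorem reduced_ofFn_id (n : ℕ) : (coxeterWordGroup n).Reduced (List.ofFn id) := by
  rw [WordGroup.Reduced, List.isChain_iff_getElem]
  intro i hi
  simp [coxeterWordGroup]

theorem coxeter_exists_hurwitz_eq {n : ℕ} (t : Fin n → UniversalCoxeterGroup n)
    (ht : t ∈ decompositions (coxeterGen n)) : ∃ b, hurwitz n _ b t = coxeterGen n :=
  (coxeterWordGroup n).exists_hurwitz_eq id (reduced_ofFn_id n) (fun _ _ h => h.symm)
    (isDualTo_coxeterParity n) t ht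

/-! ### A left-invariant cyclic order on the universal Coxeter group -/

/-- The cyclic order on the natural numbers. -/
def NatCyc (a b c : ℕ) : Prop := (a < b ∧ b < c) ∨ (b < c ∧ c < a) ∨ (c < a ∧ a < b)

/-- The order in which a clockwise walk around the planar Cayley tree, after the edge labelled `c`,
meets the vertices with given words. The outgoing edges at a vertex are labelled `1, …, n` and
the vertex itself counts as the direction `0`. -/
def wordLT {n : ℕ} : ℕ → List (Fin n) → List (Fin n) → Prop
  | _, [], [] => False
  | c, [], m :: _ => NatCyc c 0 (m + 1)
  | c, l :: _, [] => NatCyc c (l + 1) 0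
  | c, l :: L, m :: M => (l = m ∧ wordLT (l + 1) L M) ∨ (l ≠ m ∧ NatCyc c (l + 1) (m + 1))

/-- The direction of the first step of a word. -/
def headDir {n : ℕ} (x : List (Fin n)) : ℕ := (x.head?.map fun a : Fin n => (a : ℕ) + 1).getD 0

/-- The direction of the last step of a word. -/
def lastDir {n : ℕ} (c : ℕ) (x : List (Fin n)) : ℕ :=
  (x.getLast?.map fun a : Fin n => (a : ℕ) + 1).getD c

/-- Two branches are compared at the vertex where they separate; only the arrival edge there and the
two departing directions matter. -/
theorem wordLT_append {n : ℕ} (c : ℕ) (p x y : List (Fin n))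
    (h : ∀ a ∈ x.head?, ∀ b ∈ y.head?, a ≠ b) :
    wordLT c (p ++ x) (p ++ y) ↔ NatCyc (lastDir c p) (headDir x) (headDir y) := by
  induction p generalizing c with
  | nil =>
    cases x <;> cases y <;> simp_all [wordLT, headDir, lastDir, NatCyc]
  | cons a p ih =>
    have : lastDir c (a :: p) = lastDir (a + 1) p := by
      cases p using List.reverseRecOn <;> simp [lastDir, List.getLast?_cons]
    simp [wordLT, ih, this]

theorem wordLT_trans {n : ℕ} (c : ℕ) (x y z : List (Fin n)) (h : wordLT c x y)
    (h' : wordLT c y z) : wordLT c x z := by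
  induction x generalizing c y z with
  | nil =>
    cases y with
    | nil => exact h.elim
    | cons b y =>
      cases z with
      | nil => simp only [wordLT, NatCyc] at *; omega
      | cons d z =>
        simp only [wordLT] at *
        rcases h' with ⟨rfl, -⟩ | ⟨-, h'⟩
        · exact h
        · simp only [NatCyc] at *; omega
  | cons a x ih =>
    cases y with
    | nil =>
      cases z with
      | nil => exact h'.elim
      | cons d z =>
        simp only [wordLT] at *
        by_cases had : a = d
        · subst had; simp only [NatCyc] at *; omega
        · exact Or.inr ⟨had, by simp only [NatCyc] at *; omega⟩
    | cons b y =>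
      cases z with
      | nil =>
        simp only [wordLT] at *
        rcases h with ⟨rfl, -⟩ | ⟨-, h⟩
        · exact h'
        · simp only [NatCyc] at *; omega
      | cons d z =>
        simp only [wordLT] at *
        rcases h with ⟨rfl, h⟩ | ⟨hab, h⟩
        · rcases h' with ⟨rfl, h'⟩ | ⟨had, h'⟩
          · exact Or.inl ⟨rfl, ih _ _ _ h h'⟩
          · exact Or.inr ⟨had, h'⟩
        · rcases h' with ⟨rfl, h'⟩ | ⟨hbd, h'⟩
          · exact Or.inr ⟨hab, h⟩
          · refine Or.inr ⟨?_, ?_⟩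
            · rintro rfl; simp only [NatCyc] at *; omega
            · simp only [NatCyc] at *; omega

/-- The subtree behind the vertex `p` is an interval of the order: a walk around the planar tree
enters it once and leaves it once. -/
theorem prefix_of_wordLT {n : ℕ} (c : ℕ) (p x y z : List (Fin n)) (h : wordLT c (p ++ x) y)
    (h' : wordLT c y (p ++ z)) : p <+: y := by
  induction p generalizing c y with
  | nil => exact List.nil_prefix
  | cons a p ih =>
    cases y with
    | nil => simp only [List.cons_append, wordLT, NatCyc] at *; omega
    | cons b y =>
      simp only [List.cons_append, wordLT] at *
      by_cases hab : a = b
      · subst hab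
        simp only [true_and, ne_eq, not_true_eq_false, false_and, or_false] at h h'
        exact List.cons_prefix_cons.2 ⟨rfl, ih _ _ h h'⟩
      · simp only [hab, Ne.symm hab, false_and, false_or, NatCyc] at *
        omega

/-- The left-invariant cyclic order on the universal Coxeter group. -/
def CoxCyc {n : ℕ} (x y z : UniversalCoxeterGroup n) : Prop :=
  wordLT 0 ((coxeterWordGroup n).nf (x⁻¹ * y)) ((coxeterWordGroup n).nf (x⁻¹ * z))

namespace CoxCyc

variable {n : ℕ} {x y z w : UniversalCoxeterGroup n}

theorem mul_left (h : CoxCyc x y z) (g : UniversalCoxeterGroup n) :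
    CoxCyc (g * x) (g * y) (g * z) := by
  simpa [CoxCyc, mul_assoc] using h

theorem trans (h : CoxCyc x y z) (h' : CoxCyc x z w) : CoxCyc x y w := wordLT_trans _ _ _ _ h h'

/-- The three vertices 1, x, y span a tripod. Its centre p is given by the common prefix of the
words of x and y. Seen from 1 or from x, the order is decided by the same three directions at p, and
`NatCyc` is invariant under rotation. -/
theorem one_rotate (h : CoxCyc 1 x y) : CoxCyc x y 1 := by
  let D := coxeterWordGroup n
  obtain ⟨X, hX, rfl⟩ : ∃ X, D.Reduced X ∧ x = D.val X := ⟨D.nf x, D.reduced_nf x, by simp⟩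
  obtain ⟨Y, hY, rfl⟩ : ∃ X, D.Reduced X ∧ y = D.val X := ⟨D.nf y, D.reduced_nf y, by simp⟩
  obtain ⟨p, u, v, rfl, rfl, huv⟩ := List.exists_common_prefix X Y
  have hu : D.Reduced u := (D.reduced_append.1 hX).2.1
  have hv : D.Reduced v := (D.reduced_append.1 hY).2.1
  have hp : D.Reduced p := (D.reduced_append.1 hX).1
  have hpv : ∀ a ∈ v.head?, ∀ b ∈ (D.inv p).head?, a ≠ b := by
    intro a ha b hb
    rw [D.head?_inv] at hb
    obtain ⟨c, hc, rfl⟩ := Option.map_eq_some_iff.1 hb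
    exact (D.reduced_append.1 hY).2.2 c hc a ha
  have h1 : D.nf ((D.val (p ++ u))⁻¹ * D.val (p ++ v)) = D.inv u ++ v := by
    have hred : D.Reduced (D.inv u ++ v) := by
      rw [D.reduced_append]
      refine ⟨D.reduced_inv hu, hv, ?_⟩
      intro a ha b hb
      rw [D.getLast?_inv] at ha
      obtain ⟨c, hc, rfl⟩ := Option.map_eq_some_iff.1 ha
      rw [D.bar_bar]
      exact (huv c hc b hb).symm
    rw [← D.nf_val hred]
    simp [mul_assoc]
  have h2 : D.nf ((D.val (p ++ u))⁻¹ * 1) = D.inv u ++ D.inv p := by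
    rw [mul_one, D.nf_inv, D.nf_val hX]
    simp [WordGroup.inv]
  rw [CoxCyc, inv_one, one_mul, one_mul, D.nf_val hX, D.nf_val hY, wordLT_append _ _ _ _ huv] at h
  rw [CoxCyc, h1, h2, wordLT_append _ _ _ _ hpv]
  -- Generators are their own inverses, so an edge has the same label in both directions. For empty
  -- `u` both sides are the default direction 0.
  have e1 : lastDir 0 (D.inv u) = headDir u := by
    rw [lastDir, D.getLast?_inv, headDir, Option.map_map]
    rfl
  have e2 : headDir (D.inv p) = lastDir 0 p := by
    rw [lastDir, headDir, D.head?_inv, Option.map_map]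
    rfl
  rw [e1, e2]
  simp only [NatCyc] at *
  omega

theorem rotate (h : CoxCyc x y z) : CoxCyc y z x := by
  have := (h.mul_left x⁻¹)
  rw [inv_mul_cancel] at this
  simpa using this.one_rotate.mul_left x

/-- Here and in the next two lemmas, `CoxCyc w` is to be read as the strict linear order obtained by
cutting the circle at `w`. -/
theorem of_lt_lt (h : CoxCyc w x y) (h' : CoxCyc w y z) : CoxCyc x y z :=
  (h'.rotate.trans h.rotate.rotate).rotate.rotate

theorem lt_left_of_between (h : CoxCyc w x y) (h' : CoxCyc x z y) : CoxCyc w x z :=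
  (h'.trans h.rotate).rotate.rotate

theorem lt_right_of_between (h : CoxCyc w x y) (h' : CoxCyc x z y) : CoxCyc w z y :=
  (h.rotate.rotate.trans h'.rotate.rotate).rotate

end CoxCyc

/-! ### Cyclic order on the entries of a decomposition of the Coxeter element -/

theorem mul_self_of_mem_conjSet {n : ℕ} {r : UniversalCoxeterGroup n}
    (hr : r ∈ conjSet (coxeterGen n)) : r * r = 1 := by
  obtain ⟨j, w, rfl⟩ := hr
  have := coxeterGen_mul_self j
  rw [show w * coxeterGen n j * w⁻¹ * (w * coxeterGen n j * w⁻¹) =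
    w * (coxeterGen n j * coxeterGen n j) * w⁻¹ by group, this]
  group

theorem inv_of_mem_conjSet {n : ℕ} {r : UniversalCoxeterGroup n}
    (hr : r ∈ conjSet (coxeterGen n)) : r⁻¹ = r :=
  inv_eq_of_mul_eq_one_left (mul_self_of_mem_conjSet hr)

/-- The decompositions of the Coxeter element whose inverse partial products are in order. -/
def orderedDecompositions (n : ℕ) : Set (Fin n → UniversalCoxeterGroup n) :=
  {t | t ∈ decompositions (coxeterGen n) ∧ ∀ k, 1 ≤ k → k < n →
    CoxCyc 1 (partialProd t k)⁻¹ (partialProd t (k + 1))⁻¹}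

/-- The inverse partial products have reduced words starting with the successive generators, so the
increasing first letters already order them. -/
theorem coxeterGen_mem_orderedDecompositions (n : ℕ) :
    coxeterGen n ∈ orderedDecompositions n := by
  refine ⟨⟨self_mem_conjSet _, rfl⟩, ?_⟩
  let D := coxeterWordGroup n
  have key : ∀ k (hk : k < n), ∃ L, D.nf (partialProd (coxeterGen n) (k + 1))⁻¹ = ⟨k, hk⟩ :: L := by
    intro k hk
    have h1 : partialProd (coxeterGen n) (k + 1) = D.val ((List.ofFn id).take (k + 1)) := by
      rw [partialProd, WordGroup.val, List.map_take, List.map_ofFn]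
      rfl
    have h2 : D.Reduced ((List.ofFn id).take (k + 1)) := List.IsChain.take (reduced_ofFn_id n) _
    rw [h1, D.nf_inv, D.nf_val h2, ← List.head?_eq_some_iff, D.head?_inv, List.getLast?_take]
    simp [hk]
    rfl
  intro k hk hkn
  obtain ⟨k, rfl⟩ : ∃ j, k = j + 1 := ⟨k - 1, by omega⟩
  obtain ⟨L, hL⟩ := key k (by omega)
  obtain ⟨M, hM⟩ := key (k + 1) hkn
  rw [CoxCyc, inv_one, one_mul, one_mul, hL, hM]
  simp [wordLT, NatCyc]

/-- The move at `i` changes only the inverse partial product of index i + 1. Entries are involutions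
exchanging consecutive inverse partial products, and left-invariance places the new one inside one
of the two adjacent gaps. -/
theorem hurwitzStep_mem_orderedDecompositions {n : ℕ} (i : Fin (n - 1)) (ε : Bool)
    (t : Fin n → UniversalCoxeterGroup n) (ht : t ∈ orderedDecompositions n) :
    hurwitzStep n _ i ε t ∈ orderedDecompositions n := by
  refine ⟨hurwitzStep_mem_decompositions _ i ε t ht.1, ?_⟩
  set q : ℕ → UniversalCoxeterGroup n := fun k => (partialProd t k)⁻¹ with hq
  set q' : ℕ → UniversalCoxeterGroup n := fun k => (partialProd (hurwitzStep n _ i ε t) k)⁻¹ with hq'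
  have hlt : ∀ k, 1 ≤ k → k < n → CoxCyc 1 (q k) (q (k + 1)) := ht.2
  have hle : ∀ k : ℕ, k ≤ i → q' k = q k := fun k hk => by
    simp only [hq, hq', partialProd_hurwitzStep_of_le i ε t k hk]
  have hgt : ∀ k : ℕ, (i : ℕ) + 1 < k → k ≤ n → q' k = q k := fun k hk hk' => by
    simp only [hq, hq', partialProd_hurwitzStep_of_lt i ε t k hk hk']
  have hi := i.2
  set a := t ⟨i, by omega⟩ with ha
  set b := t ⟨i + 1, by omega⟩ with hb
  have ha1 : a⁻¹ = a := inv_of_mem_conjSet (ht.1.1 _)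
  have hb1 : b⁻¹ = b := inv_of_mem_conjSet (ht.1.1 _)
  have ha2 : a * a = 1 := mul_self_of_mem_conjSet (ht.1.1 _)
  have hb2 : b * b = 1 := mul_self_of_mem_conjSet (ht.1.1 _)
  have q1 : q (i + 1) = a * q i := by
    simp only [hq]
    rw [partialProd_succ t (by omega), mul_inv_rev, ← ha, ha1]
  have q2 : q (i + 2) = b * q (i + 1) := by
    simp only [hq]
    rw [partialProd_succ t (by omega), mul_inv_rev, ← hb, hb1]
  have q1' : q' (i + 1) = (stepFst ε a b)⁻¹ * q i := by
    rw [← hle i le_rfl]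
    simp only [hq']
    rw [partialProd_succ _ (by omega), mul_inv_rev, hurwitzStep_fst]
  -- For i = 0 the point `q 0 = 1` is the cutting point itself, so it is not part of the linearly
  -- ordered chain and is treated apart.
  have hpmr : CoxCyc (q i) (q (i + 1)) (q (i + 2)) := by
    rcases Nat.eq_zero_or_pos (i : ℕ) with h0 | h0
    · have : q i = 1 := by simp [hq, h0]
      rw [this]
      exact hlt (i + 1) (by omega) (by omega)
    · exact (hlt i h0 (by omega)).of_lt_lt (hlt (i + 1) (by omega) (by omega))
  have hmr := hlt (i + 1) (by omega) (by omega)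
  have hnew : (1 ≤ (i : ℕ) → CoxCyc 1 (q i) (q' (i + 1))) ∧
      CoxCyc 1 (q' (i + 1)) (q (i + 2)) := by
    cases ε
    -- Left multiplication by `b` exchanges `q (i + 1)` and `q (i + 2)` and sends `q i` to the new
    -- point.
    · have h : CoxCyc (q (i + 1)) (q' (i + 1)) (q (i + 2)) := by
        have := hpmr.mul_left b
        rw [← q2, q2, ← mul_assoc b b, hb2, one_mul, ← q2] at this
        rw [q1', stepFst_false, hb1]
        exact this.rotate.rotate
      exact ⟨fun h0 => (hlt i h0 (by omega)).trans (hmr.lt_left_of_between h),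
        hmr.lt_right_of_between h⟩
    -- Left multiplication by `a` exchanges `q i` and `q (i + 1)` and sends `q (i + 2)` to the new
    -- point.
    · have h : CoxCyc (q i) (q' (i + 1)) (q (i + 1)) := by
        have := hpmr.mul_left a
        rw [← q1, q2, q1, ← mul_assoc a a, ha2, one_mul] at this
        rw [q1', stepFst_true, mul_inv_rev, mul_inv_rev, inv_inv, hb1, ha1, q1]
        simp only [mul_assoc] at *
        exact this.rotate
      refine ⟨fun h0 => (hlt i h0 (by omega)).lt_left_of_between h, ?_⟩
      rcases Nat.eq_zero_or_pos (i : ℕ) with h0 | h0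
      · have : q i = 1 := by simp [hq, h0]
        rw [this] at h
        exact h.trans hmr
      · exact ((hlt i h0 (by omega)).lt_right_of_between h).trans hmr
  intro k hk hkn
  change CoxCyc 1 (q' k) (q' (k + 1))
  rcases lt_trichotomy k i with h | h | h
  · rw [hle k (by omega), hle (k + 1) (by omega)]
    exact hlt k hk hkn
  · subst h
    rw [hle i le_rfl]
    exact hnew.1 hk
  · rcases Nat.eq_or_lt_of_le (Nat.succ_le_of_lt h) with h' | h'
    · obtain rfl : k = (i : ℕ) + 1 := h'.symm
      rw [hgt (i + 1 + 1) (by omega) (by omega)]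
      exact hnew.2
    · rw [hgt k h' (by omega), hgt (k + 1) (by omega) (by omega)]
      exact hlt k hk hkn

/-- Transitivity turns a property of the base decomposition that is invariant under moves into a
property of all decompositions. -/
theorem orderedDecompositions_eq (n : ℕ) :
    orderedDecompositions n = decompositions (coxeterGen n) := by
  refine Set.Subset.antisymm (fun t ht => ht.1) fun t ht => ?_
  obtain ⟨b, hb⟩ := coxeter_exists_hurwitz_eq t ht
  have := hurwitz_mem (hurwitzStep_mem_orderedDecompositions (n := n)) b⁻¹ _
    (coxeterGen_mem_orderedDecompositions n)
  rw [← hb, map_inv] at this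
  simpa using this

theorem coxCyc_of_mem_decompositions {n : ℕ} {t : Fin n → UniversalCoxeterGroup n}
    (ht : t ∈ decompositions (coxeterGen n)) (i : ℕ) (hi : i + 1 < n) :
    CoxCyc 1 (t ⟨i, by omega⟩) (t ⟨i + 1, hi⟩) := by
  induction i generalizing t with
  | zero =>
    have h := ht
    rw [← orderedDecompositions_eq] at h
    have h1 := h.2 1 le_rfl hi
    have e1 : partialProd t 1 = t ⟨0, by omega⟩ := by
      simpa using partialProd_succ t (show 0 < n by omega)
    have e2 : partialProd t (1 + 1) = t ⟨0, by omega⟩ * t ⟨0 + 1, hi⟩ := by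
      rw [partialProd_succ t hi, e1]
    rw [e1, e2, mul_inv_rev, inv_of_mem_conjSet (ht.1 _), inv_of_mem_conjSet (ht.1 _)] at h1
    -- The ordered triple (1, t₀, t₁t₀), multiplied by t₁, gives (t₁, t₁t₀, t₀); together the two
    -- force (1, t₀, t₁).
    have h2 := h1.mul_left (t ⟨0 + 1, hi⟩)
    rw [← mul_assoc, mul_self_of_mem_conjSet (ht.1 _), one_mul, mul_one] at h2
    exact (h2.rotate.rotate.trans h1.rotate).rotate.rotate
  | succ i ih =>
    -- Two inverse moves shift the pair at i + 1, i + 2 unchanged to the positions i, i + 1.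
    have h1 := hurwitzStep_mem_decompositions _ ⟨i, by omega⟩ false t ht
    have h2 := hurwitzStep_mem_decompositions _ ⟨i + 1, by omega⟩ false _ h1
    have h3 := ih h2 (by omega)
    rw [hurwitzStep_of_ne _ _ _ _ (by simp) (by simp; omega)] at h3
    have e1 := hurwitzStep_fst (n := n) ⟨i, by omega⟩ false t (by simp; omega)
    have e2 := hurwitzStep_fst (n := n) ⟨i + 1, by omega⟩ false
      (hurwitzStep n _ ⟨i, by omega⟩ false t) (by simp; omega)
    have e3 := hurwitzStep_of_ne (n := n) ⟨i, by omega⟩ false t ⟨i + 1 + 1, hi⟩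
      (by simp; omega) (by simp)
    simp only [stepFst_false] at e1 e2 e3
    rw [e3] at e2
    rw [e1, e2] at h3
    exact h3

/-! ### The prefix order on reflections -/

/-- The first half, including the middle letter, of the reduced word of a reflection. -/
def rootWord {n : ℕ} (r : UniversalCoxeterGroup n) : List (Fin n) :=
  ((coxeterWordGroup n).nf r).take (((coxeterWordGroup n).norm r + 1) / 2)

/-- The root word of `r` is a proper prefix of the root word of `s`. -/
def Below {n : ℕ} (r s : UniversalCoxeterGroup n) : Prop :=
  ∃ z, z ≠ [] ∧ rootWord s = rootWord r ++ z

section Below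

variable {n : ℕ}

local notation "D" => coxeterWordGroup n
local notation "T" => conjSet (coxeterGen n)

theorem rootWord_prefix (r : UniversalCoxeterGroup n) : rootWord r <+: (D).nf r :=
  List.take_prefix _ _

theorem rootWord_conj {u : List (Fin n)} {a : Fin n} (h : (D).IsRootWord u a) :
    rootWord ((D).val u * (D).gen a * ((D).val u)⁻¹) = u ++ [a] := by
  rw [rootWord, h.norm_conj, h.nf_conj, show (2 * u.length + 1 + 1) / 2 = u.length + 1 by omega,
    List.take_length_add_append]
  rfl

theorem exists_rootWord {r : UniversalCoxeterGroup n} (hr : r ∈ T) :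
    ∃ u a, (D).IsRootWord u a ∧ r = (D).val u * (D).gen a * ((D).val u)⁻¹ ∧
      rootWord r = u ++ [a] := by
  obtain ⟨j, w, rfl⟩ := hr
  obtain ⟨u, hu, h⟩ := (D).exists_isRootWord w j
  exact ⟨u, j, hu, h, by rw [← rootWord_conj hu, ← h]; rfl⟩

theorem rootWord_injOn : Set.InjOn (rootWord (n := n)) T := by
  intro r hr s hs h
  obtain ⟨u, a, -, rfl, h1⟩ := exists_rootWord hr
  obtain ⟨v, b, -, rfl, h2⟩ := exists_rootWord hs
  rw [h1, h2] at h
  obtain ⟨rfl, hab⟩ := List.append_inj' h rfl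
  rw [List.singleton_inj.1 hab]

theorem norm_eq_length_rootWord {r : UniversalCoxeterGroup n} (hr : r ∈ T) :
    (D).norm r + 1 = 2 * (rootWord r).length := by
  obtain ⟨u, a, hu, rfl, h1⟩ := exists_rootWord hr
  rw [h1, hu.norm_conj]
  simp
  omega

theorem Below.trans {r s q : UniversalCoxeterGroup n} (h : Below r s) (h' : Below s q) :
    Below r q := by
  obtain ⟨z, hz, h⟩ := h
  obtain ⟨w, hw, h'⟩ := h'
  exact ⟨z ++ w, by simp [hz], by rw [h', h, List.append_assoc]⟩

theorem Below.norm_lt {r s : UniversalCoxeterGroup n} (h : Below r s) (hr : r ∈ T) (hs : s ∈ T) :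
    (D).norm r < (D).norm s := by
  have h1 := norm_eq_length_rootWord hr
  have h2 := norm_eq_length_rootWord hs
  obtain ⟨z, hz, h⟩ := h
  rw [h, List.length_append] at h2
  have := List.length_pos_iff.2 hz
  omega

theorem below_of_prefix {r s : UniversalCoxeterGroup n} (hr : r ∈ T) (hs : s ∈ T) (hne : r ≠ s)
    (h : rootWord r <+: rootWord s) : Below r s := by
  obtain ⟨z, hz⟩ := h
  refine ⟨z, ?_, hz.symm⟩
  rintro rfl
  rw [List.append_nil] at hz
  exact hne (rootWord_injOn hr hs hz)

theorem Below.total {r s q : UniversalCoxeterGroup n} (hr : r ∈ T) (hs : s ∈ T) (hne : r ≠ s)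
    (h : Below r q) (h' : Below s q) : Below r s ∨ Below s r := by
  obtain ⟨z, -, h⟩ := h
  obtain ⟨w, -, h'⟩ := h'
  rcases List.prefix_or_prefix_of_prefix (l₁ := rootWord r) (l₂ := rootWord s)
    (l₃ := rootWord q) ⟨z, h.symm⟩ ⟨w, h'.symm⟩ with h1 | h1
  · exact Or.inl (below_of_prefix hr hs hne h1)
  · exact Or.inr (below_of_prefix hs hr hne.symm h1)

theorem below_iff {u v : List (Fin n)} {a b : Fin n} (hu : (D).IsRootWord u a)
    (hv : (D).IsRootWord v b) :
    Below ((D).val u * (D).gen a * ((D).val u)⁻¹) ((D).val v * (D).gen b * ((D).val v)⁻¹) ↔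
      ∃ z, v = u ++ a :: z := by
  rw [Below, rootWord_conj hu, rootWord_conj hv]
  constructor
  · rintro ⟨z, hz, h⟩
    obtain ⟨y, c, rfl⟩ := (List.eq_nil_or_concat z).resolve_left hz
    rw [List.concat_eq_append, ← List.append_assoc] at h
    obtain ⟨h, -⟩ := List.append_inj' h rfl
    exact ⟨y, by simp [h]⟩
  · rintro ⟨z, rfl⟩
    exact ⟨z ++ [b], by simp, by simp⟩

theorem conj_mem {r s : UniversalCoxeterGroup n} (hr : r ∈ T) (hs : s ∈ T) :
    r * (s * r) ∈ T := by
  have := conj_mem_conjSet hs r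
  rwa [inv_of_mem_conjSet hr, mul_assoc] at this

/-- Conjugation by the lower reflection deletes the last letter of its root word from inside the
longer root word, shortening the reflection by at least 2. -/
theorem Below.norm_conj_lt {r s : UniversalCoxeterGroup n} (h : Below r s) (hr : r ∈ T)
    (hs : s ∈ T) : (D).norm (r * (s * r)) < (D).norm s := by
  have hinv := inv_of_mem_conjSet hr
  obtain ⟨u, a, hu, rfl, -⟩ := exists_rootWord hr
  obtain ⟨v, b, hv, rfl, -⟩ := exists_rootWord hs
  obtain ⟨z, rfl⟩ := (below_iff hu hv).1 h
  have h1 : (D).val u * (D).gen a * ((D).val u)⁻¹ *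
      ((D).val (u ++ a :: z) * (D).gen b * ((D).val (u ++ a :: z))⁻¹ *
        ((D).val u * (D).gen a * ((D).val u)⁻¹)) =
      (D).val (u ++ z) * (D).gen b * ((D).val (u ++ z))⁻¹ := by
    have hbar : (D).bar a = a := rfl
    rw [← (D).conj_val_append u z a b, hinv, hbar]
    simp only [mul_assoc]
  rw [h1, hv.norm_conj]
  have := (D).norm_conj_le (u ++ z) b
  simp only [List.length_append, List.length_cons] at *
  omega

/-- Conjugation by `s`, then by `r`, deletes two different letters of the root word of `q`. -/
theorem Below.norm_conj_conj_lt {r s q : UniversalCoxeterGroup n} (h : Below r s)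
    (h' : Below s q) (hr : r ∈ T) (hs : s ∈ T) (hq : q ∈ T) :
    (D).norm (r * (s * (q * (s * r)))) < (D).norm q := by
  have hinv := inv_of_mem_conjSet hr
  have hinv' := inv_of_mem_conjSet hs
  obtain ⟨u, a, hu, rfl, -⟩ := exists_rootWord hr
  obtain ⟨v, b, hv, rfl, -⟩ := exists_rootWord hs
  obtain ⟨w, c, hw, rfl, -⟩ := exists_rootWord hq
  obtain ⟨y, rfl⟩ := (below_iff hu hv).1 h
  obtain ⟨z, rfl⟩ := (below_iff hv hw).1 h'
  have h1 := (D).conj_val_append (u ++ a :: y) z b c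
  have h2 := (D).conj_val_append u (y ++ z) a c
  rw [hinv'] at h1
  rw [hinv] at h2
  have e : u ++ (D).bar a :: (y ++ z) = u ++ a :: y ++ z := by simp [coxeterWordGroup]
  rw [e, ← h1] at h2
  simp only [mul_assoc] at h2 hw ⊢
  have hbar : (D).bar b = b := rfl
  rw [hbar] at h2
  have h3 := (D).norm_conj_le (u ++ (y ++ z)) c
  have h4 := hw.norm_conj
  simp only [mul_assoc] at h3 h4
  rw [h2, h4]
  simp only [List.length_append, List.length_cons] at *
  omega

/-- The reflection flips the edge from u to u a of the Cayley tree, hence carries vertices outside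
the half-tree behind u a into it. -/
theorem rootWord_prefix_nf_mul {u : List (Fin n)} {a : Fin n} (hu : (D).IsRootWord u a)
    (x : UniversalCoxeterGroup n) (h : ¬ u ++ [a] <+: (D).nf x) :
    u ++ [a] <+: (D).nf ((D).val u * (D).gen a * ((D).val u)⁻¹ * x) := by
  have hz : ∃ z, (D).Reduced z ∧ x = (D).val u * (D).val z :=
    ⟨(D).nf (((D).val u)⁻¹ * x), (D).reduced_nf _, by simp⟩
  obtain ⟨z, hz, rfl⟩ := hz
  by_cases h1 : ∃ z', z = a :: z'
  · obtain ⟨z, rfl⟩ := h1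
    exfalso
    apply h
    have hred : (D).Reduced (u ++ (a :: z)) :=
      (D).reduced_append.2 ⟨hu.reduced, hz, fun c hc d hd => by
        simp only [List.head?_cons, Option.mem_def, Option.some.injEq] at hd
        subst hd
        exact ((D).reduced_concat.1 hu.1).2 c hc⟩
    rw [← (D).val_append, (D).nf_val hred]
    exact ⟨z, by simp⟩
  · have hred : (D).Reduced ((u ++ [a]) ++ z) := by
      refine (D).reduced_append.2 ⟨hu.1, hz, fun c hc d hd => ?_⟩
      simp only [List.getLast?_append, List.getLast?_singleton, Option.some_or, Option.mem_def,
        Option.some.injEq] at hc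
      subst hc
      rintro rfl
      apply h1
      cases z with
      | nil => simp at hd
      | cons e z => exact ⟨z, by simp at hd; rw [hd]⟩
    have e : (D).val u * (D).gen a * ((D).val u)⁻¹ * ((D).val u * (D).val z) =
        (D).val ((u ++ [a]) ++ z) := by simp [mul_assoc]
    rw [e, (D).nf_val hred]
    exact List.prefix_append _ _

/-- The edge flipped by `s` lies outside the half-tree behind the edge of `r`, so `r` carries both
its ends into that half-tree. -/
theorem below_conj_of_not_below {r s : UniversalCoxeterGroup n} (hr : r ∈ T) (hs : s ∈ T)
    (hne : r ≠ s) (h : ¬ Below r s) : Below r (r * (s * r)) := by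
  have hinv := inv_of_mem_conjSet hr
  obtain ⟨u, a, hu, rfl, hru⟩ := exists_rootWord hr
  obtain ⟨v, b, hv, rfl, hsv⟩ := exists_rootWord hs
  rw [below_iff hu hv] at h
  have h1 : ¬ u ++ [a] <+: (D).nf ((D).val v) := by
    rw [(D).nf_val hv.reduced]
    rintro ⟨z, hz⟩
    exact h ⟨z, by simp [← hz]⟩
  have h2 : ¬ u ++ [a] <+: (D).nf ((D).val (v ++ [b])) := by
    rw [(D).nf_val hv.1, List.prefix_concat_iff]
    rintro (h2 | ⟨z, hz⟩)
    · rw [← hru, ← hsv] at h2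
      exact hne (rootWord_injOn hr hs h2)
    · exact h ⟨z, by simp [← hz]⟩
  have h3 := rootWord_prefix_nf_mul hu _ h1
  have h4 := rootWord_prefix_nf_mul hu _ h2
  set r := (D).val u * (D).gen a * ((D).val u)⁻¹ with hrdef
  obtain ⟨X, hX, hXr⟩ : ∃ X, (D).Reduced X ∧ r * (D).val v = (D).val X :=
    ⟨_, (D).reduced_nf _, ((D).val_nf _).symm⟩
  have e : r * ((D).val v * (D).gen b * ((D).val v)⁻¹ * r) =
      (D).val X * (D).gen b * ((D).val X)⁻¹ := by
    rw [← hXr, mul_inv_rev, hinv]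
    simp only [mul_assoc]
  have e2 : r * (D).val (v ++ [b]) = (D).val X * (D).gen b := by
    rw [← hXr]
    simp [mul_assoc]
  rw [hXr, (D).nf_val hX] at h3
  rw [e2] at h4
  rw [e]
  by_cases hXb : (D).Reduced (X ++ [b])
  · rw [hrdef, below_iff hu ⟨hXb, hXb⟩]
    obtain ⟨z, rfl⟩ := h3
    exact ⟨z, by simp⟩
  -- Here the reflection traverses its edge towards the identity: `Y` is the near end of the edge,
  -- and `h4` rather than `h3` gives the prefix.
  · obtain ⟨Y, rfl⟩ : ∃ Y, X = Y ++ [b] := by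
      rw [(D).reduced_concat] at hXb
      push Not at hXb
      obtain ⟨c, hc, rfl⟩ := hXb hX
      obtain ⟨Y, rfl⟩ := List.getLast?_eq_some_iff.1 hc
      exact ⟨Y, rfl⟩
    have hbb : (D).gen b * (D).gen b = 1 := coxeterGen_mul_self b
    have e3 : (D).val (Y ++ [b]) * (D).gen b = (D).val Y := by
      simp [mul_assoc, hbb]
    have e4 : (D).val (Y ++ [b]) * (D).gen b * ((D).val (Y ++ [b]))⁻¹ =
        (D).val Y * (D).gen b * ((D).val Y)⁻¹ := by
      simp [mul_assoc]
    rw [e3, (D).nf_val ((D).reduced_append.1 hX).1] at h4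
    rw [hrdef, e4, below_iff hu ⟨hX, hX⟩]
    obtain ⟨z, rfl⟩ := h4
    exact ⟨z, by simp⟩

/-- Conjugating back by `r` shortens, because `r` is below the conjugate. -/
theorem norm_lt_norm_conj {r s : UniversalCoxeterGroup n} (hr : r ∈ T) (hs : s ∈ T)
    (hne : r ≠ s) (h : ¬ Below r s) : (D).norm s < (D).norm (r * (s * r)) := by
  have h1 := (below_conj_of_not_below hr hs hne h).norm_conj_lt hr (conj_mem hr hs)
  have h2 := mul_self_of_mem_conjSet hr
  rwa [← mul_assoc, ← mul_assoc, h2, one_mul, mul_assoc, h2, mul_one] at h1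

/-- An adjacent triple in a decomposition of the Coxeter element has no strict local minimum for
the prefix order. -/
theorem not_below_both {t : Fin n → UniversalCoxeterGroup n}
    (ht : t ∈ decompositions (coxeterGen n)) (i : ℕ) (hi : i + 2 < n)
    (h : Below (t ⟨i + 1, by omega⟩) (t ⟨i, by omega⟩))
    (h' : Below (t ⟨i + 1, by omega⟩) (t ⟨i + 2, hi⟩)) : False := by
  induction hN : (D).norm (t ⟨i, by omega⟩) using Nat.strong_induction_on generalizing t with
  | _ N ih =>
    subst hN
    -- The inverse move turns the valley (x, y, z) into (y, yxy, z), which will be a valley again.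
    have ht' := hurwitzStep_mem_decompositions _ ⟨i, by omega⟩ false t ht
    set t' := hurwitzStep n _ ⟨i, by omega⟩ false t
    set x := t ⟨i, by omega⟩ with hx
    set y := t ⟨i + 1, by omega⟩ with hy
    set z := t ⟨i + 2, hi⟩ with hz
    have hxT : x ∈ T := ht.1 _
    have hyT : y ∈ T := ht.1 _
    have hzT : z ∈ T := ht.1 _
    have e0 : t' ⟨i, by omega⟩ = y := hurwitzStep_fst _ _ _ _
    have e1 : t' ⟨i + 1, by omega⟩ = y * (x * y) := by
      have := hurwitzStep_snd (n := n) ⟨i, by omega⟩ false t (by simp; omega)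
      simp only [stepSnd_false] at this
      rwa [← hx, ← hy, inv_of_mem_conjSet hyT, mul_assoc] at this
    have e2 : t' ⟨i + 2, hi⟩ = z := hurwitzStep_of_ne _ _ _ _ (by simp) (by simp)
    have h1 := coxCyc_of_mem_decompositions ht' i (by omega)
    have h2 := coxCyc_of_mem_decompositions ht' (i + 1) (by omega)
    rw [e0, e1] at h1
    rw [e1, e2] at h2
    have hvT := conj_mem hyT hxT
    have hvx := h.norm_conj_lt hyT hxT
    have hyx := h.norm_lt hyT hxT
    set v := y * (x * y) with hv
    have hyv : y * (v * y) = x := by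
      have h2 := mul_self_of_mem_conjSet hyT
      rw [hv, ← mul_assoc, ← mul_assoc, h2, one_mul, mul_assoc, h2, mul_one]
    -- Otherwise conjugating v by y would shorten it, but that gives back x, which is longer.
    have hnb : ¬ Below y v := fun hb => by
      have := hb.norm_conj_lt hyT hvT
      rw [hyv] at this
      omega
    have hne : v ≠ y := by
      intro hvy
      rw [hvy, mul_self_of_mem_conjSet hyT, mul_one] at hyv
      rw [hyv] at hyx
      omega
    -- In the cyclic order v lies between y and z, both of which lie behind the root word of y; the
    -- interval property applies.
    have hpre : rootWord y <+: (D).nf v := by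
      simp only [CoxCyc, inv_one, one_mul] at h1 h2
      obtain ⟨p, hp⟩ := rootWord_prefix y
      obtain ⟨q, hq⟩ := rootWord_prefix z
      obtain ⟨w, -, hw⟩ := h'
      rw [hw, List.append_assoc] at hq
      rw [← hp] at h1
      rw [← hq] at h2
      exact prefix_of_wordLT _ _ _ _ _ h1 h2
    have hvy : Below v y := by
      rcases List.prefix_or_prefix_of_prefix hpre (rootWord_prefix v) with h3 | h3
      · exact (hnb (below_of_prefix hyT hvT hne.symm h3)).elim
      · exact below_of_prefix hvT hyT hne h3
    refine ih _ ?_ ht' ?_ ?_ rfl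
    · rw [e0]; exact hyx
    · rw [e0, e1]; exact hvy
    · rw [e1, e2]; exact hvy.trans h'

end Below

/-! ### Trivial stabilizers from a height function -/

section Descent

variable {B X ι : Type*} [Group B] (φ : B →* Equiv.Perm X) (g : ι → B) (L : X → ℕ) (x₀ : X)

/-- `b` is a product of generators along a path from `x` to `x₀` of decreasing height. -/
inductive IsDescent : X → B → Prop
  | base : IsDescent x₀ 1
  | step (x : X) (i : ι) (b : B) : L (φ (g i) x) < L x → IsDescent (φ (g i) x) b →
      IsDescent x (b * g i)

/-- Adjacency in the graph of the action, between vertices lower than `x`. -/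
def LowAdj (x : X) (b b' : B) : Prop := ∃ i, b' = g i * b ∧ L (φ b x) < L x ∧ L (φ b' x) < L x

variable {φ g L x₀}

/-- An argument in the style of Newman's lemma. Let c(x) be the group element of a decreasing path
from x to x₀. By induction on the height, `hconf` makes it independent of the path. It then
satisfies c(g_i x) g_i = c(x) along every edge, hence c(b x₀) b = 1 for every b. If b fixes x₀, then
c(b x₀) = 1 and so b = 1. -/
theorem eq_one_of_height {S : Set X} (ν : ι → ι) (hν : ∀ i, g (ν i) = (g i)⁻¹)
    (hind : ∀ p : B → Prop, p 1 → (∀ i b, p b → p (g i * b)) → ∀ b, p b)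
    (hS : ∀ b, ∀ x ∈ S, φ b x ∈ S) (hx₀ : x₀ ∈ S) (hmin : ∀ x ∈ S, L x₀ ≤ L x)
    (hne : ∀ x ∈ S, ∀ i, L (φ (g i) x) ≠ L x)
    (hdesc : ∀ x ∈ S, x ≠ x₀ → ∃ i, L (φ (g i) x) < L x)
    (hconf : ∀ x ∈ S, ∀ i j, L (φ (g i) x) < L x → L (φ (g j) x) < L x →
      Relation.ReflTransGen (LowAdj φ g L x) (g i) (g j))
    (b : B) (hb : φ b x₀ = x₀) : b = 1 := by
  -- Adjacent heights differ, so the edge is a descending step in one of its two directions; the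
  -- upper end can begin its descent with it.
  have edge : ∀ y ∈ S, ∀ i b b', (∃! c, IsDescent φ g L x₀ y c) →
      (∃! c, IsDescent φ g L x₀ (φ (g i) y) c) → IsDescent φ g L x₀ y b →
      IsDescent φ g L x₀ (φ (g i) y) b' → b' * g i = b := by
    intro y hy i b b' h1 h2 hb hb'
    rcases lt_or_gt_of_ne (hne y hy i) with h | h
    · exact h1.unique (.step y i b' h hb') hb
    · have hyy : φ (g (ν i)) (φ (g i) y) = y := by simp [hν]
      have := h2.unique hb' (.step (φ (g i) y) (ν i) b (by rwa [hyy]) (by rwa [hyy]))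
      rw [this, hν, inv_mul_cancel_right]
  have uniq : ∀ N, ∀ x ∈ S, L x = N → ∃! c, IsDescent φ g L x₀ x c := by
    intro N
    induction N using Nat.strong_induction_on with
    | _ N ih =>
      intro x hx hN
      subst hN
      -- All vertices of the path are lower than `x`, so their descent elements are unique by
      -- induction and `edge` can be composed along it.
      have path : ∀ b b', Relation.ReflTransGen (LowAdj φ g L x) b b' → L (φ b x) < L x →
          ∀ c c', IsDescent φ g L x₀ (φ b x) c → IsDescent φ g L x₀ (φ b' x) c' →
          c' * b' = c * b := by
        intro b b' h hlt c c' hc hc'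
        induction h generalizing c' with
        | refl => rw [(ih _ hlt _ (hS b x hx) rfl).unique hc hc']
        | @tail d e _ hde ih' =>
          obtain ⟨i, rfl, h1, h2⟩ := hde
          obtain ⟨a, ha, -⟩ := ih _ h1 _ (hS d x hx) rfl
          have h3 := ih' a ha
          have hmul : φ (g i * d) x = φ (g i) (φ d x) := by simp
          have h4 := edge _ (hS d x hx) i a c' (ih _ h1 _ (hS d x hx) rfl)
            (by rw [← hmul]; exact ih _ h2 _ (hS _ x hx) rfl) ha (by rwa [← hmul])
          rw [← h3, ← h4]
          group
      have huniq : ∀ b b', IsDescent φ g L x₀ x b → IsDescent φ g L x₀ x b' → b = b' := by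
        intro b b' h h'
        cases h with
        | base =>
          cases h' with
          | base => rfl
          | step _ i c hlt _ => exact absurd (hmin _ (hS (g i) _ hx)) (not_le.2 hlt)
        | step _ i c hlt hc =>
          cases h' with
          | base => exact absurd (hmin _ (hS (g i) _ hx)) (not_le.2 hlt)
          | step _ j d hlt' hd =>
            exact (path _ _ (hconf x hx i j hlt hlt') hlt c d hc hd).symm
      by_cases h0 : x = x₀
      · subst h0
        exact ⟨1, .base, fun b hb => huniq _ _ hb .base⟩
      · obtain ⟨i, hi⟩ := hdesc x hx h0
        obtain ⟨c, hc, -⟩ := ih _ hi _ (hS _ x hx) rfl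
        exact ⟨c * g i, .step x i c hi hc, fun b hb => huniq _ _ hb (.step x i c hi hc)⟩
  have key : ∀ b, ∀ c', IsDescent φ g L x₀ (φ b x₀) c' → c' * b = 1 := by
    intro b
    refine hind (fun b => ∀ c', IsDescent φ g L x₀ (φ b x₀) c' → c' * b = 1) ?_ ?_ b
    · intro c hc
      rw [map_one, Equiv.Perm.one_apply] at hc
      rw [mul_one]
      exact (uniq _ _ hx₀ rfl).unique hc .base
    · intro i d ih c hc
      obtain ⟨a, ha, -⟩ := uniq _ _ (hS d _ hx₀) rfl
      rw [map_mul, Equiv.Perm.mul_apply] at hc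
      have h4 := edge _ (hS d _ hx₀) i a c (uniq _ _ (hS d _ hx₀) rfl)
        (uniq _ _ (hS _ _ (hS d _ hx₀)) rfl) ha hc
      rw [← mul_assoc, h4, ih a ha]
  have := key b 1 (by rw [hb]; exact .base)
  rwa [one_mul] at this

theorem LowAdj.symm (ν : ι → ι) (hν : ∀ i, g (ν i) = (g i)⁻¹) {x : X} {b b' : B}
    (h : LowAdj φ g L x b b') : LowAdj φ g L x b' b := by
  obtain ⟨i, rfl, h1, h2⟩ := h
  exact ⟨ν i, by rw [hν, inv_mul_cancel_left], h2, h1⟩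

end Descent

/-! ### Freeness of the Hurwitz action on the decompositions of the Coxeter element -/

section Local

variable {n : ℕ} {G : Type*} [Group G]

/-- The tuple `t` with the entries at `i`, `i + 1`, `i + 2` replaced. -/
def replaceThree (t : Fin n → G) (i : ℕ) (a b c : G) (k : Fin n) : G :=
  if (k : ℕ) = i then a else if (k : ℕ) = i + 1 then b else if (k : ℕ) = i + 2 then c else t k

omit [Group G] in
theorem replaceThree_self (t : Fin n → G) (i : ℕ) (hi : i + 2 < n) :
    replaceThree t i (t ⟨i, by omega⟩) (t ⟨i + 1, by omega⟩) (t ⟨i + 2, hi⟩) = t := by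
  funext k
  rw [replaceThree]
  split_ifs with h1 h2 h3
  · exact congrArg t (Fin.ext h1.symm)
  · exact congrArg t (Fin.ext h2.symm)
  · exact congrArg t (Fin.ext h3.symm)
  · rfl

theorem hurwitzStep_replaceThree (t : Fin n → G) (i : ℕ) (hi : i + 2 < n) (ε : Bool) (a b c : G) :
    hurwitzStep n G ⟨i, by omega⟩ ε (replaceThree t i a b c) =
      replaceThree t i (stepFst ε a b) (stepSnd ε a b) c := by
  funext k
  rw [hurwitzStep_apply]
  simp only [replaceThree, if_pos, Nat.succ_ne_self, if_false]
  split_ifs <;> rfl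

theorem hurwitzStep_succ_replaceThree (t : Fin n → G) (i : ℕ) (hi : i + 2 < n) (ε : Bool)
    (a b c : G) :
    hurwitzStep n G ⟨i + 1, by omega⟩ ε (replaceThree t i a b c) =
      replaceThree t i a (stepFst ε b c) (stepSnd ε b c) := by
  funext k
  rw [hurwitzStep_apply]
  simp only [replaceThree]
  split_ifs <;> first | rfl | omega

omit [Group G] in
theorem sum_replaceThree (N : G → ℕ) (t : Fin n → G) (i : ℕ) (hi : i + 2 < n) (a b c : G) :
    ∑ k, N (replaceThree t i a b c k) +
        (N (t ⟨i, by omega⟩) + N (t ⟨i + 1, by omega⟩) + N (t ⟨i + 2, hi⟩)) =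
      ∑ k, N (t k) + (N a + N b + N c) := by
  have h := sum_add_sum_of_eqOn_compl
    {(⟨i, by omega⟩ : Fin n), ⟨i + 1, by omega⟩, ⟨i + 2, hi⟩}
    (fun k => N (replaceThree t i a b c k)) (fun k => N (t k)) (by
      intro k hk
      simp only [Finset.mem_insert, Finset.mem_singleton, not_or, Fin.ext_iff] at hk
      simp [replaceThree, hk.1, hk.2.1, hk.2.2])
  rw [Finset.sum_insert (by simp), Finset.sum_pair (by simp), Finset.sum_insert (by simp),
    Finset.sum_pair (by simp)] at h
  have e0 : replaceThree t i a b c ⟨i, by omega⟩ = a := by simp [replaceThree]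
  have e1 : replaceThree t i a b c ⟨i + 1, by omega⟩ = b := by simp [replaceThree]
  have e2 : replaceThree t i a b c ⟨i + 2, hi⟩ = c := by simp [replaceThree]
  rw [e0, e1, e2] at h
  omega

theorem braidGen_braid (i : ℕ) (hi : i + 2 < n) :
    braidGen n ⟨i, by omega⟩ true * braidGen n ⟨i + 1, by omega⟩ true *
        braidGen n ⟨i, by omega⟩ true =
      braidGen n ⟨i + 1, by omega⟩ true * braidGen n ⟨i, by omega⟩ true *
        braidGen n ⟨i + 1, by omega⟩ true := by
  have h := PresentedGroup.one_of_mem (rels := braidRels n) (x := _)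
    ⟨⟨i, by omega⟩, ⟨i + 1, by omega⟩, Or.inl ⟨rfl, rfl⟩⟩
  rw [map_mul, map_inv, mul_inv_eq_one] at h
  simp only [map_mul] at h
  exact h

theorem braidGen_comm (i j : Fin (n - 1)) (h : (i : ℕ) + 1 < j ∨ (j : ℕ) + 1 < i) (ε δ : Bool) :
    braidGen n i ε * braidGen n j δ = braidGen n j δ * braidGen n i ε := by
  have h := PresentedGroup.one_of_mem (rels := braidRels n) (x := _) ⟨i, j, Or.inr ⟨h, rfl⟩⟩
  rw [map_mul, map_inv, mul_inv_eq_one] at h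
  have h' : Commute (PresentedGroup.of i : BraidGroup n) (PresentedGroup.of j) := h
  cases ε <;> cases δ <;> simp only [braidGen, if_true, if_false, Bool.false_eq_true]
  · exact h'.inv_inv
  · exact h'.inv_left
  · exact h'.inv_right
  · exact h'

end Local

section Confluence

variable {n : ℕ}

local notation "D" => coxeterWordGroup n
local notation "T" => conjSet (coxeterGen n)
local notation "W" => UniversalCoxeterGroup n

/-- The total length of a tuple. -/
def totalNorm (t : Fin n → W) : ℕ := ∑ k, (D).norm (t k)

/-- The order relation between adjacent entries that makes a Hurwitz move decrease the length. -/
def StepBelow (ε : Bool) (a b : W) : Prop := if ε then Below a b else Below b a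

/-- A move conjugates one entry by its neighbour. This shortens it if the neighbour is below it and
lengthens it otherwise; adjacent entries are distinct by their colours. -/
theorem totalNorm_hurwitzStep_lt_iff {t : Fin n → W} (ht : t ∈ decompositions (coxeterGen n))
    (i : Fin (n - 1)) (ε : Bool) :
    (totalNorm (hurwitzStep n W i ε t) < totalNorm t ↔
      StepBelow ε (t ⟨i, by omega⟩) (t ⟨i + 1, by omega⟩)) ∧
    totalNorm (hurwitzStep n W i ε t) ≠ totalNorm t := by
  have h := sum_hurwitzStep (D).norm i ε t
  change totalNorm (hurwitzStep n W i ε t) + _ = totalNorm t + _ at h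
  have ha : t ⟨i, by omega⟩ ∈ T := ht.1 _
  have hb : t ⟨i + 1, by omega⟩ ∈ T := ht.1 _
  have hne : t ⟨i, by omega⟩ ≠ t ⟨i + 1, by omega⟩ := fun h => by
    have := (isDualTo_coxeterParity n).injective ht h
    simp at this
  set a := t ⟨i, by omega⟩
  set b := t ⟨i + 1, by omega⟩
  cases ε
  · simp only [stepFst_false, stepSnd_false, inv_of_mem_conjSet hb, mul_assoc] at h
    simp only [StepBelow, Bool.false_eq_true, if_false]
    by_cases hab : Below b a
    · have := hab.norm_conj_lt hb ha
      simp only [hab, iff_true]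
      omega
    · have := norm_lt_norm_conj hb ha hne.symm hab
      simp only [hab, iff_false]
      omega
  · simp only [stepFst_true, stepSnd_true, inv_of_mem_conjSet ha, mul_assoc] at h
    simp only [StepBelow, if_true]
    by_cases hab : Below a b
    · have := hab.norm_conj_lt ha hb
      simp only [hab, iff_true]
      omega
    · have := norm_lt_norm_conj ha hb hne hab
      simp only [hab, iff_false]
      omega

/-- Adjacency between low vertices in the graph of the Hurwitz action. -/
abbrev HurwitzLowAdj (t : Fin n → W) : BraidGroup n → BraidGroup n → Prop :=
  LowAdj (hurwitz n W) (fun i : Fin (n - 1) × Bool => braidGen n i.1 i.2) totalNorm t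

theorem hurwitzLowAdj_path {t : Fin n → W} {b₀ b₁ b₂ b₃ b₄ : BraidGroup n}
    (i₁ i₂ i₃ i₄ : Fin (n - 1) × Bool) (e₁ : b₁ = braidGen n i₁.1 i₁.2 * b₀)
    (e₂ : b₂ = braidGen n i₂.1 i₂.2 * b₁) (e₃ : b₃ = braidGen n i₃.1 i₃.2 * b₂)
    (e₄ : b₄ = braidGen n i₄.1 i₄.2 * b₃)
    (h₀ : totalNorm (hurwitz n W b₀ t) < totalNorm t)
    (h₁ : totalNorm (hurwitz n W b₁ t) < totalNorm t)
    (h₂ : totalNorm (hurwitz n W b₂ t) < totalNorm t)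
    (h₃ : totalNorm (hurwitz n W b₃ t) < totalNorm t)
    (h₄ : totalNorm (hurwitz n W b₄ t) < totalNorm t) :
    Relation.ReflTransGen (HurwitzLowAdj t) b₀ b₄ :=
  .tail (.tail (.tail (.tail .refl ⟨i₁, e₁, h₀, h₁⟩) ⟨i₂, e₂, h₁, h₂⟩) ⟨i₃, e₃, h₂, h₃⟩)
    ⟨i₄, e₄, h₃, h₄⟩

end Confluence

/-! ### Local confluence of the shortening moves -/

section Confluence

variable {n : ℕ}

local notation "D" => coxeterWordGroup n
local notation "T" => conjSet (coxeterGen n)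
local notation "W" => UniversalCoxeterGroup n

set_option linter.unusedSimpArgs false in
-- The braid relation is a hexagon with `t` and its two shortened neighbours as three consecutive
-- vertices; the path runs around the other side. The prefix relations between the three entries
-- `a`, `b`, `c` show that the remaining vertices are lower than `t` as well.
theorem confluence_adjacent {t : Fin n → W} (ht : t ∈ decompositions (coxeterGen n)) (i : ℕ)
    (hi : i + 2 < n) (ε δ : Bool)
    (h : totalNorm (hurwitz n W (braidGen n ⟨i, by omega⟩ ε) t) < totalNorm t)
    (h' : totalNorm (hurwitz n W (braidGen n ⟨i + 1, by omega⟩ δ) t) < totalNorm t) :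
    Relation.ReflTransGen (HurwitzLowAdj t) (braidGen n ⟨i, by omega⟩ ε)
      (braidGen n ⟨i + 1, by omega⟩ δ) := by
  have hA := h
  have hB := h'
  rw [hurwitz_braidGen, (totalNorm_hurwitzStep_lt_iff ht _ _).1] at h h'
  have hneac : t ⟨i, by omega⟩ ≠ t ⟨i + 2, hi⟩ := fun h => by
    have := (isDualTo_coxeterParity n).injective ht h
    simp at this
  have hvalley := not_below_both ht i hi
  have hsum := sum_replaceThree (D).norm t i hi
  have ht3 := replaceThree_self t i hi
  have haT : t ⟨i, by omega⟩ ∈ T := ht.1 _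
  have hbT : t ⟨i + 1, by omega⟩ ∈ T := ht.1 _
  have hcT : t ⟨i + 2, hi⟩ ∈ T := ht.1 _
  simp only at h h'
  change StepBelow δ (t ⟨i + 1, by omega⟩) (t ⟨i + 2, hi⟩) at h'
  generalize ha : t ⟨i, by omega⟩ = a at *
  generalize hb : t ⟨i + 1, by omega⟩ = b at *
  generalize hc : t ⟨i + 2, hi⟩ = c at *
  have ha1 := inv_of_mem_conjSet haT
  have hb1 := inv_of_mem_conjSet hbT
  have hc1 := inv_of_mem_conjSet hcT
  have ha2 : ∀ x, a * (a * x) = x := fun x => by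
    rw [← mul_assoc, mul_self_of_mem_conjSet haT, one_mul]
  have hb2 : ∀ x, b * (b * x) = x := fun x => by
    rw [← mul_assoc, mul_self_of_mem_conjSet hbT, one_mul]
  have hc2 : ∀ x, c * (c * x) = x := fun x => by
    rw [← mul_assoc, mul_self_of_mem_conjSet hcT, one_mul]
  have hbraid := braidGen_braid i hi
  -- Only three entries change along the hexagon, so the sum of their three lengths decides.
  have low : ∀ x y z : W, (D).norm x + (D).norm y + (D).norm z <
      (D).norm a + (D).norm b + (D).norm c →
      totalNorm (replaceThree t i x y z) < totalNorm t := by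
    intro x y z hxyz
    have := hsum x y z
    change totalNorm (replaceThree t i x y z) + _ = totalNorm t + _ at this
    omega
  have calcA : ∀ (β : BraidGroup n) (η : Bool) (x y z : W), hurwitz n W β t = replaceThree t i x y z →
      hurwitz n W (braidGen n ⟨i, by omega⟩ η * β) t =
        replaceThree t i (stepFst η x y) (stepSnd η x y) z := fun β η x y z hβ => by
    rw [map_mul, Equiv.Perm.mul_apply, hβ, hurwitz_braidGen, hurwitzStep_replaceThree _ _ hi]
  have calcB : ∀ (β : BraidGroup n) (η : Bool) (x y z : W), hurwitz n W β t = replaceThree t i x y z →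
      hurwitz n W (braidGen n ⟨i + 1, by omega⟩ η * β) t =
        replaceThree t i x (stepFst η y z) (stepSnd η y z) := fun β η x y z hβ => by
    rw [map_mul, Equiv.Perm.mul_apply, hβ, hurwitz_braidGen, hurwitzStep_succ_replaceThree _ _ hi]
  have calc1 : hurwitz n W 1 t = replaceThree t i a b c := by rw [ht3]; simp
  have hAf : braidGen n ⟨i, by omega⟩ false = (braidGen n ⟨i, by omega⟩ true)⁻¹ :=
    braidGen_not _ true
  have hBf : braidGen n ⟨i + 1, by omega⟩ false = (braidGen n ⟨i + 1, by omega⟩ true)⁻¹ :=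
    braidGen_not _ true
  cases ε <;> cases δ
  · change Below b a at h
    change Below c b at h'
    have f1 := h'.norm_conj_lt hcT hbT
    have f2 := (h'.trans h).norm_conj_lt hcT haT
    have f3 := h'.norm_conj_conj_lt h hcT hbT haT
    have r1 := calcB _ false _ _ _ (calcA _ false _ _ _ calc1)
    have r2 := calcA _ false _ _ _ r1
    have r3 := calcA _ false _ _ _ (calcB _ false _ _ _ calc1)
    simp only [stepFst_false, stepSnd_false, mul_inv_rev, ha1, hb1, hc1, mul_assoc, ha2, hb2, hc2,
      mul_one] at r1 r2 r3
    refine hurwitzLowAdj_path (⟨i + 1, by omega⟩, false) (⟨i, by omega⟩, false)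
      (⟨i + 1, by omega⟩, true) (⟨i, by omega⟩, true)
      rfl rfl (b₃ := braidGen n ⟨i, by omega⟩ false * braidGen n ⟨i + 1, by omega⟩ false)
      ?_ ?_ hA ?_ ?_ ?_ hB
    · simp only [hAf, hBf, ← mul_inv_rev]
      rw [hbraid]
      group
    · simp only [hAf, hBf]
      group
    · rw [r1]; apply low; omega
    · rw [r2]; apply low; omega
    · rw [r3]; apply low; omega
  -- The valley: `b` is below both `a` and `c`, and planarity excludes it.
  · exact (hvalley h h').elim
  · change Below a b at h
    change Below c b at h'
    -- Both `a` and `c` are below `b`, hence comparable; the lower one decides the sign of the next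
    -- move on the path.
    rcases h.total haT hcT hneac h' with hac | hca
    · have f1 := h.norm_conj_lt haT hbT
      have f2 := hac.norm_conj_lt haT hcT
      have f3 := h'.norm_conj_lt hcT hbT
      have f4 := hac.norm_conj_conj_lt h' haT hcT hbT
      have r1 := calcB _ true _ _ _ (calcA _ true _ _ _ calc1)
      have r3 := calcA _ true _ _ _ (calcB _ false _ _ _ calc1)
      have r2 := calcB _ true _ _ _ r3
      simp only [stepFst_false, stepSnd_false, stepFst_true, stepSnd_true, mul_inv_rev, ha1, hb1,
        hc1, mul_assoc, ha2, hb2, hc2, mul_one] at r1 r2 r3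
      refine hurwitzLowAdj_path (⟨i + 1, by omega⟩, true) (⟨i, by omega⟩, false)
        (⟨i + 1, by omega⟩, false) (⟨i, by omega⟩, false)
        rfl (b₂ := braidGen n ⟨i + 1, by omega⟩ true * (braidGen n ⟨i, by omega⟩ true *
          braidGen n ⟨i + 1, by omega⟩ false)) ?_
        (b₃ := braidGen n ⟨i, by omega⟩ true * braidGen n ⟨i + 1, by omega⟩ false)
        ?_ ?_ hA ?_ ?_ ?_ hB
      · simp only [hAf, hBf]
        rw [eq_inv_mul_iff_mul_eq, ← mul_assoc, ← mul_assoc, hbraid]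
        group
      · simp only [hAf, hBf]
        group
      · simp only [hAf, hBf]
        group
      · rw [r1]; apply low; omega
      · rw [r2]; apply low; omega
      · rw [r3]; apply low; omega
    · have f1 := h.norm_conj_lt haT hbT
      have f2 := hca.norm_conj_lt hcT haT
      have f3 := h'.norm_conj_lt hcT hbT
      have f4 := hca.norm_conj_conj_lt h hcT haT hbT
      have r1 := calcB _ false _ _ _ (calcA _ true _ _ _ calc1)
      have r2 := calcA _ false _ _ _ r1
      have r3 := calcA _ false _ _ _ (calcB _ false _ _ _ calc1)
      simp only [stepFst_false, stepSnd_false, stepFst_true, stepSnd_true, mul_inv_rev, ha1, hb1,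
        hc1, mul_assoc, ha2, hb2, hc2, mul_one] at r1 r2 r3
      refine hurwitzLowAdj_path (⟨i + 1, by omega⟩, false) (⟨i, by omega⟩, false)
        (⟨i + 1, by omega⟩, false) (⟨i, by omega⟩, true)
        rfl rfl
        (b₃ := braidGen n ⟨i, by omega⟩ false * braidGen n ⟨i + 1, by omega⟩ false)
        ?_ ?_ hA ?_ ?_ ?_ hB
      · simp only [hAf, hBf]
        rw [eq_inv_mul_iff_mul_eq, eq_inv_mul_iff_mul_eq, eq_inv_mul_iff_mul_eq]
        generalize braidGen n ⟨i, by omega⟩ true = x at *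
        generalize braidGen n ⟨i + 1, by omega⟩ true = y at *
        have : y * (x * (y * (x⁻¹ * y⁻¹))) = (y * x * y) * x⁻¹ * y⁻¹ := by group
        rw [this, ← hbraid]
        group
      · simp only [hAf, hBf]
        group
      · rw [r1]; apply low; omega
      · rw [r2]; apply low; omega
      · rw [r3]; apply low; omega
  · change Below a b at h
    change Below b c at h'
    have f1 := h.norm_conj_lt haT hbT
    have f2 := (h.trans h').norm_conj_lt haT hcT
    have f3 := h.norm_conj_conj_lt h' haT hbT hcT
    have r1 := calcB _ true _ _ _ (calcA _ true _ _ _ calc1)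
    have r2 := calcA _ true _ _ _ r1
    have r3 := calcA _ true _ _ _ (calcB _ true _ _ _ calc1)
    simp only [stepFst_true, stepSnd_true, mul_inv_rev, ha1, hb1, hc1, mul_assoc, ha2, hb2, hc2,
      mul_one] at r1 r2 r3
    refine hurwitzLowAdj_path (⟨i + 1, by omega⟩, true) (⟨i, by omega⟩, true)
      (⟨i + 1, by omega⟩, false) (⟨i, by omega⟩, false)
      rfl rfl (b₃ := braidGen n ⟨i, by omega⟩ true * braidGen n ⟨i + 1, by omega⟩ true)
      ?_ ?_ hA ?_ ?_ ?_ hB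
    · simp only [hAf, hBf]
      rw [eq_inv_mul_iff_mul_eq, ← mul_assoc, ← mul_assoc, hbraid]
    · simp only [hAf, hBf]
      group
    · rw [r1]; apply low; omega
    · rw [r2]; apply low; omega
    · rw [r3]; apply low; omega

theorem hurwitz_mem_decompositions {G : Type*} [Group G] {s : Fin n → G} (b : BraidGroup n)
    {t : Fin n → G} (ht : t ∈ decompositions s) : hurwitz n G b t ∈ decompositions s :=
  hurwitz_mem (hurwitzStep_mem_decompositions s) b t ht

theorem confluence_of_lt {t : Fin n → W} (ht : t ∈ decompositions (coxeterGen n))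
    (i j : Fin (n - 1)) (hij : (i : ℕ) < j) (ε δ : Bool)
    (h : totalNorm (hurwitz n W (braidGen n i ε) t) < totalNorm t)
    (h' : totalNorm (hurwitz n W (braidGen n j δ) t) < totalNorm t) :
    Relation.ReflTransGen (HurwitzLowAdj t) (braidGen n i ε) (braidGen n j δ) := by
  obtain ⟨i, hi⟩ := i
  obtain ⟨j, hj⟩ := j
  change i < j at hij
  rcases Nat.eq_or_lt_of_le (Nat.succ_le_of_lt hij) with rfl | hij'
  · exact confluence_adjacent ht i (by omega) ε δ h h'
  -- Distant moves commute and do not affect each other's entries, so the second still shortens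
  -- after the first: the fourth corner of the square is low.
  · have hcomm := braidGen_comm ⟨j, hj⟩ ⟨i, hi⟩ (Or.inr hij') δ ε
    have hlow : totalNorm (hurwitz n W (braidGen n ⟨j, hj⟩ δ * braidGen n ⟨i, hi⟩ ε) t) <
        totalNorm (hurwitz n W (braidGen n ⟨i, hi⟩ ε) t) := by
      have ht' := hurwitz_mem_decompositions (braidGen n ⟨i, hi⟩ ε) ht
      rw [map_mul, Equiv.Perm.mul_apply, hurwitz_braidGen (G := W) ⟨j, hj⟩,
        (totalNorm_hurwitzStep_lt_iff ht' _ _).1]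
      rw [hurwitz_braidGen, (totalNorm_hurwitzStep_lt_iff ht _ _).1] at h'
      rw [hurwitz_braidGen, hurwitzStep_of_ne _ _ _ _ (by simp; omega) (by simp; omega),
        hurwitzStep_of_ne _ _ _ _ (by simp; omega) (by simp; omega)]
      exact h'
    refine .tail (.tail .refl ⟨(⟨j, hj⟩, δ), rfl, h, hlow.trans h⟩)
      ⟨(⟨i, hi⟩, !ε), ?_, hlow.trans h, h'⟩
    change _ = braidGen n ⟨i, hi⟩ (!ε) * _
    rw [hcomm, braidGen_not, inv_mul_cancel_left]

theorem confluence {t : Fin n → W} (ht : t ∈ decompositions (coxeterGen n))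
    (i j : Fin (n - 1) × Bool)
    (h : totalNorm (hurwitz n W (braidGen n i.1 i.2) t) < totalNorm t)
    (h' : totalNorm (hurwitz n W (braidGen n j.1 j.2) t) < totalNorm t) :
    Relation.ReflTransGen (HurwitzLowAdj t) (braidGen n i.1 i.2) (braidGen n j.1 j.2) := by
  obtain ⟨i, ε⟩ := i
  obtain ⟨j, δ⟩ := j
  rcases lt_trichotomy (i : ℕ) j with hij | hij | hij
  · exact confluence_of_lt ht i j hij ε δ h h'
  · obtain rfl := Fin.ext hij
    -- At equal positions, the move and its inverse would require each of two reflections to be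
    -- below the other.
    have hopp : ∀ a b, a ∈ T → b ∈ T → Below a b → Below b a → False := fun a b ha hb hab hba =>
      lt_asymm (hab.norm_lt ha hb) (hba.norm_lt hb ha)
    rw [hurwitz_braidGen, (totalNorm_hurwitzStep_lt_iff ht _ _).1] at h h'
    cases ε <;> cases δ
    · exact .refl
    · exact (hopp _ _ (ht.1 _) (ht.1 _) h h').elim
    · exact (hopp _ _ (ht.1 _) (ht.1 _) h h').elim
    · exact .refl
  · exact Relation.ReflTransGen.mono (fun b b' hb =>
      LowAdj.symm (fun i => (i.1, !i.2)) (fun i => braidGen_not i.1 i.2) hb)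
      _ _ (confluence_of_lt ht j i hij δ ε h' h).swap

theorem totalNorm_coxeterGen_le {t : Fin n → W} (ht : t ∈ decompositions (coxeterGen n)) :
    totalNorm (coxeterGen n) ≤ totalNorm t := by
  refine Finset.sum_le_sum fun k _ => ?_
  have h1 := (D).norm_val_le [k]
  obtain ⟨u, a, hu, h, -⟩ := exists_rootWord (ht.1 k)
  rw [h, hu.norm_conj]
  simp only [WordGroup.val_cons, WordGroup.val_nil, mul_one, List.length_singleton] at h1
  change (D).norm ((D).gen k) ≤ _
  omega

theorem eq_one_of_hurwitz_coxeterGen (b : BraidGroup n)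
    (hb : hurwitz n W b (coxeterGen n) = coxeterGen n) : b = 1 := by
  have hbase : coxeterGen n ∈ decompositions (coxeterGen n) := ⟨self_mem_conjSet _, rfl⟩
  refine eq_one_of_height (g := fun i : Fin (n - 1) × Bool => braidGen n i.1 i.2)
    (L := totalNorm) (fun i => (i.1, !i.2)) (fun i => braidGen_not i.1 i.2)
    (fun p h1 hmul b => braidGen_induction h1 (fun i ε b hb => hmul (i, ε) b hb) b)
    (fun b x hx => hurwitz_mem_decompositions b hx) hbase
    (fun x hx => totalNorm_coxeterGen_le hx) ?_ ?_
    (fun x hx i j h h' => confluence hx i j h h') b hb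
  · intro x hx i
    rw [hurwitz_braidGen]
    exact (totalNorm_hurwitzStep_lt_iff hx _ _).2
  · intro x hx hne
    obtain ⟨i, ε, h⟩ := (D).exists_descent id (reduced_ofFn_id n) (fun _ _ h => h.symm)
      (isDualTo_coxeterParity n) hx hne
    exact ⟨(i, ε), by rw [hurwitz_braidGen]; exact h⟩

end Confluence

/-! ### The two Hurwitz actions compared -/

theorem decompositions_self {G : Type*} [Group G] {n : ℕ} (s : Fin n → G) :
    s ∈ decompositions s := ⟨self_mem_conjSet s, rfl⟩

theorem perm_map_inv_apply {B X : Type*} [Group B] (φ : B →* Equiv.Perm X) (b : B) (x : X) :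
    φ b⁻¹ (φ b x) = x := by
  rw [← Equiv.Perm.mul_apply, ← map_mul, inv_mul_cancel, map_one, Equiv.Perm.one_apply]

theorem isSimplyTransitiveOn_of_base {B X : Type*} [Group B] (φ : B →* Equiv.Perm X) (S : Set X)
    (x₀ : X) (hx₀ : x₀ ∈ S) (hS : ∀ b, ∀ x ∈ S, φ b x ∈ S) (htrans : ∀ x ∈ S, ∃ b, φ b x = x₀)
    (hfree : ∀ b, φ b x₀ = x₀ → b = 1) : IsSimplyTransitiveOn φ S := by
  refine ⟨⟨x₀, hx₀⟩, hS, fun x hx x' hx' => ?_⟩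
  obtain ⟨b, hb⟩ := htrans x hx
  obtain ⟨b', hb'⟩ := htrans x' hx'
  have hinv : φ b'⁻¹ x₀ = x' := by rw [← hb', perm_map_inv_apply]
  have hinv' : φ b⁻¹ x₀ = x := by rw [← hb, perm_map_inv_apply]
  refine ⟨b'⁻¹ * b, by beta_reduce; rw [map_mul, Equiv.Perm.mul_apply, hb, hinv], fun d hd => ?_⟩
  have h1 := hfree (b' * d * b⁻¹) (by
    rw [map_mul, map_mul, Equiv.Perm.mul_apply, Equiv.Perm.mul_apply, hinv', hd, hb'])
  rw [mul_inv_eq_one] at h1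
  rw [← h1, inv_mul_cancel_left]

theorem coxeter_isSimplyTransitiveOn (n : ℕ) :
    IsSimplyTransitiveOn (hurwitz n (UniversalCoxeterGroup n)) (decompositions (coxeterGen n)) :=
  isSimplyTransitiveOn_of_base _ _ _ (decompositions_self _)
    (fun b _ ht => hurwitz_mem_decompositions b ht) coxeter_exists_hurwitz_eq
    eq_one_of_hurwitz_coxeterGen

theorem map_mem_decompositions {G H : Type*} [Group G] [Group H] {n : ℕ} {s t : Fin n → G}
    (φ : G →* H) (ht : t ∈ decompositions s) :
    (fun i => φ (t i)) ∈ decompositions fun i => φ (s i) := by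
  refine ⟨fun i => ?_, ?_⟩
  · obtain ⟨j, w, h⟩ := ht.1 i
    exact ⟨j, φ w, by simp only [h, map_mul, map_inv]⟩
  · have := congrArg φ ht.2
    rw [map_list_prod, map_list_prod, List.map_ofFn, List.map_ofFn] at this
    exact this

/-! ### The theorem for a group free on `f`, with the conjugates of `f` as reflections -/

theorem main_of_mulEquiv (n : ℕ) {F : Type*} [Group F] (f : Fin n → F) (R : Set F)
    (hR : R = conjSet f) (e : F ≃* FreeGroup (Fin n)) (he : ∀ j, e (f j) = FreeGroup.of j) :
    IsSimplyTransitiveOn (hurwitz n F) (Red R (List.ofFn f).prod n) ∧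
    ∃ π : F →* UniversalCoxeterGroup n,
      (∀ j, π (f j) = coxeterGen n j) ∧
      (∀ π' : F →* UniversalCoxeterGroup n, (∀ j, π' (f j) = coxeterGen n j) → π' = π) ∧
      Function.Surjective π ∧
      IsSimplyTransitiveOn (hurwitz n (UniversalCoxeterGroup n))
        (Red (π '' R) (π (List.ofFn f).prod) n) ∧
      (Set.BijOn (fun (t : Fin n → F) i => π (t i)) (Red R (List.ofFn f).prod n)
          (Red (π '' R) (π (List.ofFn f).prod) n) ∧
        ∀ (β : BraidGroup n), ∀ t ∈ Red R (List.ofFn f).prod n,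
          (fun i => π (hurwitz n F β t i)) =
            hurwitz n (UniversalCoxeterGroup n) β (fun i => π (t i))) := by
  subst hR
  have hsymm : ∀ j, e.symm (FreeGroup.of j) = f j := fun j => by rw [← he, e.symm_apply_apply]
  have hdual : IsDualTo (fun j => (freeParity n j).comp e.toMonoidHom) f := fun i j => by
    rw [← isDualTo_freeParity n i j, MonoidHom.comp_apply, ← he]
    rfl
  let π : F →* UniversalCoxeterGroup n := (FreeGroup.lift (coxeterGen n)).comp e.toMonoidHom
  have hπ : ∀ j, π (f j) = coxeterGen n j := fun j => by
    change FreeGroup.lift (coxeterGen n) (e (f j)) = _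
    rw [he, FreeGroup.lift_apply_of]
  have hsurj : Function.Surjective π := by
    rw [← MonoidHom.range_eq_top, ← top_le_iff, ← closure_range_coxeterGen, Subgroup.closure_le]
    rintro _ ⟨j, rfl⟩
    exact ⟨f j, hπ j⟩
  have himage : π '' conjSet f = conjSet (coxeterGen n) := by
    ext r
    constructor
    · rintro ⟨_, ⟨j, w, rfl⟩, rfl⟩
      exact ⟨j, π w, by rw [map_mul, map_mul, map_inv, hπ]⟩
    · rintro ⟨j, w, rfl⟩
      obtain ⟨v, rfl⟩ := hsurj w
      exact ⟨v * f j * v⁻¹, ⟨j, v, rfl⟩, by rw [map_mul, map_mul, map_inv, hπ]⟩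
  have hprod : π (List.ofFn f).prod = (List.ofFn (coxeterGen n)).prod := by
    rw [map_list_prod, List.map_ofFn]
    congr 2
    exact funext hπ
  have hπf : (fun i => π (f i)) = coxeterGen n := funext hπ
  rw [hdual.red_eq]
  have htrans : ∀ t ∈ decompositions f, ∃ b, hurwitz n F b t = f := by
    intro t ht
    have h1 := map_mem_decompositions e.toMonoidHom ht
    have h2 : (fun i => e.toMonoidHom (f i)) = FreeGroup.of := funext he
    rw [h2] at h1
    obtain ⟨b, hb⟩ := free_exists_hurwitz_eq _ h1
    refine ⟨b, ?_⟩
    rw [← map_hurwitz] at hb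
    funext i
    rw [← hsymm i, ← congrFun hb i]
    exact (e.symm_apply_apply _).symm
  have hmap : ∀ (b : BraidGroup n) (t : Fin n → F), (fun i => π (hurwitz n F b t i)) =
      hurwitz n (UniversalCoxeterGroup n) b fun i => π (t i) := fun b t => map_hurwitz π b t
  -- By equivariance, equality after `π` places b'⁻¹b in the stabilizer of the Coxeter generators,
  -- which is trivial. This yields both freeness upstairs and injectivity of `π` on the orbit.
  have hfree : ∀ b b', (fun i => π (hurwitz n F b f i)) = (fun i => π (hurwitz n F b' f i)) →
      b = b' := by
    intro b b' h
    rw [hmap, hmap, hπf] at h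
    have := eq_one_of_hurwitz_coxeterGen (b'⁻¹ * b) (by
      rw [map_mul, Equiv.Perm.mul_apply, h, perm_map_inv_apply])
    rw [inv_mul_eq_one] at this
    exact this.symm
  have horbit : ∀ t ∈ decompositions f, ∃ b, t = hurwitz n F b f := by
    intro t ht
    obtain ⟨b, hb⟩ := htrans t ht
    exact ⟨b⁻¹, by rw [← hb, perm_map_inv_apply]⟩
  refine ⟨isSimplyTransitiveOn_of_base _ _ f (decompositions_self f)
    (fun b _ ht => hurwitz_mem_decompositions b ht) htrans
    (fun b hb => hfree b 1 (by rw [hb]; simp)), π, hπ, ?_, hsurj, ?_, ?_, ?_⟩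
  · intro π' hπ'
    have : π'.comp e.symm.toMonoidHom = π.comp e.symm.toMonoidHom := by
      ext j
      change π' (e.symm (FreeGroup.of j)) = π (e.symm (FreeGroup.of j))
      rw [hsymm, hπ, hπ']
    ext x
    simpa using DFunLike.congr_fun this (e x)
  · rw [himage, hprod, (isDualTo_coxeterParity n).red_eq]
    exact coxeter_isSimplyTransitiveOn n
  · rw [himage, hprod, (isDualTo_coxeterParity n).red_eq]
    refine ⟨fun t ht => ?_, fun t ht t' ht' h => ?_, fun t ht => ?_⟩
    · rw [← hπf]
      exact map_mem_decompositions π ht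
    · obtain ⟨b, rfl⟩ := horbit t ht
      obtain ⟨b', rfl⟩ := horbit t' ht'
      rw [hfree b b' h]
    · obtain ⟨b, hb⟩ := coxeter_exists_hurwitz_eq t ht
      refine ⟨hurwitz n F b⁻¹ f, hurwitz_mem_decompositions _ (decompositions_self f), ?_⟩
      change (fun i => π (hurwitz n F b⁻¹ f i)) = t
      rw [hmap, hπf, ← hb, perm_map_inv_apply]
  · exact fun b t _ => hmap b t

open scoped unitInterval

/-! ### Fundamental groups of unions of two open sets: homomorphisms from locally constant cocycles -/

section TwoOpen

variable {X : Type*} [TopologicalSpace X] {G : Type*} [Group G] [TopologicalSpace G]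
  [DiscreteTopology G]

/-- The covering space of `U ∪ V` with group `G` glued along `U ∩ V` by the locally constant
function `c`. -/
noncomputable def cocycleBundle (U V : Set X) (hU : IsOpen U) (hV : IsOpen V) (hUV : ∀ x, x ∉ U → x ∈ V)
    (c : X → G) (hc : ContinuousOn c (U ∩ V)) : FiberBundleCore Bool X G := by
  classical exact
  { baseSet i := cond i U V
    isOpen_baseSet i := by cases i <;> assumption
    indexAt x := decide (x ∈ U)
    mem_baseSet_at x := by
      by_cases h : x ∈ U
      · simp [h]
      · simpa [h] using hUV x h
    -- Gluing by right multiplication leaves left multiplication globally defined on the total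
    -- space.
    coordChange i j x g := g * ((cond i 1 (c x))⁻¹ * cond j 1 (c x))
    coordChange_self i x _ g := by simp
    continuousOn_coordChange i j := by
      have hfst : ContinuousOn (fun p : X × G => c p.1) ((U ∩ V) ×ˢ Set.univ) :=
        hc.comp continuousOn_fst fun p hp => hp.1
      cases i <;> cases j
      · simpa using continuousOn_snd
      · have : ContinuousOn (fun p : X × G => p.2 * (c p.1)⁻¹) ((V ∩ U) ×ˢ Set.univ) :=
          continuousOn_snd.mul (Set.inter_comm U V ▸ hfst).inv
        simpa using this
      · have : ContinuousOn (fun p : X × G => p.2 * c p.1) ((U ∩ V) ×ˢ Set.univ) :=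
          continuousOn_snd.mul hfst
        simpa using this
      · simpa using continuousOn_snd
    coordChange_comp i j k x _ g := by group }

namespace FiberBundleCore

variable {ι G : Type*} [TopologicalSpace G] [DiscreteTopology G] (Z : FiberBundleCore ι X G)

theorem isCoveringMap_proj : IsCoveringMap Z.proj :=
  FiberBundle.isCoveringMap (F := G) (E := Z.Fiber)

/-- The endpoint of the lift of a path to the total space of a bundle with discrete fibres. -/
noncomputable def transport {x y : X} (γ : Path.Homotopic.Quotient x y) (g : G) : G :=
  (Z.isCoveringMap_proj.monodromy γ ⟨⟨x, g⟩, rfl⟩).1.2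

theorem monodromy_mk {x y : X} (γ : Path.Homotopic.Quotient x y) (g : G) :
    Z.isCoveringMap_proj.monodromy γ ⟨⟨x, g⟩, rfl⟩ = ⟨⟨y, Z.transport γ g⟩, rfl⟩ := by
  apply Subtype.ext
  have h := (Z.isCoveringMap_proj.monodromy γ ⟨⟨x, g⟩, rfl⟩).2
  unfold transport
  generalize (Z.isCoveringMap_proj.monodromy γ ⟨⟨x, g⟩, rfl⟩).1 = e at h ⊢
  obtain ⟨z, a⟩ := e
  obtain rfl : z = y := h
  rfl

theorem transport_refl (x : X) (g : G) : Z.transport (.refl x) g = g := by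
  rw [transport, IsCoveringMap.monodromy_refl]
  rfl

theorem transport_trans {x y z : X} (γ : Path.Homotopic.Quotient x y)
    (γ' : Path.Homotopic.Quotient y z) (g : G) :
    Z.transport (γ.trans γ') g = Z.transport γ' (Z.transport γ g) := by
  rw [transport, IsCoveringMap.monodromy_trans_apply, monodromy_mk]
  rfl

/-- Uniqueness of path lifting: any continuous lift computes the transport. -/
theorem transport_eq_of_lift {x y : X} (γ : Path x y) (Γ : I → Z.TotalSpace)
    (hΓ : Continuous Γ) (hlift : ∀ t, (Γ t).1 = γ t) :
    Z.transport (.mk γ) (Γ 0).2 = (Γ 1).2 := by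
  have h0 : (⟨x, (Γ 0).2⟩ : Z.TotalSpace) = Γ 0 := by
    have := hlift 0
    rw [γ.source] at this
    generalize Γ 0 = e at this ⊢
    obtain ⟨z, a⟩ := e
    obtain rfl : z = x := this
    rfl
  have h : Γ = Z.isCoveringMap_proj.liftPath γ ⟨x, (Γ 0).2⟩ γ.source :=
    (Z.isCoveringMap_proj.eq_liftPath_iff γ.source).2 ⟨hΓ, funext hlift, h0.symm⟩
  exact congrArg Bundle.TotalSpace.snd (congrFun h 1).symm

theorem transport_mk_of_mem {x y : X} (γ : Path x y) (i : ι) (hγ : ∀ t, γ t ∈ Z.baseSet i)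
    (v : G) : Z.transport (.mk γ) (Z.coordChange i (Z.indexAt x) x v) =
      Z.coordChange i (Z.indexAt y) y v := by
  have h := Z.transport_eq_of_lift γ
    (fun t => (Z.localTriv i).toOpenPartialHomeomorph.symm (γ t, v))
    ((Z.localTriv i).toOpenPartialHomeomorph.continuousOn_symm.comp_continuous
      (by fun_prop) fun t => (Z.mem_localTriv_target i _).2 (hγ t)) fun t => rfl
  simpa using h

end FiberBundleCore

variable {U V : Set X} {hU : IsOpen U} {hV : IsOpen V} {hUV : ∀ x, x ∉ U → x ∈ V}
  {c : X → G} {hc : ContinuousOn c (U ∩ V)}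

/-- Left multiplication commutes with the gluing, so it carries lifts of a path to lifts of the same
path. -/
theorem cocycleBundle_transport_mul {x y : X} (γ : Path.Homotopic.Quotient x y) (g h : G) :
    (cocycleBundle U V hU hV hUV c hc).transport γ (g * h) =
      g * (cocycleBundle U V hU hV hUV c hc).transport γ h := by
  set Z := cocycleBundle U V hU hV hUV c hc
  induction γ using Path.Homotopic.Quotient.ind with
  | mk γ =>
    set Γ := Z.isCoveringMap_proj.liftPath γ ⟨x, h⟩ γ.source with hΓ
    have hlift : ∀ t, (Γ t).1 = γ t := congrFun (Z.isCoveringMap_proj.liftPath_lifts γ _ _)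
    have h0 : Γ 0 = ⟨x, h⟩ := Z.isCoveringMap_proj.liftPath_zero γ _ _
    let s : Z.TotalSpace → G := fun e => e.2
    let L : Z.TotalSpace → Z.TotalSpace := fun e => ⟨e.1, g * s e⟩
    have hL : Continuous L := by
      refine continuous_iff_continuousAt.2 fun e => ?_
      let T := (Z.localTriv (Z.indexAt e.1)).toOpenPartialHomeomorph
      have he : e ∈ T.source := Z.mem_baseSet_at e.1
      have hLT : L = fun e' => T.symm ((T e').1, g * (T e').2) := by
        funext e'
        refine congrArg (Bundle.TotalSpace.mk e'.1) ?_
        have h1 : ∀ u p q : G, g * u = g * (u * (p⁻¹ * q)) * (q⁻¹ * p) := fun u p q => by group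
        exact h1 _ _ _
      rw [hLT]
      have hT := T.continuousAt he
      refine ContinuousAt.comp (f := fun e' => ((T e').1, g * (T e').2))
        (T.symm.continuousAt ?_) (hT.fst.prodMk (continuousAt_const.mul hT.snd))
      exact (Z.mem_localTriv_target _ _).2 (Z.mem_baseSet_at e.1)
    have h1 := Z.transport_eq_of_lift γ Γ Γ.continuous hlift
    have h2 := Z.transport_eq_of_lift γ (fun t => L (Γ t)) (hL.comp Γ.continuous) hlift
    have h0' : s (Γ 0) = h := by rw [h0]
    change Z.transport _ (g * s (Γ 0)) = g * s (Γ 1) at h2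
    rwa [show s (Γ 1) = _ from h1.symm, h0', show (Γ 0).2 = h from h0'] at h2

/-- The homomorphism is the monodromy of the glued covering applied to 1. Left equivariance makes it
multiplicative for concatenation. In the chart over `U` the lift is constant along `u` and `u'`,
while `v`, constant in the other chart, contributes the gluing at both its ends. -/
theorem exists_hom_of_cocycle {U V : Set X} (hU : IsOpen U) (hV : IsOpen V)
    (hUV : ∀ x, x ∉ U → x ∈ V) {c : X → G} (hc : ContinuousOn c (U ∩ V)) {b : X} (hb : b ∈ U) :
    ∃ Φ : (FundamentalGroup X b)ᵐᵒᵖ →* G, ∀ (z₁ z₂ : X) (u : Path b z₁) (v : Path z₁ z₂)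
      (u' : Path z₂ b), (∀ t, u t ∈ U) → (∀ t, v t ∈ V) → (∀ t, u' t ∈ U) →
      Φ (MulOpposite.op (FundamentalGroup.fromPath (.mk ((u.trans v).trans u')))) =
        c z₁ * (c z₂)⁻¹ := by
  set Z := cocycleBundle U V hU hV hUV c hc with hZ
  refine ⟨⟨⟨fun γ => Z.transport γ.unop.toPath 1, Z.transport_refl b 1⟩, fun γ γ' => ?_⟩, ?_⟩
  · change Z.transport (γ.unop.toPath.trans γ'.unop.toPath) 1 = _
    rw [Z.transport_trans, ← mul_one (Z.transport γ.unop.toPath 1)]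
    exact cocycleBundle_transport_mul _ _ _
  · intro z₁ z₂ u v u' hu hv hu'
    have hz₁ : z₁ ∈ U := by simpa using hu 1
    have hz₂ : z₂ ∈ U := by simpa using hu' 0
    have key : ∀ {x y : X} (γ : Path x y) (i : Bool), (∀ t, γ t ∈ cond i U V) → x ∈ U → y ∈ U →
        ∀ g, Z.transport (.mk γ) g = g * (cond i 1 (c x) * (cond i 1 (c y))⁻¹) := by
      intro x y γ i hγ hx hy g
      have := Z.transport_mk_of_mem γ i hγ (g * cond i 1 (c x))
      simpa [hZ, cocycleBundle, hx, hy, mul_assoc] using this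
    change Z.transport (.mk ((u.trans v).trans u')) 1 = _
    rw [Path.Homotopic.Quotient.mk_trans, Path.Homotopic.Quotient.mk_trans, Z.transport_trans,
      Z.transport_trans, key u true hu hb hz₁, key v false hv hz₁ hz₂, key u' true hu' hz₂ hb]
    simp

end TwoOpen

/-! ### Fundamental groups of unions of two open sets: generators -/

section Generation

variable {X : Type*} [TopologicalSpace X]

theorem IsSimplyConnected.mk_eq_mk {S : Set X} (hS : IsSimplyConnected S) {x y : X}
    (p q : Path x y) (hp : ∀ t, p t ∈ S) (hq : ∀ t, q t ∈ S) :
    (Path.Homotopic.Quotient.mk p) = .mk q := by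
  have := hS.simplyConnectedSpace
  have hx : x ∈ S := by simpa using hp 0
  have hy : y ∈ S := by simpa using hp 1
  let p' : Path (⟨x, hx⟩ : S) ⟨y, hy⟩ := ⟨⟨fun t => ⟨p t, hp t⟩, by fun_prop⟩, by simp, by simp⟩
  let q' : Path (⟨x, hx⟩ : S) ⟨y, hy⟩ := ⟨⟨fun t => ⟨q t, hq t⟩, by fun_prop⟩, by simp, by simp⟩
  exact Path.Homotopic.Quotient.eq.2
    ((SimplyConnectedSpace.paths_homotopic p' q').map ⟨Subtype.val, continuous_subtype_val⟩)

@[simp] theorem Path.Homotopic.Quotient.symm_trans_cancel {x y z : X}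
    (γ : Path.Homotopic.Quotient x y) (δ : Path.Homotopic.Quotient y z) :
    γ.symm.trans (γ.trans δ) = δ := by
  rw [← Path.Homotopic.Quotient.trans_assoc, Path.Homotopic.Quotient.symm_trans,
    Path.Homotopic.Quotient.refl_trans]

@[simp] theorem Path.Homotopic.Quotient.trans_symm_cancel {x y z : X}
    (γ : Path.Homotopic.Quotient x y) (δ : Path.Homotopic.Quotient x z) :
    γ.trans (γ.symm.trans δ) = δ := by
  rw [← Path.Homotopic.Quotient.trans_assoc, Path.Homotopic.Quotient.trans_symm,
    Path.Homotopic.Quotient.refl_trans]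

theorem Path.trans_mem {S : Set X} {x y z : X} {p : Path x y} {q : Path y z} (hp : ∀ t, p t ∈ S)
    (hq : ∀ t, q t ∈ S) (t : I) : p.trans q t ∈ S := by
  have : p.trans q t ∈ Set.range (p.trans q) := ⟨t, rfl⟩
  rw [Path.trans_range] at this
  rcases this with ⟨s, hs⟩ | ⟨s, hs⟩
  · exact hs ▸ hp s
  · exact hs ▸ hq s

/-- The element of the fundamental group obtained by closing up a path class by means of chosen
path classes from the base point. -/
noncomputable def closeUp {b : X} (κ : ∀ x, Path.Homotopic.Quotient b x) {x y : X}
    (γ : Path.Homotopic.Quotient x y) : (FundamentalGroup X b)ᵐᵒᵖ :=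
  MulOpposite.op (FundamentalGroup.fromPath (((κ x).trans γ).trans (κ y).symm))

variable {b : X} (κ : ∀ x, Path.Homotopic.Quotient b x) {x y z : X}

theorem op_trans (γ γ' : Path.Homotopic.Quotient b b) :
    MulOpposite.op (FundamentalGroup.fromPath (γ.trans γ')) =
      MulOpposite.op (FundamentalGroup.fromPath γ) *
        MulOpposite.op (FundamentalGroup.fromPath γ') := rfl

theorem closeUp_trans (γ : Path.Homotopic.Quotient x y) (γ' : Path.Homotopic.Quotient y z) :
    closeUp κ (γ.trans γ') = closeUp κ γ * closeUp κ γ' := by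
  rw [closeUp, closeUp, closeUp, ← op_trans]
  congr 2
  simp

theorem closeUp_refl : closeUp κ (.refl x) = 1 := by
  have := closeUp_trans κ (.refl x) (.refl x)
  simpa using this

theorem closeUp_cast {x' y' : X} (γ : Path.Homotopic.Quotient x y) (hx : x' = x) (hy : y' = y) :
    closeUp κ (γ.cast hx hy) = closeUp κ γ := by
  subst hx hy
  rw [Path.Homotopic.Quotient.cast_rfl_rfl]

/-- Subdivide the path into pieces contained in `U` or in `V`, by compactness; closing up is
multiplicative, so it suffices to treat the pieces. -/
theorem closeUp_mem_of_local (H : Subgroup (FundamentalGroup X b)ᵐᵒᵖ) {U V : Set X}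
    (hU : IsOpen U) (hV : IsOpen V) (hUV : ∀ x, x ∉ U → x ∈ V)
    (hHU : ∀ (x y : X) (p : Path x y), (∀ t, p t ∈ U) → closeUp κ (.mk p) ∈ H)
    (hHV : ∀ (x y : X) (p : Path x y), (∀ t, p t ∈ V) → closeUp κ (.mk p) ∈ H)
    (γ : Path x y) : closeUp κ (.mk γ) ∈ H := by
  obtain ⟨t, ht0, hmono, ⟨N, hN⟩, hcover⟩ :=
    exists_monotone_Icc_subset_open_cover_unitInterval (c := fun i : Bool => γ ⁻¹' cond i U V)
      (fun i => by cases i <;> exact IsOpen.preimage γ.continuous (by assumption)) (fun s _ => by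
        by_cases h : γ s ∈ U
        · exact Set.mem_iUnion.2 ⟨true, h⟩
        · exact Set.mem_iUnion.2 ⟨false, hUV _ h⟩)
  have key : ∀ k, closeUp κ (.mk (γ.subpath 0 (t k))) ∈ H := by
    intro k
    induction k with
    | zero =>
      rw [ht0, Path.subpath_self, Path.Homotopic.Quotient.mk_refl, closeUp_refl]
      exact H.one_mem
    | succ k ih =>
      have h := Path.Homotopic.Quotient.eq.2
        ⟨Path.Homotopy.subpathTransSubpath γ 0 (t k) (t (k + 1))⟩
      rw [← h, Path.Homotopic.Quotient.mk_trans, closeUp_trans]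
      refine H.mul_mem ih ?_
      obtain ⟨i, hi⟩ := hcover k
      have hmem : ∀ s, γ.subpath (t k) (t (k + 1)) s ∈ cond i U V := by
        intro s
        have h1 : γ.subpath (t k) (t (k + 1)) s ∈ Set.range (γ.subpath (t k) (t (k + 1))) := ⟨s, rfl⟩
        rw [Path.range_subpath_of_le _ _ _ (hmono k.le_succ)] at h1
        obtain ⟨r, hr, h1⟩ := h1
        rw [← h1]
        exact hi hr
      cases i
      · exact hHV _ _ _ hmem
      · exact hHU _ _ _ hmem
  have := key N
  rwa [hN N le_rfl, Path.subpath_zero_one, Path.Homotopic.Quotient.mk_cast, closeUp_cast] at this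

/-- If the loops that go from the base point to `z` in `U`, then to `w` in `V`, and
return in `U`, lie in `H`, then `H` is the whole fundamental group. -/
theorem eq_top_of_loops_mem {U V : Set X} (hU : IsOpen U) (hV : IsOpen V)
    (hUV : ∀ x, x ∉ U → x ∈ V) (hsU : IsSimplyConnected U) (hsV : IsSimplyConnected V)
    (hb : b ∈ U) {w : X} (hwU : w ∈ U) (hwV : w ∈ V) (H : Subgroup (FundamentalGroup X b)ᵐᵒᵖ)
    (hH : ∀ z, z ∈ U → z ∈ V → ∃ (u : Path b z) (v : Path z w) (u' : Path w b),
      (∀ t, u t ∈ U) ∧ (∀ t, v t ∈ V) ∧ (∀ t, u' t ∈ U) ∧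
      MulOpposite.op (FundamentalGroup.fromPath (.mk ((u.trans v).trans u'))) ∈ H) : H = ⊤ := by
  classical
  have pU : ∀ x y, x ∈ U → y ∈ U → ∃ p : Path x y, ∀ t, p t ∈ U := fun x y hx hy =>
    ⟨_, (hsU.isPathConnected.joinedIn x hx y hy).somePath_mem⟩
  have pV : ∀ x y, x ∈ V → y ∈ V → ∃ p : Path x y, ∀ t, p t ∈ V := fun x y hx hy =>
    ⟨_, (hsV.isPathConnected.joinedIn x hx y hy).somePath_mem⟩
  obtain ⟨q, hq⟩ := pU b w hb hwU
  -- The reference paths stay in `U` where possible and otherwise pass through `w` and then stay in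
  -- `V`. Simple connectedness makes paths within `U` close up trivially and leaves only the loops
  -- of `hH` for paths in `V` ending at `w`.
  have hκ : ∀ x, ∃ κ : Path.Homotopic.Quotient b x,
      (x ∈ U → ∃ p : Path b x, (∀ t, p t ∈ U) ∧ κ = .mk p) ∧
      (x ∉ U → ∃ p : Path w x, (∀ t, p t ∈ V) ∧
        κ = (Path.Homotopic.Quotient.mk q).trans (.mk p)) := by
    intro x
    by_cases hx : x ∈ U
    · obtain ⟨p, hp⟩ := pU b x hb hx
      exact ⟨.mk p, fun _ => ⟨p, hp, rfl⟩, fun h => absurd hx h⟩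
    · obtain ⟨p, hp⟩ := pV w x hwV (hUV x hx)
      exact ⟨_, fun h => absurd h hx, fun _ => ⟨p, hp, rfl⟩⟩
  choose κ hκU hκV using hκ
  have κU : ∀ x (p : Path b x), (∀ t, p t ∈ U) → κ x = .mk p := by
    intro x p hp
    obtain ⟨p', hp', h⟩ := hκU x (by simpa using hp 1)
    rw [h, hsU.mk_eq_mk p p' hp hp']
  have κb : κ b = .refl b := κU b (Path.refl b) fun _ => hb
  have closeU : ∀ (x y : X) (p : Path x y), (∀ t, p t ∈ U) → closeUp κ (.mk p) = 1 := by
    intro x y p hp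
    obtain ⟨r, hr⟩ := pU b x hb (by simpa using hp 0)
    rw [closeUp, κU x r hr, κU y (r.trans p) (Path.trans_mem hr hp)]
    simp
    rfl
  have closeV : ∀ (x : X) (p : Path x w), (∀ t, p t ∈ V) → closeUp κ (.mk p) ∈ H := by
    intro x p hp
    have hxV : x ∈ V := by simpa using hp 0
    by_cases hx : x ∈ U
    · obtain ⟨u, v, u', hu, hv, hu', h⟩ := hH x hx hxV
      rw [closeUp, κU x u hu, hsV.mk_eq_mk p v hp hv, κU w u'.symm fun t => hu' _,
        ← Path.Homotopic.Quotient.mk_symm, Path.symm_symm]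
      exact h
    · obtain ⟨p', hp', h⟩ := hκV x hx
      rw [closeUp, h, κU w q hq, hsV.mk_eq_mk p p'.symm hp fun t => hp' _]
      simp
      exact H.one_mem
  rw [eq_top_iff]
  intro g _
  obtain ⟨γ, hγ⟩ := Path.Homotopic.Quotient.mk_surjective g.unop.toPath
  have h1 := closeUp_mem_of_local κ H hU hV hUV
    (fun x y p hp => by rw [closeU x y p hp]; exact H.one_mem) (fun x y p hp => by
      -- A path in `V` with arbitrary end is the difference of two paths in `V` ending at `w`.
      obtain ⟨r, hr⟩ := pV y w (by simpa using hp 1) hwV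
      have h2 := closeV x (p.trans r) (Path.trans_mem hp hr)
      rw [Path.Homotopic.Quotient.mk_trans, closeUp_trans] at h2
      exact (H.mul_mem_cancel_right (closeV y r hr)).1 h2) γ
  rw [hγ, closeUp, κb] at h1
  rw [← Path.Homotopic.Quotient.mk_refl, ← Path.Homotopic.Quotient.mk_symm, Path.refl_symm,
    Path.Homotopic.Quotient.mk_refl, Path.Homotopic.Quotient.trans_refl,
    Path.Homotopic.Quotient.refl_trans] at h1
  exact h1

end Generation

/-! ### The punctured plane as the union of two simply connected open sets -/

section Sides

variable {n : ℕ}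

/-- The plane without the closed horizontal half-lines that issue from the points `x_j`, to the
right if `ε = 1` and to the left if `ε = -1`. -/
def sidePlane (y : Fin n → ℝ) (ε : ℝ) : Set ℂ := {z | ∀ j, z.im = y j → ε * z.re < 0}

/-- The trace of `sidePlane y ε` on the punctured plane. -/
def side (y : Fin n → ℝ) (ε : ℝ) : Set (PuncturedPlane y) := Subtype.val ⁻¹' sidePlane y ε

variable (y : Fin n → ℝ)

theorem mem_side {ε : ℝ} {z : PuncturedPlane y} :
    z ∈ side y ε ↔ ∀ j, z.1.im = y j → ε * z.1.re < 0 := Iff.rfl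

theorem isOpen_side (ε : ℝ) : IsOpen (side y ε) := by
  have h : side y ε = ⋂ j, ({z | z.1.im ≠ y j} ∪ {z | ε * z.1.re < 0}) := by
    ext z
    simp only [mem_side, Set.mem_iInter, Set.mem_union, Set.mem_ofPred_eq]
    exact forall_congr' fun j => imp_iff_not_or
  rw [h]
  refine isOpen_iInter_of_finite fun j => IsOpen.union ?_ ?_
  · exact isOpen_ne_fun (Complex.continuous_im.comp continuous_subtype_val) continuous_const
  · exact isOpen_lt (continuous_const.mul (Complex.continuous_re.comp continuous_subtype_val))
      continuous_const

theorem puncture_re (j : Fin n) : (puncture y j).re = 0 := by simp [puncture]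

theorem puncture_im (j : Fin n) : (puncture y j).im = y j := by simp [puncture]

theorem mem_side_neg_one_of_notMem (z : PuncturedPlane y) (hz : z ∉ side y 1) :
    z ∈ side y (-1) := by
  simp only [mem_side, not_forall, not_lt] at hz ⊢
  obtain ⟨j, hj, hre⟩ := hz
  intro _ _
  have : z.1.re ≠ 0 := fun h => z.2 j (Complex.ext (by rw [h, puncture_re]) (by rw [hj, puncture_im]))
  have := lt_of_le_of_ne hre (by simpa using this.symm)
  linarith

/-- Slide horizontally away from the slits into the open half-plane on the other side of the
imaginary axis, then contract that convex set to the point -ε. -/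
theorem isSimplyConnected_sidePlane {ε : ℝ} (hε : ε * ε = 1) :
    IsSimplyConnected (sidePlane y ε) := by
  have hhalf : ∀ z : ℂ, ε * z.re < 0 → z ∈ sidePlane y ε := fun z hz _ _ => hz
  -- The displacement |re z| + 1 is enough to cross the imaginary axis from any point.
  let shift : I × sidePlane y ε → sidePlane y ε := fun p =>
    ⟨p.2.1 - ((ε * (p.1 * (|p.2.1.re| + 1)) : ℝ) : ℂ), fun j hj => by
      have h1 := p.2.2 j (by simpa using hj)
      have h2 : 0 ≤ (p.1 : ℝ) * (|p.2.1.re| + 1) := mul_nonneg p.1.2.1 (by positivity)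
      have h3 : ε * (ε * (p.1 * (|p.2.1.re| + 1))) = p.1 * (|p.2.1.re| + 1) := by
        rw [← mul_assoc, hε, one_mul]
      simp only [Complex.sub_re, Complex.ofReal_re, mul_sub]
      linarith⟩
  have hend : ∀ z : sidePlane y ε, ε * (shift (1, z)).1.re < 0 := by
    intro z
    have h3 : ε * (ε * (|z.1.re| + 1)) = |z.1.re| + 1 := by rw [← mul_assoc, hε, one_mul]
    have h4 : ε * z.1.re ≤ |z.1.re| := by
      have : |ε| = 1 := by nlinarith [abs_mul_abs_self ε, abs_nonneg ε]
      calc ε * z.1.re ≤ |ε * z.1.re| := le_abs_self _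
        _ = |z.1.re| := by rw [abs_mul, this, one_mul]
    simp only [shift, Complex.sub_re, Complex.ofReal_re, mul_sub, Set.Icc.coe_one, one_mul]
    linarith
  let p₀ : sidePlane y ε := ⟨((-ε : ℝ) : ℂ), hhalf _ (by
    rw [Complex.ofReal_re, mul_neg, hε]; norm_num)⟩
  let line : I × sidePlane y ε → sidePlane y ε := fun p =>
    ⟨((1 - p.1 : ℝ) : ℂ) * (shift (1, p.2)).1 + ((p.1 : ℝ) : ℂ) * p₀.1, hhalf _ (by
      have h1 := hend p.2
      have h2 := p.1.2.1
      have h3 := p.1.2.2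
      simp only [p₀, Complex.add_re, Complex.re_ofReal_mul, Complex.ofReal_re]
      have h4 : ∀ a s : ℝ, ε * ((1 - s) * a + s * -ε) = (1 - s) * (ε * a) - s := fun a s => by
        linear_combination (-s) * hε
      rw [h4]
      rcases h2.eq_or_lt with h | h
      · rw [← h]; linarith
      · nlinarith)⟩
  have hc1 : Continuous shift := by fun_prop
  have hc2 : Continuous line := by fun_prop
  have : ContractibleSpace (sidePlane y ε) := by
    rw [contractible_iff_id_nullhomotopic]
    refine ⟨p₀, ContinuousMap.Homotopic.trans (g := ⟨fun z => shift (1, z), by fun_prop⟩)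
      ⟨⟨⟨shift, hc1⟩, fun z => ?_, fun z => ?_⟩⟩ ⟨⟨⟨line, hc2⟩, fun z => ?_, fun z => ?_⟩⟩⟩
    · apply Subtype.ext; simp [shift]
    · rfl
    · apply Subtype.ext; simp [line]
    · apply Subtype.ext; simp [line]
  exact SimplyConnectedSpace.ofContractible _

theorem isSimplyConnected_side {ε : ℝ} (hε : ε * ε = 1) : IsSimplyConnected (side y ε) := by
  rw [← Topology.IsEmbedding.subtypeVal.isSimplyConnected_image, side,
    Set.image_preimage_eq_of_subset]
  · exact isSimplyConnected_sidePlane y hε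
  · intro z hz
    refine ⟨⟨z, fun j hj => ?_⟩, rfl⟩
    have := hz j (by rw [hj, puncture_im])
    rw [hj, puncture_re, mul_zero] at this
    exact lt_irrefl _ this

end Sides

/-! ### Lassos around the punctures -/

theorem Path.Homotopic.Quotient.symm_trans_rev {X : Type*} [TopologicalSpace X] {x y z : X}
    (γ : Path.Homotopic.Quotient x y) (δ : Path.Homotopic.Quotient y z) :
    (γ.trans δ).symm = δ.symm.trans γ.symm := by
  induction γ, δ using Path.Homotopic.Quotient.ind₂ with
  | mk γ δ =>
    rw [← mk_trans, ← mk_symm, Path.trans_symm, mk_trans, mk_symm, mk_symm]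

theorem Path.mk_trans_mk_of_square {X : Type*} [TopologicalSpace X] (F : C(I × I, X)) {a b c d : X}
    (bot : Path a b) (right : Path b d) (left : Path a c) (top : Path c d)
    (hbot : ∀ s, F (s, 0) = bot s) (hright : ∀ s, F (1, s) = right s)
    (hleft : ∀ s, F (0, s) = left s) (htop : ∀ s, F (s, 1) = top s) :
    (Path.Homotopic.Quotient.mk bot).trans (.mk right) = (Path.Homotopic.Quotient.mk left).trans (.mk top) := by
  obtain rfl : F (0, 0) = a := by rw [hbot, bot.source]
  obtain rfl : F (1, 0) = b := by rw [hbot, bot.target]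
  obtain rfl : F (0, 1) = c := by rw [htop, top.source]
  obtain rfl : F (1, 1) = d := by rw [htop, top.target]
  let e : Path (0 : I) 1 := ⟨.id I, rfl, rfl⟩
  have h1 : bot = (e.prod (Path.refl 0)).map F.continuous := Path.ext (funext fun s => (hbot s).symm)
  have h2 : right = ((Path.refl 1).prod e).map F.continuous :=
    Path.ext (funext fun s => (hright s).symm)
  have h3 : left = ((Path.refl 0).prod e).map F.continuous :=
    Path.ext (funext fun s => (hleft s).symm)
  have h4 : top = (e.prod (Path.refl 1)).map F.continuous := Path.ext (funext fun s => (htop s).symm)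
  have : ContractibleSpace (I × I) := by
    rw [contractible_iff_id_nullhomotopic]
    exact ⟨(0, 0), ⟨⟨⟨fun p => (σ p.1 * p.2.1, σ p.1 * p.2.2), by fun_prop⟩, by simp, by simp⟩⟩⟩
  rw [← Path.Homotopic.Quotient.mk_trans, ← Path.Homotopic.Quotient.mk_trans, h1, h2, h3, h4,
    ← Path.map_trans, ← Path.map_trans]
  exact Path.Homotopic.Quotient.eq.2 ((SimplyConnectedSpace.paths_homotopic _ _).map F)

section Lasso

variable {n : ℕ} (y : Fin n → ℝ)

/-- The punctured disc centred at `x_j` whose radius is the distance to the nearest other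
puncture. -/
def near (j : Fin n) : Set (PuncturedPlane y) :=
  {z | ∀ k, puncture y k ≠ puncture y j → ‖z.1 - puncture y j‖ < ‖puncture y k - puncture y j‖}

variable {y} {j : Fin n}

theorem mul_exp_add_ne_puncture {z : PuncturedPlane y} (hz : z ∈ near y j) (θ : ℝ) (k : Fin n) :
    puncture y j + (z.1 - puncture y j) * Complex.exp (θ * Complex.I) ≠ puncture y k := by
  intro h
  have h2 := congrArg norm (eq_sub_of_add_eq' h)
  rw [norm_mul, Complex.norm_exp_ofReal_mul_I, mul_one] at h2
  by_cases hkj : puncture y k = puncture y j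
  · rw [hkj, sub_self, norm_zero, norm_eq_zero, sub_eq_zero] at h2
    exact z.2 _ h2
  · exact (hz k hkj).ne h2

/-- The positive turn around `x_j` that starts at `z`. -/
noncomputable def turn {z : PuncturedPlane y} (hz : z ∈ near y j) : Path z z where
  toFun s := ⟨puncture y j +
      (z.1 - puncture y j) * Complex.exp ((2 * Real.pi * (s : ℝ) : ℝ) * Complex.I),
    mul_exp_add_ne_puncture hz _⟩
  continuous_toFun := by fun_prop
  source' := Subtype.ext (by simp)
  target' := Subtype.ext (by simp)

/-- Rotating the whole path `τ` about the puncture sweeps out a square with these four sides. -/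
theorem turn_trans {z z' : PuncturedPlane y} (τ : Path z z') (hτ : ∀ s, τ s ∈ near y j)
    (hz : z ∈ near y j) (hz' : z' ∈ near y j) :
    (Path.Homotopic.Quotient.mk τ).trans (.mk (turn hz')) = (Path.Homotopic.Quotient.mk (turn hz)).trans (.mk τ) := by
  refine Path.mk_trans_mk_of_square ⟨fun p => ⟨puncture y j +
      ((τ p.1).1 - puncture y j) * Complex.exp ((2 * Real.pi * (p.2 : ℝ) : ℝ) * Complex.I),
    mul_exp_add_ne_puncture (hτ p.1) _⟩, by fun_prop⟩ _ _ _ _ ?_ ?_ ?_ ?_ <;> intro s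
  · apply Subtype.ext; simp
  · apply Subtype.ext; simp [turn]
  · apply Subtype.ext; simp [turn]
  · apply Subtype.ext; simp

/-- Interpolate linearly between the logarithms of the displacements: the exponential never
vanishes, and its norm, a geometric mean, stays below the radius. -/
theorem exists_path_near {z z' : PuncturedPlane y} (hz : z ∈ near y j) (hz' : z' ∈ near y j) :
    ∃ τ : Path z z', ∀ s, τ s ∈ near y j := by
  have h0 : z.1 - puncture y j ≠ 0 := sub_ne_zero.2 (z.2 j)
  have h0' : z'.1 - puncture y j ≠ 0 := sub_ne_zero.2 (z'.2 j)
  let L : I → ℂ := fun s => ((1 - s : ℝ) : ℂ) * Complex.log (z.1 - puncture y j) +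
    ((s : ℝ) : ℂ) * Complex.log (z'.1 - puncture y j)
  have hL : ∀ s k, puncture y k ≠ puncture y j →
      ‖Complex.exp (L s)‖ < ‖puncture y k - puncture y j‖ := by
    intro s k hk
    have hpos : 0 < ‖puncture y k - puncture y j‖ := norm_pos_iff.2 (sub_ne_zero.2 hk)
    have h1 := Real.log_lt_log (norm_pos_iff.2 h0) (hz k hk)
    have h2 := Real.log_lt_log (norm_pos_iff.2 h0') (hz' k hk)
    rw [Complex.norm_exp, ← Real.lt_log_iff_exp_lt hpos]
    simp only [L, Complex.add_re, Complex.re_ofReal_mul, Complex.log_re]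
    have h3 := s.2.1
    have h4 := s.2.2
    rcases h3.eq_or_lt with h | h
    · rw [← h]; linarith
    · nlinarith
  have hne : ∀ s k, puncture y j + Complex.exp (L s) ≠ puncture y k := by
    intro s k h
    have h1 := eq_sub_of_add_eq' h
    by_cases hk : puncture y k = puncture y j
    · rw [hk, sub_self] at h1
      exact Complex.exp_ne_zero _ h1
    · exact (hL s k hk).ne (congrArg norm h1)
  refine ⟨⟨⟨fun s => ⟨puncture y j + Complex.exp (L s), hne s⟩, by fun_prop⟩, ?_, ?_⟩, ?_⟩
  · apply Subtype.ext; simp [L, Complex.exp_log h0]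
  · apply Subtype.ext; simp [L, Complex.exp_log h0']
  · intro s k hk
    simpa using hL s k hk

/-- The class of the loop that follows `p`, makes a positive turn around `x_j`, and returns. -/
noncomputable def lassoClass {z : PuncturedPlane y} (p : Path.Homotopic.Quotient (basePoint y) z)
    (hz : z ∈ near y j) : LoopGroup y :=
  MulOpposite.op (FundamentalGroup.fromPath ((p.trans (.mk (turn hz))).trans p.symm))

theorem lassoClass_trans {z z' : PuncturedPlane y} (p : Path.Homotopic.Quotient (basePoint y) z) (τ : Path z z')
    (hτ : ∀ s, τ s ∈ near y j) (hz : z ∈ near y j) (hz' : z' ∈ near y j) :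
    lassoClass (p.trans (.mk τ)) hz' = lassoClass p hz := by
  have h : ((p.trans (.mk τ)).trans (.mk (turn hz'))) = (p.trans (.mk (turn hz))).trans (.mk τ) := by
    rw [Path.Homotopic.Quotient.trans_assoc, turn_trans τ hτ hz hz',
      Path.Homotopic.Quotient.trans_assoc]
  rw [lassoClass, h, lassoClass]
  congr 2
  simp [Path.Homotopic.Quotient.symm_trans_rev]

theorem lassoClass_loop_trans {z : PuncturedPlane y} (w : Path.Homotopic.Quotient (basePoint y) (basePoint y))
    (p : Path.Homotopic.Quotient (basePoint y) z) (hz : z ∈ near y j) :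
    lassoClass (w.trans p) hz = MulOpposite.op (FundamentalGroup.fromPath w) * lassoClass p hz *
      (MulOpposite.op (FundamentalGroup.fromPath w))⁻¹ := by
  have h : (MulOpposite.op (FundamentalGroup.fromPath w))⁻¹ =
    MulOpposite.op (FundamentalGroup.fromPath w.symm) := rfl
  rw [h, lassoClass, lassoClass, ← op_trans, ← op_trans]
  congr 2
  simp [Path.Homotopic.Quotient.symm_trans_rev]

theorem lassoClass_cast {z z' : PuncturedPlane y} (p : Path.Homotopic.Quotient (basePoint y) z) (hz : z ∈ near y j)
    (h : z' = z) : lassoClass (p.cast rfl h) (h ▸ hz) = lassoClass p hz := by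
  subst h
  rw [Path.Homotopic.Quotient.cast_rfl_rfl]

theorem ConnectingPath.lasso_eq (γ : ConnectingPath y) (t : I) (ht : t ≠ 1) (hc : γ.IsCloseAt t) :
    γ.lasso t ht hc = lassoClass (j := γ.idx) (.mk (γ.initialPath t ht)) (hc t le_rfl) := rfl

/-- The end of the tail can be moved inside the punctured disc onto the segment; two lassos around
the same circle then differ by conjugation with the loop formed by their tails. -/
theorem lassoClass_mem_conjSet {z : PuncturedPlane y} (p : Path.Homotopic.Quotient (basePoint y) z)
    (hz : z ∈ near y j) : lassoClass p hz ∈ conjSet (stdReflection y) := by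
  set γ := ConnectingPath.segment y j
  have hclose : γ.point _ γ.exists_isCloseAt.choose_spec.1 ∈ near y j :=
    γ.exists_isCloseAt.choose_spec.2 _ le_rfl
  obtain ⟨τ, hτ⟩ := exists_path_near hz hclose
  set p' := Path.Homotopic.Quotient.mk (γ.initialPath _ γ.exists_isCloseAt.choose_spec.1)
  refine ⟨j, MulOpposite.op (FundamentalGroup.fromPath ((p.trans (.mk τ)).trans p'.symm)), ?_⟩
  have h := lassoClass_loop_trans ((p.trans (.mk τ)).trans p'.symm) p' (j := j)
    hclose
  refine Eq.trans ?_ h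
  rw [← lassoClass_trans p τ hτ hz hclose]
  congr 1
  simp

end Lasso

/-! ### The braid reflections are the conjugates of the standard ones -/

namespace ConnectingPath

variable {n : ℕ} {y : Fin n → ℝ}

/-- The square (s, r) ↦ γ(s · ((1 - r)t + rT)) has a constant left side, and its other sides are the
three paths. It never reaches the end of γ because T ≠ 1. -/
theorem mk_trans_mk (γ : ConnectingPath y) {t T : I} (hT : T ≠ 1) (htT : t ≤ T)
    {a z z' : PuncturedPlane y} (bot : Path a z) (right : Path z z') (top : Path a z')
    (hbot : ∀ s, (bot s).1 = γ.path (s * t))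
    (hright : ∀ s, (right s).1 = γ.path (Set.Icc.convexComb t T s))
    (htop : ∀ s, (top s).1 = γ.path (s * T)) :
    (Path.Homotopic.Quotient.mk bot).trans (.mk right) = .mk top := by
  have hne : ∀ p : I × I, p.1 * Set.Icc.convexComb t T p.2 ≠ 1 := fun p =>
    (lt_of_le_of_lt (unitInterval.mul_le_right.trans (Set.Icc.convexComb_le htT _))
      (lt_of_le_of_ne unitInterval.le_one' hT)).ne
  rw [Path.mk_trans_mk_of_square ⟨fun p => ⟨γ.path (p.1 * Set.Icc.convexComb t T p.2),
      γ.avoids _ (hne p)⟩, ?_⟩ bot right (Path.refl a) top (fun s => Subtype.ext ?_)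
      (fun s => Subtype.ext ?_) (fun s => Subtype.ext ?_) (fun s => Subtype.ext ?_),
    Path.Homotopic.Quotient.mk_refl, Path.Homotopic.Quotient.refl_trans]
  · have : Continuous fun p : I × I => Set.Icc.convexComb t T p.2 :=
      (Set.Icc.continuous_convexComb t T).comp continuous_snd
    fun_prop
  · simp [hbot]
  · simp [hright]
  · have := hbot 0
    simp only [Path.source, zero_mul] at this
    simp [this]
  · simp [htop]

theorem IsCloseAt.mono {γ : ConnectingPath y} {t t' : I} (h : γ.IsCloseAt t) (htt' : t ≤ t') :
    γ.IsCloseAt t' := fun s hs => h s (htt'.trans hs)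

theorem lasso_eq_of_le (γ : ConnectingPath y) {t t' : I} (htt' : t ≤ t') (ht : t ≠ 1) (ht' : t' ≠ 1)
    (hc : γ.IsCloseAt t) : γ.lasso t ht hc = γ.lasso t' ht' (hc.mono htt') := by
  let τ : Path (γ.point t ht) (γ.point t' ht') :=
    { toFun s := γ.point (Set.Icc.convexComb t t' s)
        (lt_of_le_of_lt (Set.Icc.convexComb_le htt' _) (lt_of_le_of_ne unitInterval.le_one' ht')).ne
      continuous_toFun := by
        have := Set.Icc.continuous_convexComb t t'
        unfold point
        fun_prop
      source' := by simp
      target' := by simp }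
  have hτ : ∀ s, τ s ∈ near y γ.idx := fun s => hc _ (Set.Icc.le_convexComb htt' s)
  rw [lasso_eq, lasso_eq, ← lassoClass_trans _ τ hτ (hc t le_rfl) (hc t' htt'),
    γ.mk_trans_mk ht' htt' (γ.initialPath t ht) τ (γ.initialPath t' ht') (fun _ => rfl)
      (fun _ => rfl) (fun _ => rfl)]

theorem lasso_eq_reflection (γ : ConnectingPath y) (t : I) (ht : t ≠ 1) (hc : γ.IsCloseAt t) :
    γ.lasso t ht hc = γ.reflection := by
  rcases le_total t γ.exists_isCloseAt.choose with h | h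
  · exact γ.lasso_eq_of_le h _ _ _
  · exact (γ.lasso_eq_of_le h _ _ _).symm

/-- A loop followed by a connecting path. -/
noncomputable def precomp (γ : ConnectingPath y) (w : Path (basePoint y) (basePoint y)) :
    ConnectingPath y where
  idx := γ.idx
  path := Path.trans ((w.map continuous_subtype_val).cast (x := -1) (y := -1) rfl rfl) γ.path
  avoids t ht k := by
    rw [Path.trans_apply]
    split_ifs with h
    · exact (w _).2 k
    · refine γ.avoids _ (fun h1 => ht ?_) k
      have := congrArg Subtype.val h1
      apply Subtype.ext
      simp only [Set.Icc.coe_one] at this ⊢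
      linarith

theorem precomp_path_of_le (γ : ConnectingPath y) (w : Path (basePoint y) (basePoint y)) (s u : I)
    (h : (u : ℝ) = s / 2) : (γ.precomp w).path u = (w s).1 := by
  have h1 := s.2.2
  rw [precomp, Path.trans_apply, dif_pos (by linarith)]
  have : (⟨2 * (u : ℝ), by rw [h]; constructor <;> linarith [s.2.1, s.2.2]⟩ : I) = s :=
    Subtype.ext (by simp [h]; ring)
  rw [this]
  rfl

theorem precomp_path_of_ge (γ : ConnectingPath y) (w : Path (basePoint y) (basePoint y)) (s u : I)
    (h : (u : ℝ) = (1 + s) / 2) : (γ.precomp w).path u = γ.path s := by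
  have h1 := s.2.1
  rw [precomp, Path.trans_apply]
  split_ifs with h2
  · have hs : s = 0 := Subtype.ext (show (s : ℝ) = 0 by linarith)
    have hu : (⟨2 * (u : ℝ), by rw [h]; constructor <;> linarith⟩ : I) = 1 :=
      Subtype.ext (by simp [h, hs])
    rw [hu, hs, Path.target, Path.source]
  · congr 1
    exact Subtype.ext (by simp [h]; ring)

/-- Prefixing a loop to a connecting path conjugates the braid reflection. Hence every conjugate of
a standard reflection is again a braid reflection. -/
theorem reflection_precomp (γ : ConnectingPath y) (w : Path (basePoint y) (basePoint y)) :
    (γ.precomp w).reflection = MulOpposite.op (FundamentalGroup.fromPath (.mk w)) * γ.reflection *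
      (MulOpposite.op (FundamentalGroup.fromPath (.mk w)))⁻¹ := by
  obtain ⟨t, ht, hc⟩ := γ.exists_isCloseAt
  have ht1 : (t : ℝ) < 1 := lt_of_le_of_ne t.2.2 fun h => ht (Subtype.ext h)
  let half : I := ⟨1 / 2, by norm_num, by norm_num⟩
  let T : I := ⟨(1 + t) / 2, by linarith [t.2.1], by linarith [t.2.2]⟩
  have hT : T ≠ 1 := fun h => by
    have := congrArg Subtype.val h
    simp only [T, Set.Icc.coe_one] at this
    linarith
  have hhT : half ≤ T := Subtype.coe_le_coe.1 (by simp only [half, T]; linarith [t.2.1])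
  have hcT : (γ.precomp w).IsCloseAt T := by
    intro s hs k hk
    have hs' : (1 + (t : ℝ)) / 2 ≤ s := hs
    let s' : I := ⟨2 * s - 1, by linarith [t.2.1], by linarith [s.2.2]⟩
    rw [γ.precomp_path_of_ge w s' s (by simp only [s']; ring)]
    exact hc s' (Subtype.coe_le_coe.1 (by simp only [s']; linarith)) k hk
  have hpoint : γ.point t ht = (γ.precomp w).point T hT :=
    Subtype.ext (γ.precomp_path_of_ge w t T rfl).symm
  have key := (γ.precomp w).mk_trans_mk hT hhT w (γ.initialPath t ht)
    (((γ.precomp w).initialPath T hT).cast rfl hpoint)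
    (fun s => (γ.precomp_path_of_le w _ _ (by simp [half]; ring)).symm)
    (fun s => (γ.precomp_path_of_ge w _ _ (by
      simp [half, T, Set.Icc.coe_convexComb]; ring)).symm) fun s => rfl
  rw [← lasso_eq_reflection _ T hT hcT, ← lasso_eq_reflection _ t ht hc, lasso_eq, lasso_eq]
  have hnear : (γ.precomp w).point T hT ∈ near y γ.idx := hcT T le_rfl
  refine Eq.trans (lassoClass_cast _ hnear hpoint).symm ?_
  refine Eq.trans ?_ (lassoClass_loop_trans (.mk w) (.mk (γ.initialPath t ht)) (hc t le_rfl))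
  rw [key]
  rfl

end ConnectingPath

theorem braidReflections_eq_conjSet {n : ℕ} (y : Fin n → ℝ) :
    braidReflections y = conjSet (stdReflection y) := by
  ext r
  constructor
  · rintro ⟨γ, rfl⟩
    exact lassoClass_mem_conjSet (j := γ.idx) (.mk (γ.initialPath _ γ.exists_isCloseAt.choose_spec.1))
      (γ.exists_isCloseAt.choose_spec.2 _ le_rfl)
  · rintro ⟨j, w, rfl⟩
    obtain ⟨p, hp⟩ := Path.Homotopic.Quotient.mk_surjective w.unop.toPath
    refine ⟨(ConnectingPath.segment y j).precomp p, ?_⟩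
    rw [ConnectingPath.reflection_precomp, hp]
    rfl

/-! ### The standard braid reflections as loops through the two sides -/

theorem Path.mk_eq_trans_subpath {X : Type*} [TopologicalSpace X] {a b : X} (γ : Path a b)
    (s t : I) : Path.Homotopic.Quotient.mk γ =
      ((Path.Homotopic.Quotient.mk ((γ.subpath 0 s).cast γ.source.symm rfl)).trans
        (.mk (γ.subpath s t))).trans (.mk ((γ.subpath t 1).cast rfl γ.target.symm)) := by
  have h := (Path.Homotopic.Quotient.mk_trans _ _).symm.trans
    (Path.Homotopic.Quotient.eq.2 ⟨Path.Homotopy.subpathTransSubpath γ 0 s t⟩)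
  have h' := (Path.Homotopic.Quotient.mk_trans _ _).symm.trans
    (Path.Homotopic.Quotient.eq.2 ⟨Path.Homotopy.subpathTransSubpath γ 0 t 1⟩)
  rw [← h, Path.subpath_zero_one] at h'
  have h2 := congrArg (fun q => q.cast γ.source.symm γ.target.symm) h'
  rw [Path.Homotopic.Quotient.mk_cast, Path.Homotopic.Quotient.cast_cast,
    Path.Homotopic.Quotient.cast_rfl_rfl] at h2
  exact h2.symm

section StdReflection

variable {n : ℕ} {y : Fin n → ℝ} {j : Fin n}

theorem norm_puncture_sub (k : Fin n) : ‖puncture y k - puncture y j‖ = |y k - y j| := by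
  rw [puncture, puncture, ← sub_mul, norm_mul, Complex.norm_I, mul_one, ← Complex.ofReal_sub,
    Complex.norm_real, Real.norm_eq_abs]

theorem abs_im_sub_lt_of_mem_near {z : PuncturedPlane y} (hz : z ∈ near y j) {k : Fin n}
    (hk : y k ≠ y j) : |z.1.im - y j| < |y k - y j| := by
  have h := hz k fun h => hk (by rw [← puncture_im y k, h, puncture_im])
  rw [norm_puncture_sub] at h
  refine lt_of_le_of_lt ?_ h
  have := Complex.abs_im_le_norm (z.1 - puncture y j)
  rwa [Complex.sub_im, puncture_im] at this

theorem turn_mem_near {z : PuncturedPlane y} (hz : z ∈ near y j) (s : I) :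
    turn hz s ∈ near y j := by
  intro k hk
  have : (turn hz s).1 - puncture y j =
      (z.1 - puncture y j) * Complex.exp ((2 * Real.pi * (s : ℝ) : ℝ) * Complex.I) :=
    add_sub_cancel_left _ _
  rw [this, norm_mul, Complex.norm_exp_ofReal_mul_I, mul_one]
  exact hz k hk

theorem mem_side_of_mem_near {z : PuncturedPlane y} (hz : z ∈ near y j)
    {ε : ℝ} (h : z.1.im = y j → ε * z.1.re < 0) : z ∈ side y ε := by
  intro k hk
  by_cases hkj : y k = y j
  · exact h (hk.trans hkj)
  · exact absurd (congrArg (fun a => |a - y j|) hk) (abs_im_sub_lt_of_mem_near hz hkj).ne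

theorem segment_path_re (t : I) : ((ConnectingPath.segment y j).path t).re = -(1 - (t : ℝ)) := by
  change ((1 - (t : ℝ) : ℝ) * (-1 : ℂ) + ((t : ℝ) : ℂ) * puncture y j).re = _
  rw [Complex.add_re, Complex.re_ofReal_mul, Complex.re_ofReal_mul, puncture_re]
  simp

theorem segment_path_sub (t : I) : (ConnectingPath.segment y j).path t - puncture y j =
    -((1 - (t : ℝ) : ℝ) * (1 + y j * Complex.I)) := by
  simp only [ConnectingPath.segment, puncture]
  change ((1 - (t : ℝ) : ℝ) * (-1 : ℂ) + ((t : ℝ) : ℂ) * _) - _ = _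
  push_cast
  ring

theorem cos_pos_of_sin_eq_zero {φ : ℝ} (h1 : -(Real.pi / 2) ≤ φ) (h2 : φ ≤ Real.pi / 2)
    (h : Real.sin φ = 0) : 0 < Real.cos φ := by
  have h3 := Real.cos_nonneg_of_neg_pi_div_two_le_of_le h1 h2
  have h4 := Real.sin_sq_add_cos_sq φ
  rw [h] at h4
  nlinarith

/-- The turn starts to the left of the puncture, passes to its right at the lowest point of the
circle, and returns to its left at the highest point. The circle is too small to meet the heights of
other punctures. -/
theorem exists_turn_eq (t : I) (ht : t ≠ 1)
    (hz : (ConnectingPath.segment y j).point t ht ∈ near y j) :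
    ∃ a₁ a₂ : I, a₁ ≤ a₂ ∧ (∀ s ≤ a₁, turn hz s ∈ side y 1) ∧
      (∀ s, a₁ ≤ s → s ≤ a₂ → turn hz s ∈ side y (-1)) ∧ (∀ s, a₂ ≤ s → turn hz s ∈ side y 1) ∧
      (turn hz a₁).1.im < y j ∧ y j < (turn hz a₂).1.im := by
  set w : ℂ := 1 + y j * Complex.I with hw
  have ht1 : 0 < 1 - (t : ℝ) := sub_pos.2 (lt_of_le_of_ne t.2.2 fun h => ht (Subtype.ext h))
  have hwre : w.re = 1 := by simp [hw]
  have hα := Complex.abs_arg_lt_pi_div_two_iff.2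
    (Or.inl (by rw [hwre]; exact one_pos) : 0 < w.re ∨ w = 0)
  set α := w.arg
  rw [abs_lt] at hα
  obtain ⟨hα1, hα2⟩ := hα
  have hπ := Real.pi_pos
  set r : ℝ := (1 - t) * ‖w‖ with hr
  have hr0 : 0 < r := mul_pos ht1 (norm_pos_iff.2 fun h => by simp [h] at hwre)
  have hturn : ∀ s : I, (turn hz s).1 =
      puncture y j - (r : ℂ) * Complex.exp (((α + 2 * Real.pi * s : ℝ) : ℂ) * Complex.I) := by
    intro s
    have h1 : (turn hz s).1 = puncture y j + ((ConnectingPath.segment y j).path t - puncture y j) *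
      Complex.exp ((2 * Real.pi * (s : ℝ) : ℝ) * Complex.I) := rfl
    rw [h1, segment_path_sub, ← hw, ← Complex.norm_mul_exp_arg_mul_I w, hr, Complex.ofReal_add,
      add_mul, Complex.exp_add]
    push_cast
    ring
  have hre : ∀ s : I, (turn hz s).1.re = -(r * Real.cos (α + 2 * Real.pi * s)) := by
    intro s
    rw [hturn, Complex.sub_re, puncture_re, Complex.re_ofReal_mul, Complex.exp_ofReal_mul_I_re,
      zero_sub]
  have him : ∀ s : I, (turn hz s).1.im = y j - r * Real.sin (α + 2 * Real.pi * s) := by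
    intro s
    rw [hturn, Complex.sub_im, puncture_im, Complex.im_ofReal_mul, Complex.exp_ofReal_mul_I_im]
  have hsin : ∀ s : I, (turn hz s).1.im = y j → Real.sin (α + 2 * Real.pi * s) = 0 := by
    intro s h
    rw [him, sub_eq_self] at h
    exact (mul_eq_zero.1 h).resolve_left hr0.ne'
  have hdiv : ∀ a : ℝ, 2 * Real.pi * (a / (2 * Real.pi)) = a := fun a => by field_simp
  -- With α the argument of x_j + 1, the displacement from x_j is -r times the unit vector of angle
  -- α + 2πs. The angles π/2 and 3π/2 give the lowest and the highest point, `a₁` and `a₂`.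
  let a₁ : I := ⟨(Real.pi / 2 - α) / (2 * Real.pi), by
    constructor
    · apply div_nonneg <;> linarith
    · rw [div_le_one (by positivity)]; linarith⟩
  let a₂ : I := ⟨(3 * Real.pi / 2 - α) / (2 * Real.pi), by
    constructor
    · apply div_nonneg <;> linarith
    · rw [div_le_one (by positivity)]; linarith⟩
  have ha₁ : 2 * Real.pi * (a₁ : ℝ) = Real.pi / 2 - α := hdiv _
  have ha₂ : 2 * Real.pi * (a₂ : ℝ) = 3 * Real.pi / 2 - α := hdiv _
  have hmono : ∀ s s' : I, s ≤ s' → 2 * Real.pi * (s : ℝ) ≤ 2 * Real.pi * s' := fun s s' h =>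
    mul_le_mul_of_nonneg_left h (by positivity)
  have h12 : a₁ ≤ a₂ := by
    refine Subtype.coe_le_coe.1 ?_
    refine div_le_div_of_nonneg_right ?_ (by positivity)
    linarith
  refine ⟨a₁, a₂, h12, fun s hs => ?_, fun s hs hs' => ?_, fun s hs => ?_, ?_, ?_⟩
  · have h1 := hmono _ _ hs
    have h2 := hmono 0 s s.2.1
    rw [ha₁] at h1
    simp only [Set.Icc.coe_zero, mul_zero] at h2
    refine mem_side_of_mem_near (turn_mem_near hz s) fun h => ?_
    have := cos_pos_of_sin_eq_zero (by linarith) (by linarith) (hsin s h)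
    rw [hre, one_mul, neg_lt_zero]
    positivity
  · have h1 := hmono _ _ hs
    have h2 := hmono _ _ hs'
    rw [ha₁] at h1
    rw [ha₂] at h2
    refine mem_side_of_mem_near (turn_mem_near hz s) fun h => ?_
    have := cos_pos_of_sin_eq_zero (φ := α + 2 * Real.pi * s - Real.pi) (by linarith) (by linarith)
      (by rw [Real.sin_sub_pi, hsin s h, neg_zero])
    rw [Real.cos_sub_pi] at this
    rw [hre]
    nlinarith
  · have h1 := hmono _ _ hs
    have h2 := hmono s 1 s.2.2
    rw [ha₂] at h1
    simp only [Set.Icc.coe_one, mul_one] at h2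
    refine mem_side_of_mem_near (turn_mem_near hz s) fun h => ?_
    have := cos_pos_of_sin_eq_zero (φ := α + 2 * Real.pi * s - 2 * Real.pi) (by linarith)
      (by linarith) (by rw [Real.sin_sub_two_pi, hsin s h])
    rw [Real.cos_sub_two_pi] at this
    rw [hre, one_mul, neg_lt_zero]
    positivity
  · rw [him, ha₁, add_sub_cancel, Real.sin_pi_div_two]
    linarith
  · rw [him, ha₂, add_sub_cancel, show 3 * Real.pi / 2 = Real.pi / 2 + Real.pi by ring,
      Real.sin_add_pi, Real.sin_pi_div_two]
    linarith

/-- The j-th generator crosses to the right in the strip just below x_j and comes back in the strip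
just above it. -/
theorem exists_stdReflection_eq (hy : StrictMono y) (j : Fin n) :
    ∃ (z₁ z₂ : PuncturedPlane y) (u : Path (basePoint y) z₁) (v : Path z₁ z₂)
      (u' : Path z₂ (basePoint y)), (∀ s, u s ∈ side y 1) ∧ (∀ s, v s ∈ side y (-1)) ∧
      (∀ s, u' s ∈ side y 1) ∧ (∀ k, y k < z₁.1.im ↔ k < j) ∧ (∀ k, y k < z₂.1.im ↔ k ≤ j) ∧
      stdReflection y j =
        MulOpposite.op (FundamentalGroup.fromPath (.mk ((u.trans v).trans u'))) := by
  set γ := ConnectingPath.segment y j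
  obtain ⟨t, ht, hc⟩ := γ.exists_isCloseAt
  have hz : γ.point t ht ∈ near y j := hc t le_rfl
  obtain ⟨a₁, a₂, h12, hs1, hs2, hs3, him1, him2⟩ := exists_turn_eq t ht hz
  have hinit : ∀ s, γ.initialPath t ht s ∈ side y 1 := by
    intro s k _
    change 1 * (γ.path (s * t)).re < 0
    rw [segment_path_re, one_mul, neg_lt_zero, sub_pos]
    exact lt_of_le_of_lt unitInterval.mul_le_right
      (lt_of_le_of_ne unitInterval.le_one' ht : t < 1)
  have hsub : ∀ (s s' : I), s ≤ s' → ∀ S : Set (PuncturedPlane y),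
      (∀ r, s ≤ r → r ≤ s' → turn hz r ∈ S) → ∀ r, (turn hz).subpath s s' r ∈ S := by
    intro s s' hss' S hS r
    exact hS _ (Set.Icc.le_convexComb hss' r) (Set.Icc.convexComb_le hss' r)
  have hn1 := fun k hk => abs_im_sub_lt_of_mem_near (turn_mem_near hz a₁) (k := k) hk
  have hn2 := fun k hk => abs_im_sub_lt_of_mem_near (turn_mem_near hz a₂) (k := k) hk
  refine ⟨turn hz a₁, turn hz a₂,
    (γ.initialPath t ht).trans (((turn hz).subpath 0 a₁).cast (turn hz).source.symm rfl),
    (turn hz).subpath a₁ a₂,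
    (((turn hz).subpath a₂ 1).cast rfl (turn hz).target.symm).trans (γ.initialPath t ht).symm,
    Path.trans_mem hinit (hsub _ _ unitInterval.nonneg' _ fun r _ hr => hs1 r hr),
    hsub _ _ h12 _ hs2,
    Path.trans_mem (hsub _ _ unitInterval.le_one' _ fun r hr _ => hs3 r hr) fun s => hinit _,
    fun k => ?_, fun k => ?_, ?_⟩
  · constructor
    · intro h
      exact hy.lt_iff_lt.1 (h.trans him1)
    · intro h
      have h1 := hy h
      have h2 := hn1 k h1.ne
      rw [abs_sub_comm, abs_sub_comm (y k), abs_of_pos (sub_pos.2 him1),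
        abs_of_pos (sub_pos.2 h1)] at h2
      linarith
  · constructor
    · intro h
      by_contra hk
      have h1 := hy (not_le.1 hk)
      have h2 := hn2 k h1.ne'
      rw [abs_of_pos (sub_pos.2 him2), abs_of_pos (sub_pos.2 h1)] at h2
      linarith
    · intro h
      exact (hy.le_iff_le.2 h).trans_lt him2
  · rw [stdReflection, ← ConnectingPath.lasso_eq_reflection _ t ht hc]
    refine congrArg (fun q => MulOpposite.op (FundamentalGroup.fromPath q)) ?_
    have h := Path.mk_eq_trans_subpath (turn hz) a₁ a₂
    change ((Path.Homotopic.Quotient.mk (γ.initialPath t ht)).trans (.mk (turn hz))).trans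
      (.mk (γ.initialPath t ht).symm) = _
    rw [h]
    simp

end StdReflection

/-! ### The fundamental group of the punctured plane is free on the standard braid reflections -/

section Free

variable {n : ℕ} {y : Fin n → ℝ}

theorem basePoint_mem_side : basePoint y ∈ side y 1 := fun _ _ => by simp [basePoint]

/-- The number of punctures below a point. -/
noncomputable def numBelow (y : Fin n → ℝ) (z : PuncturedPlane y) : ℕ := by
  classical exact (Finset.univ.filter fun k => y k < z.1.im).card

theorem im_ne_of_mem_side {z : PuncturedPlane y} (h : z ∈ side y 1) (h' : z ∈ side y (-1))
    (k : Fin n) : z.1.im ≠ y k := fun hk => by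
  have h1 := h k hk
  have h2 := h' k hk
  linarith

theorem numBelow_eq_of_iff {z z' : PuncturedPlane y} (h : ∀ k, y k < z.1.im ↔ y k < z'.1.im) :
    numBelow y z = numBelow y z' := by
  simp only [numBelow, h]

theorem numBelow_of_lt_iff {z : PuncturedPlane y} {j : Fin n} (h : ∀ k, y k < z.1.im ↔ k < j) :
    numBelow y z = j := by
  simp only [numBelow, h]
  convert Fin.card_Iio j using 2
  ext k
  simp

theorem numBelow_of_le_iff {z : PuncturedPlane y} {j : Fin n} (h : ∀ k, y k < z.1.im ↔ k ≤ j) :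
    numBelow y z = j + 1 := by
  simp only [numBelow, h]
  convert Fin.card_Iic j using 2
  ext k
  simp

/-- No point of the intersection has the height of a puncture, so the number of punctures below it
is locally constant. -/
theorem continuousOn_comp_numBelow {G : Type*} [TopologicalSpace G] (c : ℕ → G) :
    ContinuousOn (fun z => c (numBelow y z)) (side y 1 ∩ side y (-1)) := by
  intro z hz
  refine ContinuousAt.continuousWithinAt (continuousAt_const.congr (f := fun _ => c (numBelow y z)) ?_)
  have him : Continuous fun z : PuncturedPlane y => z.1.im :=
    Complex.continuous_im.comp continuous_subtype_val
  have : ∀ᶠ z' in nhds z, ∀ k, y k < z.1.im ↔ y k < z'.1.im := by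
    rw [Filter.eventually_all]
    intro k
    rcases (im_ne_of_mem_side hz.1 hz.2 k).lt_or_gt with h | h
    · filter_upwards [him.continuousAt.eventually_lt continuousAt_const h] with z' hz'
      exact iff_of_false h.not_gt hz'.not_gt
    · filter_upwards [continuousAt_const.eventually_lt him.continuousAt h] with z' hz'
      exact iff_of_true h hz'
  filter_upwards [this] with z' hz'
  rw [numBelow_eq_of_iff hz']

theorem exists_hom_freeGroup (hy : StrictMono y) :
    ∃ Φ : LoopGroup y →* FreeGroup (Fin n), ∀ j, Φ (stdReflection y j) = FreeGroup.of j := by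
  let _ : TopologicalSpace (FreeGroup (Fin n)) := ⊥
  have : DiscreteTopology (FreeGroup (Fin n)) := ⟨rfl⟩
  obtain ⟨Φ, hΦ⟩ := exists_hom_of_cocycle (isOpen_side y 1) (isOpen_side y (-1))
    (fun z hz => mem_side_neg_one_of_notMem y z hz)
    -- With inverse partial products as gluing data, crossing from strip j to strip j + 1
    -- contributes the quotient of consecutive partial products, the j-th free generator.
    (continuousOn_comp_numBelow fun k =>
      (partialProd (FreeGroup.of : Fin n → FreeGroup (Fin n)) k)⁻¹) (basePoint_mem_side (y := y))
  refine ⟨Φ, fun j => ?_⟩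
  obtain ⟨z₁, z₂, u, v, u', hu, hv, hu', h₁, h₂, h⟩ := exists_stdReflection_eq hy j
  have n₁ : numBelow y z₁ = j :=
    numBelow_of_lt_iff h₁
  have n₂ : numBelow y z₂ = j + 1 :=
    numBelow_of_le_iff h₂
  rw [h, hΦ z₁ z₂ u v u' hu hv hu', n₁, n₂, inv_inv, partialProd_succ _ j.2,
    inv_mul_cancel_left]

/-- Two points of both sides that are in the same horizontal strip are joined by a path
lying in both sides. -/
theorem exists_path_of_same_strip {z z' : PuncturedPlane y} (h : z ∈ side y 1)
    (h' : z ∈ side y (-1)) (hz' : z' ∈ side y 1) (hz'' : z' ∈ side y (-1))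
    (hiff : ∀ k, y k < z.1.im ↔ y k < z'.1.im) :
    ∃ p : Path z z', (∀ s, p s ∈ side y 1) ∧ ∀ s, p s ∈ side y (-1) := by
  let w : I → ℂ := fun s => ((1 - s : ℝ) : ℂ) * z.1 + ((s : ℝ) : ℂ) * z'.1
  have hw : ∀ s k, (w s).im ≠ y k := by
    intro s k
    have h3 := s.2.1
    have h4 := s.2.2
    have him : (w s).im = (1 - s) * z.1.im + s * z'.1.im := by
      simp only [w, Complex.add_im, Complex.im_ofReal_mul]
    rw [him]
    rcases (im_ne_of_mem_side h h' k).lt_or_gt with hk | hk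
    · have hk' : z'.1.im < y k :=
        lt_of_le_of_ne (not_lt.1 fun h => hk.not_gt ((hiff k).2 h)) (im_ne_of_mem_side hz' hz'' k)
      refine ne_of_lt ?_
      rcases h3.eq_or_lt with h | h
      · rw [← h]; linarith
      · nlinarith
    · have hk' := (hiff k).1 hk
      refine ne_of_gt ?_
      rcases h3.eq_or_lt with h | h
      · rw [← h]; linarith
      · nlinarith
  refine ⟨⟨⟨fun s => ⟨w s, fun k hk => hw s k (by rw [hk, puncture_im])⟩, by fun_prop⟩, ?_, ?_⟩,
    fun s k hk => absurd hk (hw s k), fun s k hk => absurd hk (hw s k)⟩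
  · apply Subtype.ext; simp [w]
  · apply Subtype.ext; simp [w]

/-- It suffices to generate the loops crossing to the right in a given strip and returning above all
punctures. Such a loop is `f_j` times the same kind of loop started one strip higher, and in the top
strip it is trivial. -/
theorem closure_range_stdReflection (hy : StrictMono y) :
    Subgroup.closure (Set.range (stdReflection y)) = ⊤ := by
  set H := Subgroup.closure (Set.range (stdReflection y))
  have sU := isSimplyConnected_side y (ε := 1) (by norm_num)
  have sV := isSimplyConnected_side y (ε := -1) (by norm_num)
  obtain ⟨M, hM⟩ := (Set.finite_range y).bddAbove
  have hM' : ∀ k, y k < M + 1 := fun k => lt_of_le_of_lt (hM ⟨k, rfl⟩) (lt_add_one M)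
  -- A point above all punctures lies in both sides and serves as the common return point.
  let top : PuncturedPlane y := ⟨⟨0, M + 1⟩, fun k hk => by
    have := congrArg Complex.im hk
    rw [puncture_im] at this
    exact (hM' k).ne' this⟩
  have topmem : ∀ ε, top ∈ side y ε := fun ε k hk => absurd hk (hM' k).ne'
  have pU : ∀ z z', z ∈ side y 1 → z' ∈ side y 1 → ∃ p : Path z z', ∀ t, p t ∈ side y 1 :=
    fun z z' hz hz' => ⟨_, (sU.isPathConnected.joinedIn z hz z' hz').somePath_mem⟩
  refine eq_top_of_loops_mem (isOpen_side y 1) (isOpen_side y (-1))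
    (fun z hz => mem_side_neg_one_of_notMem y z hz) sU sV basePoint_mem_side (topmem 1)
    (topmem (-1)) H ?_
  obtain ⟨q, hq⟩ := pU top (basePoint y) (topmem 1) basePoint_mem_side
  suffices key : ∀ (m : ℕ) (z : PuncturedPlane y), z ∈ side y 1 → z ∈ side y (-1) →
      n - numBelow y z = m → ∃ (u : Path (basePoint y) z) (v : Path z top),
        (∀ t, u t ∈ side y 1) ∧ (∀ t, v t ∈ side y (-1)) ∧
        MulOpposite.op (FundamentalGroup.fromPath (.mk ((u.trans v).trans q))) ∈ H by
    intro z hz hz'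
    obtain ⟨u, v, hu, hv, h⟩ := key _ z hz hz' rfl
    exact ⟨u, v, q, hu, hv, hq, h⟩
  intro m
  induction m using Nat.strong_induction_on with
  | _ m ih =>
    intro z hz hz' hm
    by_cases hall : ∀ k, y k < z.1.im
    · obtain ⟨u, hu⟩ := pU _ z basePoint_mem_side hz
      obtain ⟨p, hp, hp'⟩ := exists_path_of_same_strip hz hz' (topmem 1) (topmem (-1))
        fun k => iff_of_true (hall k) (hM' k)
      refine ⟨u, p, hu, hp', ?_⟩
      rw [sU.mk_eq_mk _ (Path.refl _) (Path.trans_mem (Path.trans_mem hu hp) hq)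
        fun _ => basePoint_mem_side]
      exact H.one_mem
    -- The lowest puncture not below z: then z lies in the strip just below x_j, where `f_j` crosses
    -- to the right.
    · obtain ⟨j, hj, hmin⟩ := WellFounded.has_min (wellFounded_lt (α := Fin n))
        {k | ¬ y k < z.1.im} (not_forall.1 hall)
      have hj' : ∀ k, y k < z.1.im ↔ k < j := fun k =>
        ⟨fun h => not_le.1 fun hjk => hj ((hy.monotone hjk).trans_lt h),
          fun h => not_not.1 fun h' => hmin k h' h⟩
      obtain ⟨z₁, z₂, u, v, u', hu, hv, hu', h₁, h₂, h⟩ := exists_stdReflection_eq hy j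
      have hz₁ := hu 1
      have hz₁' := hv 0
      have hz₂ := hu' 0
      have hz₂' := hv 1
      rw [Path.target] at hz₁ hz₂'
      rw [Path.source] at hz₁' hz₂
      obtain ⟨p, hp, hp'⟩ := exists_path_of_same_strip hz hz' hz₁ hz₁'
        fun k => (hj' k).trans (h₁ k).symm
      obtain ⟨u₂, v₂, hu₂, hv₂, hmem⟩ := ih (n - numBelow y z₂) (by
        rw [← hm, numBelow_of_lt_iff hj', numBelow_of_le_iff h₂]
        omega) z₂ hz₂ hz₂' rfl
      refine ⟨u.trans p.symm, p.trans (v.trans v₂), Path.trans_mem hu fun t => hp _,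
        Path.trans_mem hp' (Path.trans_mem hv hv₂), ?_⟩
      have hf : stdReflection y j ∈ H := Subgroup.subset_closure ⟨j, rfl⟩
      have := H.mul_mem hf hmem
      rw [h, ← op_trans] at this
      convert this using 3
      have h2 := sU.mk_eq_mk u₂ u'.symm hu₂ fun t => hu' _
      simp only [Path.Homotopic.Quotient.mk_trans, Path.Homotopic.Quotient.mk_symm, h2,
        Path.Homotopic.Quotient.trans_assoc, Path.Homotopic.Quotient.symm_trans_cancel,
        Path.Homotopic.Quotient.trans_symm_cancel]

theorem exists_mulEquiv_freeGroup (hy : StrictMono y) :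
    ∃ e : LoopGroup y ≃* FreeGroup (Fin n), ∀ j, e (stdReflection y j) = FreeGroup.of j := by
  obtain ⟨Φ, hΦ⟩ := exists_hom_freeGroup hy
  have hid : (FreeGroup.lift (stdReflection y)).comp Φ = MonoidHom.id _ := by
    refine MonoidHom.eq_of_eqOn_dense (closure_range_stdReflection hy) ?_
    rintro _ ⟨j, rfl⟩
    simp [hΦ]
  have hid' : Φ.comp (FreeGroup.lift (stdReflection y)) = MonoidHom.id _ := by
    ext j
    simp [hΦ]
  exact ⟨MonoidHom.toMulEquiv Φ (FreeGroup.lift (stdReflection y)) hid hid', hΦ⟩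

end Free

theorem mainTheorem3 (n : ℕ) (y : Fin n → ℝ) (hy : StrictMono y) :
    -- (1)
    IsSimplyTransitiveOn (hurwitz n (LoopGroup y)) (Red (braidReflections y) (stdElement y) n) ∧
    -- the epimorphism `π : F_n → W_n`, uniquely determined by `f_j ↦ s_j`
    ∃ π : LoopGroup y →* UniversalCoxeterGroup n,
      (∀ j, π (stdReflection y j) = coxeterGen n j) ∧
      (∀ π' : LoopGroup y →* UniversalCoxeterGroup n,
        (∀ j, π' (stdReflection y j) = coxeterGen n j) → π' = π) ∧
      Function.Surjective π ∧
      -- (2), with `T = π(R)` and `c = π(g)`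
      IsSimplyTransitiveOn (hurwitz n (UniversalCoxeterGroup n))
        (Red (π '' braidReflections y) (π (stdElement y)) n) ∧
      -- (3)
      (Set.BijOn (fun (t : Fin n → LoopGroup y) i => π (t i))
          (Red (braidReflections y) (stdElement y) n)
          (Red (π '' braidReflections y) (π (stdElement y)) n) ∧
        ∀ (β : BraidGroup n), ∀ t ∈ Red (braidReflections y) (stdElement y) n,
          (fun i => π (hurwitz n (LoopGroup y) β t i)) =
            hurwitz n (UniversalCoxeterGroup n) β (fun i => π (t i))) := by
  obtain ⟨e, he⟩ := exists_mulEquiv_freeGroup hy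
  exact main_of_mulEquiv n (stdReflection y) (braidReflections y) (braidReflections_eq_conjSet y) e he
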